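/- Let $G$ be a compact connected Lie group that is the product of a simply connected group and a torus, with Lie algebra $\mathfrak g$, an invariant inner product $\cdot$ on $\mathfrak g$ (used to identify $\mathfrak g\cong\mathfrak g^*$) and an orthonormal basis $e_a$ of $\mathfrak g$; put $f_{abc}=[e_a,e_b]\cdot e_c$ (repeated indices are summed). Let $\iota_T:T\hookrightarrow G$ be a maximal torus with Lie algebra $\mathfrak t$ and an orthonormal basis $e_k$ of $\mathfrak t$. *Weights.* Let $\Lambda^*\subset\mathfrak t$ be the weight lattice, i.e. the dual of the integral lattice $\ker(\exp:\mathfrak t\to T)$, and write $(\exp\xi)^\nu=e^{2\pi i\langle\nu,\xi\rangle}$ for $\nu\in\Lambda^*$. The roots are the $\alpha\in\mathfrak t\setminus\{0\}$ for which there is $x\ne 0$ in $\mathfrak g_{\mathbb C}$ with $[\xi,x]=2\pi i\langle\alpha,\xi\rangle x$ for all $\xi\in\mathfrak t$. Fix a closed Weyl chamber $\mathfrak t_+$, with set of positive roots $\mathfrak R_+$; let $\rho=\frac12\sum_{\alpha\in\mathfrak R_+}\alpha$ and $\Lambda^*_+=\Lambda^*\cap\mathfrak t_+$. For $\alpha\in\mathfrak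 R_+$ let $e_\alpha\in\mathfrak g_{\mathbb C}$ be a root vector, $[\xi,e_\alpha]=2\pi i\langle\alpha,\xi\rangle e_\alpha$ for $\xi\in\mathfrak t$, normalized by $e_\alpha\cdot e_{-\alpha}=1$ where $e_{-\alpha}=\overline{e_\alpha}$. For $\lambda\in\Lambda^*_+$ let $V_\lambda$ be the irreducible unitary $G$-representation with highest weight $\lambda$, let $v_\lambda$ be a highest weight vector of unit length, and put $\Delta_\lambda(g)=(v_\lambda,g\,v_\lambda)$. *Distributions.* Let $\mathcal E'(G)$ be the space of distributions on $G$. Through the Fourier coefficients $\nu\mapsto\langle u,t^\nu\rangle$, distributions $u\in\mathcal E'(T)$ are identified with the polynomially bounded functions on $\Lambda^*$. Let $\mathcal E'(T)^-\subset\mathcal E'(T)$ be the negative Hardy space of all $u$ with $\langle u,t^\nu\rangle=0$ for $\nu\notin\rho+\Lambda^*_+$, let $\pi^-:\mathcal E'(T)\to\mathcal E'(T)^-$ be the projection that sets all these coefficients to zero, and put $\delta_t^-=\pi^-(\delta_t)$. Define $r_G^T$ on $\mathcal E'(G)$ by $\langle r_G^T(u),t^{\lambda+\rho}\rangle=\langle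 u,\Delta_\lambda\rangle$ for $\lambda\in\Lambda^*_+$, all other Fourier coefficients being zero. *Clifford algebras.* Let $\mathrm{Cl}(\mathfrak g)_{\mathbb C}$ be the complex Clifford algebra with generators $x_\xi$, $\xi\in\mathfrak g$, and relations $x_\xi x_\eta+x_\eta x_\xi=\xi\cdot\eta$; write $x_a=x_{e_a}$. Let $\iota_\xi$ be the contractions, i.e. the odd derivations with $\iota_\xi x_\eta=\xi\cdot\eta$, and write $\iota_a=\iota_{e_a}$. Let $p_G^T:\mathrm{Cl}(\mathfrak g)_{\mathbb C}=\mathrm{Cl}(\mathfrak t)_{\mathbb C}\otimes\mathrm{Cl}(\mathfrak t^\perp)_{\mathbb C}\to\mathrm{Cl}(\mathfrak t)_{\mathbb C}$ be the orthogonal projection, and let $\mathcal T=\exp(\frac12r_{ab}\iota_a\iota_b)$, where $$r=r_{ab}\,e_a\otimes e_b=\tfrac12\sum_{\alpha\in\mathfrak R_+}(e_\alpha\otimes e_{-\alpha}-e_{-\alpha}\otimes e_\alpha).$$ Let $\tau:G\to\mathrm{Spin}(\mathfrak g)\subset\mathrm{Cl}(\mathfrak g)_{\mathbb C}$ be the homomorphism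 with $\tau(\exp\mu)=\exp\bigl(-\frac12f_{abc}\mu_ax_bx_c\bigr)$ for $\mu=\mu_ae_a\in\mathfrak g$. *Kernels.* Put $\widehat{\mathcal W}_G=\mathcal E'(G)\otimes\mathrm{Cl}(\mathfrak g)_{\mathbb C}$, let $\widehat{\mathcal W}_T^-=\mathcal E'(T)^-\otimes\mathrm{Cl}(\mathfrak t)_{\mathbb C}$ be the Hardy–Weil algebra, and let $\mathcal R_G^T=r_G^T\otimes(p_G^T\circ\mathcal T)$ be the restriction map, applied to the values of differential forms with coefficients in $\widehat{\mathcal W}_G$. Let $\bar\theta=\bar\theta_ae_a$ be the right-invariant Maurer–Cartan form of $G$ and $\theta^T=\theta^T_ke_k$ the Maurer–Cartan form of $T$, and let the kernels of the identity maps of $\widehat{\mathcal W}_G$ and $\widehat{\mathcal W}_T^-$ be $$\Lambda=e^{-x_a\bar\theta_a}\,\tau(g)\,\delta_g\in\widehat{\mathcal W}_G\otimes\Omega(G),\qquad \Lambda_T^-=e^{-x_k\theta^T_k}\,\delta_t^-\in\widehat{\mathcal W}_T^-\otimes\Omega(T),$$ with $\mathbb Z_2$-graded tensor products of Clifford algebras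 and complex-valued differential forms. Then the pull-back to $T$ of the kernel $\mathcal R_G^T(\Lambda)$ of the restriction map is $$\iota_T^*\,\mathcal R_G^T(\Lambda)=\Lambda_T^- .$$ Moreover $\rho\in\Lambda^*$, and $(p_G^T\circ\mathcal T)(\tau(t))=t^\rho$ for all $t\in T$. -/

import Mathlib

open scoped Manifold ContDiff TensorProduct Topology

noncomputable section

namespace GroupLocalization

universe u

instance instCompleteSpace (E : Type*) [NormedAddCommGroup E] [NormedSpace ℝ E]
    [FiniteDimensional ℝ E] : CompleteSpace E :=
  FiniteDimensional.complete ℝ E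

section Exponential

variable {E : Type*} [NormedAddCommGroup E] [NormedSpace ℝ E]
  {G : Type*} [TopologicalSpace G] [ChartedSpace E G] [Group G]

instance instLieGroupMinSmoothness [LieGroup 𝓘(ℝ, E) ∞ G] :
    LieGroup 𝓘(ℝ, E) (minSmoothness ℝ 3) G := by
  rw [minSmoothness_of_isRCLikeNormedField]
  infer_instance

/-- The Lie algebra `T_1 G`, with the bracket of left-invariant vector fields. -/
abbrev LieAlg (E G : Type*) [NormedAddCommGroup E] [NormedSpace ℝ E] [TopologicalSpace G]
    [ChartedSpace E G] [Group G] : Type _ :=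
  GroupLieAlgebra 𝓘(ℝ, E) G

open Classical in
/-- The Lie group exponential `exp ξ = γ 1`, where `γ` is the integral curve through `1` of the
left-invariant vector field of `ξ`. (On a Lie group such a `γ` exists and is unique.) -/
def lieExp (ξ : LieAlg E G) : G :=
  if h : ∃ γ : ℝ → G, γ 0 = 1 ∧ IsMIntegralCurve (I := 𝓘(ℝ, E)) γ (mulInvariantVectorField ξ)
  then h.choose 1 else 1

/-- The product of a simply connected group and a torus. -/
def IsSimplyConnectedTimesTorus (G : Type u) [TopologicalSpace G] [Group G] : Prop :=
  ∃ (K : Type u) (_ : TopologicalSpace K) (_ : Group K) (m : ℕ),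
    SimplyConnectedSpace K ∧ Nonempty (G ≃ₜ* K × (Fin m → Circle))

end Exponential

section Distributions

variable (E G : Type*) [NormedAddCommGroup E] [NormedSpace ℝ E]
  [TopologicalSpace G] [ChartedSpace E G]

/-- The space `C^∞(G)` of smooth complex-valued functions. -/
def SmoothFun : Submodule ℂ (G → ℂ) where
  carrier := {f | ContMDiff 𝓘(ℝ, E) 𝓘(ℝ, ℂ) ∞ f}
  add_mem' hf hg := ContMDiff.add hf hg
  zero_mem' := contMDiff_const
  smul_mem' c f hf := by
    have h : ContDiff ℝ ∞ (fun z : ℂ => c * z) := contDiff_const.mul contDiff_id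
    exact h.contMDiff.comp hf

variable {E G} [Group G]

/-- The derivative of `f` along the left-invariant vector field of `ξ`. -/
def leftDeriv (ξ : LieAlg E G) (f : G → ℂ) (g : G) : ℂ :=
  (mfderiv 𝓘(ℝ, E) 𝓘(ℝ, ℂ) f g (mulInvariantVectorField ξ g) : ℂ)

/-- The function `ξ₁ ⋯ ξₖ f`, with the `ξᵢ` acting as left-invariant vector fields, regarded as an
element of the space of functions with the topology of uniform convergence. -/
def iterLeftDeriv (L : List (LieAlg E G)) (f : SmoothFun E G) : UniformFun G ℂ :=
  UniformFun.ofFun (L.foldr leftDeriv (f : G → ℂ))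

/-- The `C^∞` topology of a compact Lie group: uniform convergence of all derivatives. -/
@[reducible]
def smoothTopology (E G : Type*) [NormedAddCommGroup E] [NormedSpace ℝ E]
    [TopologicalSpace G] [ChartedSpace E G] [Group G] : TopologicalSpace (SmoothFun E G) :=
  ⨅ L : List (LieAlg E G), TopologicalSpace.induced (iterLeftDeriv L) inferInstance

/-- The space `𝓔'(G)` of distributions on a compact Lie group: the continuous linear functionals
on `C^∞(G)`. -/
def Distr (E G : Type*) [NormedAddCommGroup E] [NormedSpace ℝ E]
    [TopologicalSpace G] [ChartedSpace E G] [Group G] :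
    Submodule ℂ (Module.Dual ℂ (SmoothFun E G)) where
  carrier := {u | @Continuous _ _ (smoothTopology E G) _ u}
  add_mem' hu hv := by
    let _ := smoothTopology E G
    exact Continuous.add hu hv
  zero_mem' := by
    let _ := smoothTopology E G
    exact continuous_const
  smul_mem' c u hu := by
    let _ := smoothTopology E G
    exact Continuous.const_smul hu c

/-- The delta distribution `δ_g`. -/
def delta (g : G) : Distr E G :=
  ⟨(LinearMap.proj g : (G → ℂ) →ₗ[ℂ] ℂ) ∘ₗ (SmoothFun E G).subtype, by
    let _ := smoothTopology E G
    have h1 : Continuous (iterLeftDeriv ([] : List (LieAlg E G))) :=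
      continuous_iff_le_induced.2 (iInf_le _ _)
    have h2 : Continuous (fun f : SmoothFun E G => (f : G → ℂ) g) :=
      (UniformFun.uniformContinuous_eval ℂ g).continuous.comp h1
    exact h2⟩

end Distributions

/-- The exponential `∑ aᵏ / k!` in a finite-dimensional complex algebra, with its standard
topology. -/
def algExp {A : Type*} [Ring A] [Algebra ℂ A] (a : A) : A :=
  letI : TopologicalSpace A := moduleTopology ℂ A
  ∑' k : ℕ, ((k.factorial : ℂ)⁻¹) • a ^ k

section CliffordForms

/-- The complex exterior algebra `∧ T*_g G ⊗ ℂ` of the cotangent space at `g`, generated by the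
complex-valued real-linear functionals on the tangent space. -/
abbrev ExtCot (E : Type*) {G : Type*} [NormedAddCommGroup E] [NormedSpace ℝ E]
    [TopologicalSpace G] [ChartedSpace E G] (g : G) : Type _ :=
  ExteriorAlgebra ℂ (TangentSpace 𝓘(ℝ, E) g →ₗ[ℝ] ℂ)

/-- The `ℤ/2`-graded tensor product of a Clifford algebra with `∧ T*_g G ⊗ ℂ`. -/
abbrev ClExt {V : Type*} [AddCommGroup V] [Module ℂ V] (Q : QuadraticForm ℂ V) (E : Type*)
    {G : Type*} [NormedAddCommGroup E] [NormedSpace ℝ E] [TopologicalSpace G] [ChartedSpace E G]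
    (g : G) : Type _ :=
  GradedTensorProduct ℂ (CliffordAlgebra.evenOdd Q)
    (CliffordAlgebra.evenOdd (0 : QuadraticForm ℂ (TangentSpace 𝓘(ℝ, E) g →ₗ[ℝ] ℂ)))

/-- The map `φ ⊗ ψ` between graded tensor products, for parity preserving linear maps `φ`, `ψ`. -/
def clExtMap {V V' : Type*} [AddCommGroup V] [Module ℂ V] [AddCommGroup V'] [Module ℂ V']
    {Q : QuadraticForm ℂ V} {Q' : QuadraticForm ℂ V'}
    {E E' : Type*} [NormedAddCommGroup E] [NormedSpace ℝ E]
    [NormedAddCommGroup E'] [NormedSpace ℝ E']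
    {G G' : Type*} [TopologicalSpace G] [ChartedSpace E G]
    [TopologicalSpace G'] [ChartedSpace E' G'] {g : G} {g' : G'}
    (φ : CliffordAlgebra Q →ₗ[ℂ] CliffordAlgebra Q') (ψ : ExtCot E g →ₗ[ℂ] ExtCot E' g') :
    ClExt Q E g →ₗ[ℂ] ClExt Q' E' g' :=
  (GradedTensorProduct.of ℂ _ _).toLinearMap ∘ₗ TensorProduct.map φ ψ ∘ₗ
    (GradedTensorProduct.of ℂ _ _).symm.toLinearMap

end CliffordForms


section Setup

variable {E F G T : Type*} [NormedAddCommGroup E] [NormedSpace ℝ E]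
  [FiniteDimensional ℝ E] [NormedAddCommGroup F] [NormedSpace ℝ F]
  [TopologicalSpace G] [ChartedSpace E G] [Group G] [LieGroup 𝓘(ℝ, E) ∞ G]
  [TopologicalSpace T] [ChartedSpace F T] [CommGroup T] [LieGroup 𝓘(ℝ, F) ∞ T]

/-- The complexification of a real vector space. -/
abbrev Cx (V : Type*) [AddCommGroup V] [Module ℝ V] : Type _ := ℂ ⊗[ℝ] V

/-- Complex conjugation on the complexification. -/
def cxConj {V : Type*} [AddCommGroup V] [Module ℝ V] : Cx V →ₗ[ℝ] Cx V :=
  LinearMap.rTensor V Complex.conjAe.toLinearMap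

/-- The quadratic form `ξ ↦ (ξ · ξ) / 2` on the complexification, for which the generators of the
Clifford algebra satisfy `x_ξ x_η + x_η x_ξ = ξ · η`. -/
def cliffForm {V : Type*} [AddCommGroup V] [Module ℝ V] (B : LinearMap.BilinForm ℝ V) :
    QuadraticForm ℂ (Cx V) :=
  ((1 / 2 : ℂ) • LinearMap.BilinForm.baseChange ℂ B).toQuadraticMap

/-- The complex Clifford algebra of a real inner product space. -/
abbrev Cl {V : Type*} [AddCommGroup V] [Module ℝ V] (B : LinearMap.BilinForm ℝ V) : Type _ :=
  CliffordAlgebra (cliffForm B)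

/-- The generator `x_ξ` for a real vector `ξ`. -/
def clGen {V : Type*} [AddCommGroup V] [Module ℝ V] (B : LinearMap.BilinForm ℝ V) (ξ : V) :
    Cl B :=
  CliffordAlgebra.ι (cliffForm B) (1 ⊗ₜ ξ)

/-- The contraction `ι_ξ`, i.e. the odd derivation of the Clifford algebra
with `ι_ξ x_η = ξ · η`. -/
def clContr {V : Type*} [AddCommGroup V] [Module ℝ V] (B : LinearMap.BilinForm ℝ V) :
    Cx V →ₗ[ℂ] Module.End ℂ (Cl B) :=
  CliffordAlgebra.contractLeft ∘ₗ LinearMap.BilinForm.baseChange ℂ B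

/-- The linear map `ξ ⊗ η ↦ ι_ξ ι_η`. -/
def clContr₂ {V : Type*} [AddCommGroup V] [Module ℝ V] (B : LinearMap.BilinForm ℝ V) :
    Cx V ⊗[ℂ] Cx V →ₗ[ℂ] Module.End ℂ (Cl B) :=
  TensorProduct.lift ((LinearMap.mul ℂ (Module.End ℂ (Cl B))).compl₁₂ (clContr B) (clContr B))

/-- The symbol map, which sends a product of pairwise orthogonal generators to the
corresponding wedge product. -/
def clSymbol {V : Type*} [AddCommGroup V] [Module ℝ V] (B : LinearMap.BilinForm ℝ V) :
    Cl B ≃ₗ[ℂ] ExteriorAlgebra ℂ (Cx V) :=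
  letI : Invertible (2 : ℂ) := invertibleOfNonzero two_ne_zero
  CliffordAlgebra.equivExterior (cliffForm B)

/-- The derivative `dφ : Lie(T) → Lie(G)` at the unit of a homomorphism `φ : T → G`. -/
def lieMap (φ : T →* G) : LieAlg F T →ₗ[ℝ] LieAlg E G where
  toFun ξ := (mfderiv 𝓘(ℝ, F) 𝓘(ℝ, E) φ 1 ξ : E)
  map_add' ξ η := map_add (mfderiv 𝓘(ℝ, F) 𝓘(ℝ, E) φ 1) ξ η
  map_smul' c ξ := map_smul (mfderiv 𝓘(ℝ, F) 𝓘(ℝ, E) φ 1) c ξ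

/-- The derivative at the unit of a map `f : G → ℂⁿ`. For `f g = π(g) v` it is `ξ ↦ dπ(ξ) v`. -/
def orbitDeriv {n : ℕ} (f : G → EuclideanSpace ℂ (Fin n)) :
    LieAlg E G →ₗ[ℝ] EuclideanSpace ℂ (Fin n) where
  toFun ξ := (mfderiv 𝓘(ℝ, E) 𝓘(ℝ, EuclideanSpace ℂ (Fin n)) f 1 ξ : EuclideanSpace ℂ (Fin n))
  map_add' ξ η := map_add (mfderiv 𝓘(ℝ, E) 𝓘(ℝ, EuclideanSpace ℂ (Fin n)) f 1) ξ η
  map_smul' c ξ := map_smul (mfderiv 𝓘(ℝ, E) 𝓘(ℝ, EuclideanSpace ℂ (Fin n)) f 1) c ξ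

/-- A maximal torus `T ⊆ G`, given as a compact connected abelian Lie group with its inclusion, and
an invariant inner product on the Lie algebra of `G`, with orthonormal bases `e_a` of `Lie(G)` and
`e_k` of `Lie(T)`. -/
structure TorusData (E F G T : Type*) [NormedAddCommGroup E] [NormedSpace ℝ E]
    [FiniteDimensional ℝ E] [NormedAddCommGroup F] [NormedSpace ℝ F]
    [TopologicalSpace G] [ChartedSpace E G] [Group G] [LieGroup 𝓘(ℝ, E) ∞ G]
    [TopologicalSpace T] [ChartedSpace F T] [CommGroup T] [LieGroup 𝓘(ℝ, F) ∞ T] where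
  incl : T →* G
  incl_smooth : ContMDiff 𝓘(ℝ, F) 𝓘(ℝ, E) ∞ incl
  incl_injective : Function.Injective incl
  incl_maximal : ∀ H : Subgroup G, IsClosed (H : Set G) → IsConnected (H : Set G) →
    (∀ a ∈ H, ∀ b ∈ H, a * b = b * a) → incl.range ≤ H → H = incl.range
  form : LinearMap.BilinForm ℝ (LieAlg E G)
  form_symm : ∀ ξ η, form ξ η = form η ξ
  form_pos : ∀ ξ, ξ ≠ 0 → 0 < form ξ ξ
  form_invariant : ∀ ξ η ζ, form ⁅ξ, η⁆ ζ = form ξ ⁅η, ζ⁆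
  basisG : Module.Basis (Fin (Module.finrank ℝ E)) ℝ (LieAlg E G)
  basisG_orthonormal : ∀ a b, form (basisG a) (basisG b) = if a = b then 1 else 0
  basisT : Module.Basis (Fin (Module.finrank ℝ F)) ℝ (LieAlg F T)
  basisT_orthonormal : ∀ k l,
    form (lieMap incl (basisT k)) (lieMap incl (basisT l)) = if k = l then 1 else 0

namespace TorusData

variable (S : TorusData E F G T)

/-- The induced inner product on the Lie algebra of `T`. -/
def formT : LinearMap.BilinForm ℝ (LieAlg F T) :=
  S.form.compl₁₂ (lieMap S.incl) (lieMap S.incl)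

/-- `[ξ, x] = 2πi ⟨α, ξ⟩ x` for all `ξ ∈ Lie(T)`. -/
def IsRootVector (α : LieAlg F T) (x : Cx (LieAlg E G)) : Prop :=
  ∀ ξ : LieAlg F T, (LieAlgebra.ad ℝ (LieAlg E G) (lieMap S.incl ξ)).baseChange ℂ x =
    (2 * Real.pi * Complex.I * (S.formT α ξ : ℂ)) • x

/-- The roots of `G`, as elements of `Lie(T)`. -/
def roots : Set (LieAlg F T) :=
  {α | α ≠ 0 ∧ ∃ x : Cx (LieAlg E G), x ≠ 0 ∧ S.IsRootVector α x}

/-- The weight lattice, dual to the integral lattice `ker exp`. -/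
def weightLattice : Set (LieAlg F T) :=
  {ν | ∀ ξ : LieAlg F T, lieExp ξ = (1 : T) → ∃ m : ℤ, S.formT ν ξ = m}

/-- `t^ν`, the value at `t = exp ξ` of the character `exp ξ ↦ e^{2πi⟨ν, ξ⟩}`. -/
def tpow (t : T) (ν : LieAlg F T) : ℂ :=
  Complex.exp (2 * Real.pi * Complex.I *
    (S.formT ν (Classical.epsilon fun ξ : LieAlg F T => lieExp ξ = t) : ℂ))

end TorusData

/-- A Weyl chamber, given by a regular element `reg` in its interior, and root vectors `e_α` for the
positive roots `α`, with `e_α · e_{-α} = 1` for `e_{-α}` the complex conjugate of `e_α`. -/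
structure RootData (E F G T : Type*) [NormedAddCommGroup E] [NormedSpace ℝ E]
    [FiniteDimensional ℝ E] [NormedAddCommGroup F] [NormedSpace ℝ F]
    [TopologicalSpace G] [ChartedSpace E G] [Group G] [LieGroup 𝓘(ℝ, E) ∞ G]
    [TopologicalSpace T] [ChartedSpace F T] [CommGroup T] [LieGroup 𝓘(ℝ, F) ∞ T]
    extends TorusData E F G T where
  reg : LieAlg F T
  reg_regular : ∀ α ∈ toTorusData.roots, toTorusData.formT α reg ≠ 0
  rootVec : LieAlg F T → Cx (LieAlg E G)
  rootVec_isRootVector : ∀ α ∈ toTorusData.roots, 0 < toTorusData.formT α reg →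
    toTorusData.IsRootVector α (rootVec α)
  rootVec_normalized : ∀ α ∈ toTorusData.roots, 0 < toTorusData.formT α reg →
    LinearMap.BilinForm.baseChange ℂ form (rootVec α) (cxConj (rootVec α)) = 1

namespace RootData

variable (S : RootData E F G T)

/-- The positive roots. -/
def posRoots : Set (LieAlg F T) := {α ∈ S.roots | 0 < S.formT α S.reg}

/-- The closed Weyl chamber containing `reg`. -/
def chamber : Set (LieAlg F T) := {ξ | ∀ α ∈ S.posRoots, 0 ≤ S.formT α ξ}

/-- The half-sum of the positive roots. -/
def rho : LieAlg F T := (1 / 2 : ℝ) • ∑ᶠ α ∈ S.posRoots, α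

/-- The dominant weights. -/
def dominant : Set (LieAlg F T) := S.weightLattice ∩ S.chamber

/-- The classical `r`-matrix `∑_{α > 0} e_α ∧ e_{-α}`. -/
def rMatrix : Cx (LieAlg E G) ⊗[ℂ] Cx (LieAlg E G) :=
  ∑ᶠ α ∈ S.posRoots, (1 / 2 : ℂ) •
    (S.rootVec α ⊗ₜ[ℂ] cxConj (S.rootVec α) - cxConj (S.rootVec α) ⊗ₜ[ℂ] S.rootVec α)

/-- The twist `exp(½ r_{ab} ι_a ι_b)` on the Clifford algebra of `Lie(G)`. -/
def twist : Module.End ℂ (Cl S.form) :=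
  algExp ((1 / 2 : ℂ) • clContr₂ S.form S.rMatrix)

/-- The orthogonal projection `Lie(G) → Lie(T)`. -/
def projT : LieAlg E G →ₗ[ℝ] LieAlg F T :=
  ∑ k, (S.form (lieMap S.incl (S.basisT k))).smulRight (S.basisT k)

/-- The orthogonal projection `Cl(g) = Cl(t) ⊗ Cl(t^⊥) → Cl(t)`. Under the symbol maps it is the
projection `∧g = ∧t ⊗ ∧t^⊥ → ∧t` induced by the orthogonal projection `g → t`. -/
def clProj : Cl S.form →ₗ[ℂ] Cl S.formT :=
  (clSymbol S.formT).symm.toLinearMap ∘ₗ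
    (ExteriorAlgebra.map (S.projT.baseChange ℂ)).toLinearMap ∘ₗ (clSymbol S.form).toLinearMap

/-- The structure constants `f_{abc} = [e_a, e_b] · e_c`. -/
def structConst (a b c : Fin (Module.finrank ℝ E)) : ℝ :=
  S.form ⁅S.basisG a, S.basisG b⁆ (S.basisG c)

/-- `-½ f_{abc} μ_a x_b x_c`, the image of `μ` under `g → so(g) ⊆ Cl(g)`. -/
def spinLie (μ : LieAlg E G) : Cl S.form :=
  (-(1 / 2 : ℂ)) • ∑ a, ∑ b, ∑ c,
    ((S.structConst a b c * S.form μ (S.basisG a) : ℝ) : ℂ) •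
      (clGen S.form (S.basisG b) * clGen S.form (S.basisG c))

open Classical in
/-- The homomorphism `τ : G → Spin(g) ⊆ Cl(g)` with `τ(exp μ) = exp(-½ f_{abc} μ_a x_b x_c)`.
(It exists and is unique if `G` is the product of a simply connected group and a torus.) -/
def tau : G →* Cl S.form :=
  if h : ∃ τ : G →* Cl S.form, ∀ μ : LieAlg E G, τ (lieExp μ) = algExp (S.spinLie μ)
  then h.choose else 1

/-- The restriction `p ∘ 𝒯 : Cl(g) → Cl(t)`. -/
def clRestr : Cl S.form →ₗ[ℂ] Cl S.formT := S.clProj ∘ₗ S.twist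

/-- A model of the irreducible representation `V_λ`: a smooth irreducible unitary
representation on `ℂⁿ`, with a highest weight vector of unit length and weight `λ`. -/
structure HighestWeightRep (wt : LieAlg F T) where
  n : ℕ
  rep : Representation ℂ G (EuclideanSpace ℂ (Fin n))
  rep_smooth : ∀ v, ContMDiff 𝓘(ℝ, E) 𝓘(ℝ, EuclideanSpace ℂ (Fin n)) ∞ (fun g => rep g v)
  rep_unitary : ∀ g v w, inner ℂ (rep g v) (rep g w) = inner ℂ v w
  rep_irreducible : rep.IsIrreducible
  vec : EuclideanSpace ℂ (Fin n)
  vec_unit : ‖vec‖ = 1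
  vec_weight : ∀ t : T, rep (S.incl t) vec = S.tpow t wt • vec
  vec_highest : ∀ α ∈ S.posRoots,
    LinearMap.liftBaseChange ℂ (orbitDeriv (fun g => rep g vec)) (S.rootVec α) = 0

/-- The function `Δ_λ(g) = (v_λ, g v_λ)`. -/
def HighestWeightRep.spherical {S : RootData E F G T} {wt : LieAlg F T}
    (V : S.HighestWeightRep wt) : SmoothFun E G :=
  ⟨fun g => inner ℂ V.vec (V.rep g V.vec), by
    have h : ContDiff ℝ ∞ (fun w : EuclideanSpace ℂ (Fin V.n) => inner ℂ V.vec w) :=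
      ((innerSL ℂ V.vec).restrictScalars ℝ).contDiff
    exact h.contMDiff.comp (V.rep_smooth V.vec)⟩

/-- Formal Fourier series on `T`, given by their coefficients `ν ↦ ⟨u, t^ν⟩`. -/
abbrev FourierSeries : Type _ := S.weightLattice → ℂ

/-- The space `𝓔'(T)` of distributions on `T`, identified through their Fourier coefficients with the
polynomially bounded functions on the weight lattice. -/
def torusDistr : Submodule ℂ S.FourierSeries where
  carrier := {u | ∃ (C : ℝ) (N : ℕ), ∀ ν : S.weightLattice,
    ‖u ν‖ ≤ C * (1 + Real.sqrt (S.formT ν ν)) ^ N}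
  add_mem' := by
    rintro u v ⟨C, N, hu⟩ ⟨C', N', hv⟩
    refine ⟨|C| + |C'|, max N N', fun ν => ?_⟩
    have h1 : (1 : ℝ) ≤ 1 + Real.sqrt (S.formT ν ν) := by
      linarith [Real.sqrt_nonneg (S.formT ν ν)]
    have h2 : (1 + Real.sqrt (S.formT ν ν)) ^ N ≤ (1 + Real.sqrt (S.formT ν ν)) ^ max N N' :=
      pow_le_pow_right₀ h1 (le_max_left _ _)
    have h3 : (1 + Real.sqrt (S.formT ν ν)) ^ N' ≤ (1 + Real.sqrt (S.formT ν ν)) ^ max N N' :=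
      pow_le_pow_right₀ h1 (le_max_right _ _)
    calc ‖(u + v) ν‖ ≤ ‖u ν‖ + ‖v ν‖ := norm_add_le _ _
      _ ≤ C * (1 + Real.sqrt (S.formT ν ν)) ^ N + C' * (1 + Real.sqrt (S.formT ν ν)) ^ N' :=
        add_le_add (hu ν) (hv ν)
      _ ≤ |C| * (1 + Real.sqrt (S.formT ν ν)) ^ max N N' +
          |C'| * (1 + Real.sqrt (S.formT ν ν)) ^ max N N' := by
        gcongr <;> exact le_abs_self _
      _ = _ := by ring
  zero_mem' := ⟨0, 0, fun ν => by simp⟩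
  smul_mem' := by
    rintro c u ⟨C, N, hu⟩
    refine ⟨‖c‖ * C, N, fun ν => ?_⟩
    calc ‖(c • u) ν‖ = ‖c‖ * ‖u ν‖ := by simp
      _ ≤ ‖c‖ * (C * (1 + Real.sqrt (S.formT ν ν)) ^ N) := by gcongr; exact hu ν
      _ = _ := by ring

/-- The negative Hardy space `𝓔'(T)⁻`: the distributions on `T` with `⟨u, t^ν⟩ = 0` unless
`ν ∈ ρ + Λ*₊`. -/
def hardy : Submodule ℂ S.FourierSeries where
  carrier := {u | u ∈ S.torusDistr ∧ ∀ ν : S.weightLattice, (ν : LieAlg F T) - S.rho ∉ S.dominant →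
    u ν = 0}
  add_mem' hu hv := ⟨add_mem hu.1 hv.1, fun ν hν => by simp [hu.2 ν hν, hv.2 ν hν]⟩
  zero_mem' := ⟨zero_mem _, fun _ _ => rfl⟩
  smul_mem' c _ hu := ⟨Submodule.smul_mem _ c hu.1, fun ν hν => by simp [hu.2 ν hν]⟩

/-- The delta distribution `δ_t` on `T`, with `⟨δ_t, t^ν⟩ = t^ν`. -/
def torusDelta (t : T) : S.torusDistr :=
  ⟨fun ν => S.tpow t ν, 1, 0, fun ν => by
    have h : ∀ x : ℝ, ‖Complex.exp (2 * Real.pi * Complex.I * (x : ℂ))‖ = 1 := fun x => by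
      rw [mul_right_comm]
      exact_mod_cast Complex.norm_exp_ofReal_mul_I (2 * Real.pi * x)
    exact (h _).le.trans (by simp)⟩

open Classical in
/-- The Szegő projector `π⁻ : 𝓔'(T) → 𝓔'(T)⁻`. -/
def szego : S.torusDistr →ₗ[ℂ] S.hardy where
  toFun u := ⟨fun ν => if (ν : LieAlg F T) - S.rho ∈ S.dominant then (u : S.FourierSeries) ν else 0,
    by
      obtain ⟨C, N, hu⟩ := u.2
      refine ⟨⟨C, N, fun ν => ?_⟩, fun ν hν => by simp [hν]⟩
      by_cases h : (ν : LieAlg F T) - S.rho ∈ S.dominant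
      · simpa [h] using hu ν
      · simpa [h] using (norm_nonneg _).trans (hu ν)⟩
  map_add' u v := by
    ext ν
    by_cases h : (ν : LieAlg F T) - S.rho ∈ S.dominant <;> simp [h]
  map_smul' c u := by
    ext ν
    by_cases h : (ν : LieAlg F T) - S.rho ∈ S.dominant <;> simp [h]

open Classical in
/-- The map `r_G^T`, with `⟨r_G^T(u), t^{λ+ρ}⟩ = ⟨u, Δ_λ⟩` for dominant weights `λ`, and with all
other Fourier coefficients zero. -/
def distrRestr (V : ∀ wt : S.dominant, S.HighestWeightRep wt) :
    Distr E G →ₗ[ℂ] S.FourierSeries where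
  toFun u ν := if h : (ν : LieAlg F T) - S.rho ∈ S.dominant
    then (u : Module.Dual ℂ (SmoothFun E G)) (V ⟨_, h⟩).spherical else 0
  map_add' u v := by
    ext ν
    by_cases h : (ν : LieAlg F T) - S.rho ∈ S.dominant <;> simp [h]
  map_smul' c u := by
    ext ν
    by_cases h : (ν : LieAlg F T) - S.rho ∈ S.dominant <;> simp [h]

/-- Differential forms on `G` with values in `𝓔'(G) ⊗ Cl(g)`, as sections over `G`. -/
abbrev WeilFormG : Type _ := ∀ g : G, Distr E G ⊗[ℂ] ClExt (cliffForm S.form) E g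

/-- The restriction map `R_G^T = r_G^T ⊗ (p ∘ 𝒯)`, applied to the values of a form on `G`. -/
def weilRestr (V : ∀ wt : S.dominant, S.HighestWeightRep wt) (β : S.WeilFormG) (g : G) :
    S.FourierSeries ⊗[ℂ] ClExt (cliffForm S.formT) E g :=
  TensorProduct.map (S.distrRestr V) (clExtMap S.clRestr LinearMap.id) (β g)

/-- The pull-back `T*_{ι(t)} G ⊗ ℂ → T*_t T ⊗ ℂ` under the inclusion. -/
def cotPullback (t : T) : (TangentSpace 𝓘(ℝ, E) (S.incl t) →ₗ[ℝ] ℂ) →ₗ[ℂ]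
    (TangentSpace 𝓘(ℝ, F) t →ₗ[ℝ] ℂ) where
  toFun φ := φ ∘ₗ (mfderiv 𝓘(ℝ, F) 𝓘(ℝ, E) S.incl t).toLinearMap
  map_add' _ _ := rfl
  map_smul' _ _ := rfl

/-- The pull-back `ι_T^*` of a form on `G` with values in `W ⊗ Cl(t)`. -/
def formPullback {W : Type*} [AddCommGroup W] [Module ℂ W]
    (β : ∀ g : G, W ⊗[ℂ] ClExt (cliffForm S.formT) E g) (t : T) :
    W ⊗[ℂ] ClExt (cliffForm S.formT) F t :=
  TensorProduct.map LinearMap.id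
    (clExtMap LinearMap.id (ExteriorAlgebra.map (S.cotPullback t)).toLinearMap) (β (S.incl t))

/-- The component `θ̄_a` at `g` of the right-invariant Maurer-Cartan form of `G`, whose value on a
tangent vector `w` is `(dR_{g⁻¹} w) · e_a`. -/
def mcRight (g : G) (a : Fin (Module.finrank ℝ E)) : TangentSpace 𝓘(ℝ, E) g →ₗ[ℝ] ℂ :=
  Complex.ofRealCLM.toLinearMap ∘ₗ S.form.flip (S.basisG a) ∘ₗ
    (show TangentSpace 𝓘(ℝ, E) g →ₗ[ℝ] LieAlg E G from
      (mfderiv 𝓘(ℝ, E) 𝓘(ℝ, E) (fun h : G => h * g⁻¹) g).toLinearMap)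

/-- The component `θ_k^T` at `t` of the Maurer-Cartan form of `T`. -/
def mcTorus (t : T) (k : Fin (Module.finrank ℝ F)) : TangentSpace 𝓘(ℝ, F) t →ₗ[ℝ] ℂ :=
  Complex.ofRealCLM.toLinearMap ∘ₗ S.formT.flip (S.basisT k) ∘ₗ
    (show TangentSpace 𝓘(ℝ, F) t →ₗ[ℝ] LieAlg F T from
      (mfderiv 𝓘(ℝ, F) 𝓘(ℝ, F) (fun s : T => t⁻¹ * s) t).toLinearMap)

/-- The kernel of the identity map `Λ = e^{-x_a θ̄_a} τ(g) δ_g`. -/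
def kernelG : S.WeilFormG := fun g =>
  delta g ⊗ₜ[ℂ]
    (algExp (-∑ a, GradedTensorProduct.tmul ℂ (clGen S.form (S.basisG a))
        (ExteriorAlgebra.ι ℂ (S.mcRight g a))) *
      GradedTensorProduct.tmul ℂ (S.tau g) 1)

/-- The kernel `Λ_T⁻ = e^{-x_k θ_k^T} δ_t⁻` of the identity map of the Hardy-Weil algebra, with
`δ_t⁻ = π⁻(δ_t)`. -/
def kernelT (t : T) : S.hardy ⊗[ℂ] ClExt (cliffForm S.formT) F t :=
  S.szego (S.torusDelta t) ⊗ₜ[ℂ]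
    algExp (-∑ k, GradedTensorProduct.tmul ℂ (clGen S.formT (S.basisT k))
      (ExteriorAlgebra.ι ℂ (S.mcTorus t k)))

end RootData
end Setup

end GroupLocalization

end

set_option linter.unusedSectionVars false

/-! The two tensor factors of the restriction map act separately on the kernel `δ_g ⊗ e^{-xθ̄}
τ(g)`, and at a point of `T` each of them is off by the character `t^ρ`, in opposite directions.

Distributions. Since `v_λ` is a unit weight vector, `Δ_λ(t) = t^λ` on `T`. The coefficient of
`r_G^T(δ_t)` at `λ + ρ` is therefore `t^λ` and not `t^{λ+ρ}`, so `t^ρ r_G^T(δ_t) = δ_t⁻`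
(`distrRestr_delta`).

Clifford algebras. Under the symbol map, left multiplication by `x_v` becomes `v∧ + ½ι_v`.
Conjugation by the twist adds a contraction to `x_v`, and for `v = e_{-α}` this contraction is
exactly `-½ι_v`. What remains is the wedge product with `e_{-α}`, which the projection to `t` kills.
So `p ∘ 𝒯` annihilates the right ideal generated by the `x_{e_{-α}}` (`clNormal_clVec_mul_eq_zero`),
while it commutes with left multiplication by `x_ξ` for `ξ` in `t` (`clNormal_clVec_mul`). The
exponent of `τ(exp ξ)`, with the negative root vectors ordered to the left, is `2πi⟨ρ, ξ⟩` plus an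
element of that ideal (`spinElem_incl`), and only the scalar survives: `(p ∘ 𝒯)(τ(exp ξ)) =
e^{2πi⟨ρ, ξ⟩}`. For `exp ξ = 1` the left side is `1`, so `ρ` is a weight. Since `θ̄` pulls back to
`θ^T`, which has components in `t` only, the second property carries `e^{-xθ̄}` to `e^{-xθ^T}`
(`clExtMap_algExp_mul`).

Two structural facts support this. The expansion in root vectors needs `t` to be its own
centralizer, which comes from maximality of `T`, and one-dimensional root spaces
(`mem_range_lieMap_of_lie_eq_zero`, `eq_zero_of_form_cxConj_eq_zero`). The existence of `τ` comes
from lifting through the group of pairs `(g, u)` in which `u` covers `Ad g`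
(`exists_monoidHom_algExp`). Both rest on the fact that the derivative of `Ad` is the bracket. -/

namespace GroupLocalization

/-! ### Exponentials in finite-dimensional complex algebras. -/

section AlgExp

/-- A norm on a finite-dimensional complex algebra, from its left regular representation. -/
@[reducible]
noncomputable def finiteNormedRing (A : Type*) [Ring A] [Algebra ℂ A] [FiniteDimensional ℂ A] :
    NormedRing A :=
  letI := Matrix.linftyOpNormedRing (n := Fin (Module.finrank ℂ A)) (α := ℂ)
  NormedRing.induced A (Matrix (Fin (Module.finrank ℂ A)) (Fin (Module.finrank ℂ A)) ℂ)
    (Algebra.leftMulMatrix (Module.finBasis ℂ A)) (Algebra.leftMulMatrix_injective _)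

/-- The norm of `finiteNormedRing` is a norm of complex algebras. -/
@[reducible]
noncomputable def finiteNormedAlgebra (A : Type*) [Ring A] [Algebra ℂ A] [FiniteDimensional ℂ A] :
    @NormedAlgebra ℂ A _ (finiteNormedRing A).toSeminormedRing :=
  letI := Matrix.linftyOpNormedRing (n := Fin (Module.finrank ℂ A)) (α := ℂ)
  letI := Matrix.linftyOpNormedAlgebra (n := Fin (Module.finrank ℂ A)) (R := ℂ) (α := ℂ)
  NormedAlgebra.induced ℂ A (Matrix (Fin (Module.finrank ℂ A)) (Fin (Module.finrank ℂ A)) ℂ)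
    (Algebra.leftMulMatrix (Module.finBasis ℂ A))

/-- A finite-dimensional normed algebra carries the module topology, so the value of `algExp` does
not depend on the norm chosen to compute it. -/
theorem algExp_eq_exp {A : Type*} [NormedRing A] [NormedAlgebra ℂ A] [FiniteDimensional ℂ A]
    (a : A) : algExp a = NormedSpace.exp a := by
  have h : IsModuleTopology ℂ A := isModuleTopologyOfFiniteDimensional
  rw [NormedSpace.exp_eq_tsum ℂ, algExp, ← eq_moduleTopology ℂ A]

variable {A A' C : Type*} [Ring A] [Algebra ℂ A] [FiniteDimensional ℂ A]
  [Ring A'] [Algebra ℂ A'] [FiniteDimensional ℂ A']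
  [AddCommGroup C] [Module ℂ C]

theorem hasSum_algExp [TopologicalSpace C] [ContinuousAdd C] [ContinuousSMul ℂ C]
    (f : A →ₗ[ℂ] C) (a : A) :
    HasSum (fun n : ℕ => ((n.factorial : ℂ)⁻¹) • f (a ^ n)) (f (algExp a)) := by
  let _ := finiteNormedRing A
  let _ := finiteNormedAlgebra A
  have : CompleteSpace A := FiniteDimensional.complete ℂ A
  let _ : NormedAlgebra ℚ A := NormedAlgebra.restrictScalars ℚ ℂ A
  have h := NormedSpace.exp_series_hasSum_exp' (𝕂 := ℂ) a
  rw [← algExp_eq_exp] at h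
  have hf : Continuous f := by
    have h : IsModuleTopology ℂ A := isModuleTopologyOfFiniteDimensional
    exact IsModuleTopology.continuous_of_linearMap f
  simpa only [Function.comp_def, map_smul] using h.map f hf

/-- Linear maps are continuous here, so they may be applied term by term. No multiplicativity is
required, which allows anti-automorphisms, evaluations and the restriction `p ∘ 𝒯`. -/
theorem map_algExp_congr [FiniteDimensional ℂ C] (f : A →ₗ[ℂ] C) (g : A' →ₗ[ℂ] C) (a : A) (b : A')
    (h : ∀ n : ℕ, f (a ^ n) = g (b ^ n)) : f (algExp a) = g (algExp b) := by
  let e := (Module.finBasis ℂ C).equivFun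
  have h1 := hasSum_algExp (e.toLinearMap ∘ₗ f) a
  have h2 := hasSum_algExp (e.toLinearMap ∘ₗ g) b
  apply e.injective
  refine h1.unique (h2.congr_fun fun n => ?_)
  simp [h n]

/-- All terms of the series except the constant one lie in the right ideal `a A`. -/
theorem map_algExp_eq_one [FiniteDimensional ℂ C] (f : A →ₗ[ℂ] C) (a : A)
    (h : ∀ x, f (a * x) = 0) : f (algExp a) = f 1 := by
  rw [← sub_eq_zero, ← map_sub, ← LinearMap.mem_ker]
  let e := (Module.finBasis ℂ C).equivFun
  have h1 := hasSum_algExp (e.toLinearMap ∘ₗ f) a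
  have h2 := h1.unique (hasSum_single 0 fun n hn => by
    obtain ⟨m, rfl⟩ := Nat.exists_eq_succ_of_ne_zero hn
    simp [pow_succ', h])
  have h3 : f (algExp a) = f 1 := e.injective (by simpa using h2)
  simp [h3]

/-- The series `e^{ad D} X` stops after its linear term, because `[D, X] = Z` commutes with `D`. -/
theorem algExp_mul_eq {D X Z : A} (h1 : D * X = X * D + Z) (h2 : D * Z = Z * D) :
    algExp D * X = (X + Z) * algExp D := by
  have key : ∀ n : ℕ, D ^ (n + 1) * X = X * D ^ (n + 1) + (n + 1 : ℂ) • (Z * D ^ n) := by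
    intro n
    induction n with
    | zero => simpa using h1
    | succ n ih =>
      have h3 : Commute D Z := h2
      rw [pow_succ', mul_assoc, ih, mul_add, ← mul_assoc, h1, mul_smul_comm, ← mul_assoc, h2,
        add_mul, mul_assoc, mul_assoc, ← pow_succ', ← pow_succ', add_assoc]
      push_cast
      module
  let _ := finiteNormedRing A
  let _ := finiteNormedAlgebra A
  have k1 := hasSum_algExp (LinearMap.mulRight ℂ X) D
  have k2 := hasSum_algExp (LinearMap.mulLeft ℂ X) D
  have k3 := hasSum_algExp (LinearMap.mulLeft ℂ Z) D
  simp only [LinearMap.mulRight_apply, LinearMap.mulLeft_apply] at k1 k2 k3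
  -- Dropping the constant terms aligns the indices: `(n + 1) / (n + 1)! = 1 / n!` turns the
  -- remaining series into the one for `Z e^D`.
  rw [← hasSum_nat_add_iff' 1] at k1 k2
  have k4 := k1.unique ((k2.add k3).congr_fun fun n => ?_)
  · simp only [Finset.range_one, Finset.sum_singleton, Nat.factorial_zero, Nat.cast_one, inv_one,
      pow_zero, one_mul, mul_one, one_smul] at k4
    rw [add_mul]
    rw [sub_eq_iff_eq_add.1 k4]
    abel
  · rw [key, Nat.factorial_succ, smul_add, smul_smul]
    congr 2
    push_cast
    have : (n.factorial : ℂ) ≠ 0 := by exact_mod_cast n.factorial_ne_zero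
    have : (n + 1 : ℂ) ≠ 0 := by exact_mod_cast n.succ_ne_zero
    field_simp

theorem algExp_zero : algExp (0 : A) = 1 := by
  simpa using map_algExp_eq_one LinearMap.id (0 : A) (by simp)

theorem algExp_add_of_commute {a b : A} (h : Commute a b) :
    algExp (a + b) = algExp a * algExp b := by
  let _ := finiteNormedRing A
  let _ := finiteNormedAlgebra A
  have : CompleteSpace A := FiniteDimensional.complete ℂ A
  let _ : NormedAlgebra ℚ A := NormedAlgebra.restrictScalars ℚ ℂ A
  rw [algExp_eq_exp, algExp_eq_exp, algExp_eq_exp, NormedSpace.exp_add_of_commute h]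

theorem algExp_algebraMap (c : ℂ) : algExp (algebraMap ℂ A c) = algebraMap ℂ A (Complex.exp c) := by
  have h := map_algExp_congr (LinearMap.id) (Algebra.linearMap ℂ A) (algebraMap ℂ A c) c
    (by simp)
  simpa [algExp_eq_exp, Complex.exp_eq_exp_ℂ] using h

end AlgExp
-- Clifford algebras: contractions and the symbol map.
section Clifford

variable {V : Type*} [AddCommGroup V] [Module ℝ V] (B : LinearMap.BilinForm ℝ V)

/-- The complex-bilinear extension of a real bilinear form. -/
noncomputable abbrev cxForm : LinearMap.BilinForm ℂ (Cx V) := LinearMap.BilinForm.baseChange ℂ B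

/-- The generator `x_v` of the Clifford algebra for a complex vector `v`. -/
noncomputable abbrev clVec : Cx V →ₗ[ℂ] Cl B := CliffordAlgebra.ι (cliffForm B)

instance finiteDimensional_exteriorAlgebra {W : Type*} [AddCommGroup W] [Module ℂ W]
    [FiniteDimensional ℂ W] : FiniteDimensional ℂ (ExteriorAlgebra ℂ W) :=
  Module.Basis.finiteDimensional_of_finite (Module.finBasis ℂ W).ExteriorAlgebra

instance finiteDimensional_clifford {W : Type*} [AddCommGroup W] [Module ℂ W]
    [FiniteDimensional ℂ W] (Q : QuadraticForm ℂ W) : FiniteDimensional ℂ (CliffordAlgebra Q) :=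
  let _ : Invertible (2 : ℂ) := invertibleOfNonzero two_ne_zero
  (CliffordAlgebra.equivExterior Q).symm.finiteDimensional

theorem cxForm_symm (hB : ∀ v w, B v w = B w v) (v w : Cx V) : cxForm B v w = cxForm B w v :=
  (LinearMap.BilinForm.IsSymm.baseChange ℂ (B₂ := B) ⟨hB⟩).eq v w

theorem clVec_mul_add_swap (hB : ∀ v w, B v w = B w v) (v w : Cx V) :
    clVec B v * clVec B w + clVec B w * clVec B v = algebraMap ℂ (Cl B) (cxForm B v w) := by
  rw [CliffordAlgebra.ι_mul_ι_add_swap]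
  congr 1
  simp only [cliffForm, QuadraticMap.polar, LinearMap.BilinMap.toQuadraticMap_apply,
    LinearMap.smul_apply, map_add, LinearMap.add_apply, smul_eq_mul]
  rw [cxForm_symm B hB w v]
  ring

theorem clContr_clVec_mul (v w : Cx V) (y : Cl B) :
    clContr B v (clVec B w * y) = cxForm B v w • y - clVec B w * clContr B v y :=
  CliffordAlgebra.contractLeft_ι_mul _ _ _

theorem clContr_one (v : Cx V) : clContr B v 1 = 0 :=
  CliffordAlgebra.contractLeft_one _ _

theorem clContr_mul_comm (v w : Cx V) : clContr B v * clContr B w = -(clContr B w * clContr B v) :=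
  LinearMap.ext fun _ => CliffordAlgebra.contractLeft_comm _ _ _

theorem associated_cliffForm_apply [Invertible (2 : ℂ)] (hB : ∀ v w, B v w = B w v) (v : Cx V) :
    QuadraticMap.associated (R := ℂ) (-cliffForm B) v = -((1 / 2 : ℂ) • cxForm B v) := by
  rw [map_neg, LinearMap.neg_apply, cliffForm,
    QuadraticMap.associated_left_inverse ℂ (B₁ := (1 / 2 : ℂ) • cxForm B) fun x y => by
      simp only [LinearMap.smul_apply, cxForm_symm B hB x y]]
  rfl

theorem clSymbol_one : clSymbol B 1 = 1 := by
  let _ : Invertible (2 : ℂ) := invertibleOfNonzero two_ne_zero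
  exact CliffordAlgebra.changeForm_one CliffordAlgebra.changeForm.associated_neg_proof

/-- Chevalley's description of Clifford multiplication. The `½` reflects the normalization `x_v² = ½
v · v`; it is the term that the twist later cancels. -/
theorem clSymbol_clVec_mul (hB : ∀ v w, B v w = B w v) (v : Cx V) (y : Cl B) :
    clSymbol B (clVec B v * y) = ExteriorAlgebra.ι ℂ v * clSymbol B y +
      (1 / 2 : ℂ) • CliffordAlgebra.contractLeft (cxForm B v) (clSymbol B y) := by
  let _ : Invertible (2 : ℂ) := invertibleOfNonzero two_ne_zero
  have h : clSymbol B (clVec B v * y) = ExteriorAlgebra.ι ℂ v * clSymbol B y -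
    CliffordAlgebra.contractLeft (QuadraticMap.associated (R := ℂ) (-cliffForm B) v)
      (clSymbol B y) := CliffordAlgebra.changeForm_ι_mul
    CliffordAlgebra.changeForm.associated_neg_proof v y
  rw [h, associated_cliffForm_apply B hB]
  simp only [map_neg, map_smul, sub_neg_eq_add, LinearMap.neg_apply, LinearMap.smul_apply]

theorem clSymbol_clContr (v : Cx V) (y : Cl B) :
    clSymbol B (clContr B v y) = CliffordAlgebra.contractLeft (cxForm B v) (clSymbol B y) := by
  let _ : Invertible (2 : ℂ) := invertibleOfNonzero two_ne_zero
  exact CliffordAlgebra.changeForm_contractLeft CliffordAlgebra.changeForm.associated_neg_proof _ _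

theorem exteriorMap_contractLeft {W W' : Type*} [AddCommGroup W] [Module ℂ W] [AddCommGroup W']
    [Module ℂ W'] (P : W →ₗ[ℂ] W') (d : Module.Dual ℂ W') (y : ExteriorAlgebra ℂ W) :
    ExteriorAlgebra.map P (CliffordAlgebra.contractLeft (d ∘ₗ P) y) =
      CliffordAlgebra.contractLeft d (ExteriorAlgebra.map P y : ExteriorAlgebra ℂ W') := by
  induction y using CliffordAlgebra.left_induction with
  | algebraMap r =>
    have h : ExteriorAlgebra.map P (algebraMap ℂ (ExteriorAlgebra ℂ W) r) = algebraMap ℂ _ r :=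
      AlgHom.commutes _ _
    have h1 := CliffordAlgebra.contractLeft_algebraMap (Q := (0 : QuadraticForm ℂ W)) (d ∘ₗ P) r
    have h2 := CliffordAlgebra.contractLeft_algebraMap (Q := (0 : QuadraticForm ℂ W')) d r
    rw [h1, map_zero]
    exact (h2.symm.trans (congrArg _ h.symm))
  | add x y hx hy =>
    rw [map_add, map_add, hx, hy]
    exact ((congrArg _ (map_add _ x y)).trans (map_add _ _ _)).symm
  | ι_mul x m hx =>
    have h1 := CliffordAlgebra.contractLeft_ι_mul (Q := (0 : QuadraticForm ℂ W)) (d ∘ₗ P) m x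
    have h2 := CliffordAlgebra.contractLeft_ι_mul (Q := (0 : QuadraticForm ℂ W')) d (P m)
      (ExteriorAlgebra.map P x)
    have h3 : ExteriorAlgebra.map P (ExteriorAlgebra.ι ℂ m * x) =
      ExteriorAlgebra.ι ℂ (P m) * ExteriorAlgebra.map P x := by
      rw [map_mul, ExteriorAlgebra.map_apply_ι]
    have h4 : ∀ z, ExteriorAlgebra.map P (ExteriorAlgebra.ι ℂ m * z) =
      ExteriorAlgebra.ι ℂ (P m) * ExteriorAlgebra.map P z := fun z => by
      rw [map_mul, ExteriorAlgebra.map_apply_ι]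
    refine (congrArg _ h1).trans (Eq.trans ?_ (h2.symm.trans (congrArg _ h3.symm)))
    rw [map_sub, map_smul]
    erw [h4, hx]
    rfl

/-- The number operator `N = ∑ e_i ∧ ι_i` multiplies degree `n` by `n`. If all contractions kill `y`
then `N y = 0`, and in characteristic zero only the degree zero component is left. -/
theorem contractLeft_clifford_zero_eq_zero {W : Type*} [AddCommGroup W] [Module ℂ W]
    [FiniteDimensional ℂ W] (y : ExteriorAlgebra ℂ W)
    (h : ∀ d : Module.Dual ℂ W, CliffordAlgebra.contractLeft d y = 0) :
    ∃ c : ℂ, y = algebraMap ℂ (ExteriorAlgebra ℂ W) c := by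
  classical
  let b := Module.finBasis ℂ W
  let N : ExteriorAlgebra ℂ W →ₗ[ℂ] ExteriorAlgebra ℂ W :=
    ∑ i, LinearMap.mulLeft ℂ (ExteriorAlgebra.ι ℂ (b i)) ∘ₗ
      CliffordAlgebra.contractLeft (Q := (0 : QuadraticForm ℂ W)) (b.coord i)
  have hN : ∀ z, N z = ∑ i, ExteriorAlgebra.ι ℂ (b i) *
      (CliffordAlgebra.contractLeft (Q := (0 : QuadraticForm ℂ W)) (b.coord i) z) := fun z => by
    simp only [N, LinearMap.sum_apply]; rfl
  have hNι : ∀ v z, N (ExteriorAlgebra.ι ℂ v * z) =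
      ExteriorAlgebra.ι ℂ v * z + ExteriorAlgebra.ι ℂ v * N z := by
    intro v z
    have h1 : ∀ i, CliffordAlgebra.contractLeft (Q := (0 : QuadraticForm ℂ W)) (b.coord i)
        (ExteriorAlgebra.ι ℂ v * z) = b.coord i v • z - ExteriorAlgebra.ι ℂ v *
        (CliffordAlgebra.contractLeft (Q := (0 : QuadraticForm ℂ W)) (b.coord i) z) :=
      fun i => CliffordAlgebra.contractLeft_ι_mul _ _ _
    have h2 : ∀ i, ExteriorAlgebra.ι ℂ (b i) * ExteriorAlgebra.ι ℂ v =
        -(ExteriorAlgebra.ι ℂ v * ExteriorAlgebra.ι ℂ (b i)) := fun i =>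
      eq_neg_of_add_eq_zero_left (ExteriorAlgebra.ι_add_mul_swap _ _)
    have h3 : ∑ i, b.coord i v • ExteriorAlgebra.ι ℂ (b i) = ExteriorAlgebra.ι ℂ v := by
      simp only [Module.Basis.coord_apply, ← map_smul, ← map_sum, b.sum_repr]
    rw [hN, hN]
    simp only [h1, mul_sub, mul_smul_comm]
    rw [Finset.sum_sub_distrib]
    simp only [← smul_mul_assoc]
    rw [← Finset.sum_mul, h3, sub_eq_add_neg, ← Finset.sum_neg_distrib, Finset.mul_sum]
    congr 1
    refine Finset.sum_congr rfl fun i _ => ?_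
    rw [← mul_assoc, h2, neg_mul, neg_neg, mul_assoc]
  have hN1 : ∀ c : ℂ, N (algebraMap ℂ _ c) = 0 := fun c => by
    rw [hN]
    refine Finset.sum_eq_zero fun i _ => ?_
    have h1 := CliffordAlgebra.contractLeft_algebraMap (Q := (0 : QuadraticForm ℂ W)) (b.coord i) c
    exact (congrArg _ h1).trans (mul_zero _)
  have hNy : N y = 0 := by
    rw [hN]
    refine Finset.sum_eq_zero fun i _ => ?_
    rw [h, mul_zero]
  have hdeg : ∀ n : ℕ, ∀ z ∈ ⋀[ℂ]^n W, N z = (n : ℂ) • z := by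
    intro n
    induction n with
    | zero =>
      intro z hz
      rw [ExteriorAlgebra.exteriorPower, pow_zero, Submodule.mem_one] at hz
      obtain ⟨c, rfl⟩ := hz
      simp [hN1]
    | succ n ih =>
      intro z hz
      rw [ExteriorAlgebra.exteriorPower, pow_succ'] at hz
      induction hz using Submodule.mul_induction_on' with
      | mem_mul_mem a ha c hc =>
        obtain ⟨v, rfl⟩ := ha
        rw [hNι, ih c hc, mul_smul_comm]
        push_cast
        module
      | add x _ z _ hx hz => rw [map_add, hx, hz, smul_add]
  let 𝒜 := fun i : ℕ => ⋀[ℂ]^i W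
  have hcomp : ∀ n : ℕ, n ≠ 0 → (DirectSum.decompose 𝒜 y n : ExteriorAlgebra ℂ W) = 0 := by
    intro n hn
    have h1 : N y = ∑ i ∈ (DirectSum.decompose 𝒜 y).support,
        (i : ℂ) • (DirectSum.decompose 𝒜 y i : ExteriorAlgebra ℂ W) := by
      conv_lhs => rw [← DirectSum.sum_support_decompose 𝒜 y, map_sum]
      exact Finset.sum_congr rfl fun i _ => hdeg i _ (SetLike.coe_mem _)
    have h2 : (DirectSum.decompose 𝒜 (N y) n : ExteriorAlgebra ℂ W) =
        (n : ℂ) • (DirectSum.decompose 𝒜 y n : ExteriorAlgebra ℂ W) := by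
      rw [h1, DirectSum.decompose_sum, DFinsupp.finsetSum_apply, Submodule.coe_sum,
        Finset.sum_eq_single n]
      · rw [DirectSum.decompose_smul, DirectSum.smul_apply, DirectSum.decompose_coe,
          DirectSum.of_eq_same]
        rfl
      · intro i _ hi
        rw [DirectSum.decompose_smul, DirectSum.smul_apply, DirectSum.decompose_coe,
          DirectSum.of_eq_of_ne _ _ _ hi.symm]
        simp
      · intro hn'
        rw [DFinsupp.notMem_support_iff] at hn'
        simp [hn']
    rw [hNy] at h2
    have h3 : (n : ℂ) • (DirectSum.decompose 𝒜 y n : ExteriorAlgebra ℂ W) = 0 := by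
      rw [← h2]; simp
    exact (smul_eq_zero.1 h3).resolve_left (by exact_mod_cast hn)
  have h0 : y = (DirectSum.decompose 𝒜 y 0 : ExteriorAlgebra ℂ W) := by
    conv_lhs => rw [← DirectSum.sum_support_decompose 𝒜 y]
    refine Finset.sum_eq_single 0 (fun i _ hi => hcomp i hi) fun h0 => ?_
    rw [DFinsupp.notMem_support_iff] at h0
    simp [h0]
  have h4 : (DirectSum.decompose 𝒜 y 0 : ExteriorAlgebra ℂ W) ∈ ⋀[ℂ]^0 W := SetLike.coe_mem _
  rw [ExteriorAlgebra.exteriorPower, pow_zero, Submodule.mem_one] at h4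
  obtain ⟨c, hc⟩ := h4
  exact ⟨c, h0.trans hc.symm⟩

/-- The symbol map intertwines contractions, so the exterior algebra case applies; nondegeneracy
makes every functional a contraction direction. This identifies the kernel of the spin cover. -/
theorem clifford_scalar_of_clContr_eq_zero [FiniteDimensional ℝ V]
    (hnd : ∀ d : Module.Dual ℂ (Cx V), ∃ v, cxForm B v = d)
    (y : Cl B) (h : ∀ v, clContr B v y = 0) : ∃ c : ℂ, y = algebraMap ℂ (Cl B) c := by
  obtain ⟨c, hc⟩ := contractLeft_clifford_zero_eq_zero (clSymbol B y) fun d => by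
    obtain ⟨v, rfl⟩ := hnd d
    rw [← clSymbol_clContr, h, map_zero]
  refine ⟨c, (clSymbol B).injective ?_⟩
  rw [hc, Algebra.algebraMap_eq_smul_one, Algebra.algebraMap_eq_smul_one, map_smul, clSymbol_one]

theorem clContr₂_tmul (v w : Cx V) : clContr₂ B (v ⊗ₜ w) = clContr B v * clContr B w := rfl

/-- Contractions anticommute, so the two halves of the antisymmetric tensor contribute equally. -/
theorem half_clContr₂_sum {ι : Type*} (s : Finset ι) (p m : ι → Cx V) :
    (1 / 2 : ℂ) • clContr₂ B (∑ i ∈ s, (1 / 2 : ℂ) • (p i ⊗ₜ[ℂ] m i - m i ⊗ₜ[ℂ] p i)) =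
      (1 / 2 : ℂ) • ∑ i ∈ s, clContr B (p i) * clContr B (m i) := by
  rw [map_sum]
  congr 1
  refine Finset.sum_congr rfl fun i _ => ?_
  rw [map_smul, map_sub, clContr₂_tmul, clContr₂_tmul, clContr_mul_comm B (m i) (p i)]
  module

/-- Left multiplication by `x_v` on the Clifford algebra. -/
noncomputable abbrev clLeft (v : Cx V) : Module.End ℂ (Cl B) := LinearMap.mulLeft ℂ (clVec B v)

theorem clContr_mul_clLeft (v w : Cx V) :
    clContr B v * clLeft B w = cxForm B v w • 1 - clLeft B w * clContr B v :=
  LinearMap.ext fun y => clContr_clVec_mul B v w y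

/-- The commutator of a double contraction with `x_v` is a single contraction; it commutes with all
double contractions, as `algExp_mul_eq` requires. -/
theorem clContr_mul_clContr_mul_clLeft (p m v : Cx V) :
    clContr B p * clContr B m * clLeft B v = clLeft B v * (clContr B p * clContr B m) +
      (cxForm B m v • clContr B p - cxForm B p v • clContr B m) := by
  rw [mul_assoc, clContr_mul_clLeft, mul_sub, ← mul_assoc, clContr_mul_clLeft, sub_mul, mul_smul_comm,
    smul_mul_assoc, mul_one, one_mul, mul_assoc]
  abel

theorem clContr_mul_clContr_mul_clContr (p m v : Cx V) :
    clContr B p * clContr B m * clContr B v = clContr B v * (clContr B p * clContr B m) := by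
  refine LinearMap.ext fun y => ?_
  have h : ∀ v w z, clContr B v (clContr B w z) = -clContr B w (clContr B v z) := fun v w z =>
    CliffordAlgebra.contractLeft_comm _ _ _
  change clContr B p (clContr B m (clContr B v y)) = clContr B v (clContr B p (clContr B m y))
  rw [h m v, map_neg, h p v, neg_neg]

/-! ### Conjugation by the exponential of double contractions. -/

section Twist

variable [FiniteDimensional ℝ V] {ι : Type*} (s : Finset ι) (p m : ι → Cx V)

theorem algExp_sum_clContr_clVec_mul (v : Cx V) (y : Cl B) :
    algExp ((1 / 2 : ℂ) • ∑ i ∈ s, clContr B (p i) * clContr B (m i)) (clVec B v * y) =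
      clVec B v * algExp ((1 / 2 : ℂ) • ∑ i ∈ s, clContr B (p i) * clContr B (m i)) y +
      clContr B ((1 / 2 : ℂ) • ∑ i ∈ s, (cxForm B (m i) v • p i - cxForm B (p i) v • m i))
        (algExp ((1 / 2 : ℂ) • ∑ i ∈ s, clContr B (p i) * clContr B (m i)) y) := by
  have h := algExp_mul_eq (D := (1 / 2 : ℂ) • ∑ i ∈ s, clContr B (p i) * clContr B (m i))
    (X := clLeft B v)
    (Z := clContr B ((1 / 2 : ℂ) • ∑ i ∈ s, (cxForm B (m i) v • p i - cxForm B (p i) v • m i)))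
    ?_ ?_
  · exact LinearMap.congr_fun h y
  · rw [smul_mul_assoc, mul_smul_comm, Finset.sum_mul, Finset.mul_sum, map_smul, ← smul_add, map_sum,
      ← Finset.sum_add_distrib]
    congr 1
    refine Finset.sum_congr rfl fun i _ => ?_
    rw [clContr_mul_clContr_mul_clLeft, map_sub, map_smul, map_smul]
  · rw [smul_mul_assoc, mul_smul_comm, Finset.sum_mul, Finset.mul_sum]
    congr 1
    exact Finset.sum_congr rfl fun i _ => clContr_mul_clContr_mul_clContr B _ _ _

theorem algExp_sum_clContr_one :
    algExp ((1 / 2 : ℂ) • ∑ i ∈ s, clContr B (p i) * clContr B (m i)) 1 = 1 := by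
  have h := map_algExp_congr (LinearMap.applyₗ (1 : Cl B) : Module.End ℂ (Cl B) →ₗ[ℂ] Cl B)
    (LinearMap.applyₗ (1 : Cl B) : Module.End ℂ (Cl B) →ₗ[ℂ] Cl B)
    ((1 / 2 : ℂ) • ∑ i ∈ s, clContr B (p i) * clContr B (m i)) 0 fun n => ?_
  · rw [algExp_zero] at h
    exact h
  · cases n with
    | zero => simp
    | succ n =>
      have h : ((1 / 2 : ℂ) • ∑ i ∈ s, clContr B (p i) * clContr B (m i)) (1 : Cl B) = 0 := by
        rw [LinearMap.smul_apply, LinearMap.sum_apply]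
        refine smul_eq_zero_of_right _ (Finset.sum_eq_zero fun i _ => ?_)
        rw [Module.End.mul_apply, clContr_one, map_zero]
      rw [pow_succ, zero_pow n.succ_ne_zero, map_zero, LinearMap.applyₗ_apply_apply,
        Module.End.mul_apply, h, map_zero]

end Twist

/-! ### Compatibility with the grading, needed for the signs in graded tensor products. -/

section Parity

theorem contractLeft_involute {W : Type*} [AddCommGroup W] [Module ℂ W] (Q : QuadraticForm ℂ W)
    (d : Module.Dual ℂ W) (y : CliffordAlgebra Q) :
    CliffordAlgebra.contractLeft d (CliffordAlgebra.involute y) =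
      -CliffordAlgebra.involute (CliffordAlgebra.contractLeft d y) := by
  induction y using CliffordAlgebra.left_induction with
  | algebraMap r =>
    rw [AlgHom.commutes, CliffordAlgebra.contractLeft_algebraMap, map_zero, neg_zero]
  | add x y hx hy => rw [map_add, map_add, hx, hy, map_add, map_add, neg_add]
  | ι_mul x m hx =>
    rw [map_mul, CliffordAlgebra.involute_ι, neg_mul, map_neg, CliffordAlgebra.contractLeft_ι_mul,
      hx, CliffordAlgebra.contractLeft_ι_mul, map_sub, map_smul, map_mul,
      CliffordAlgebra.involute_ι, mul_neg, neg_mul]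

theorem clContr_involute (v : Cx V) (y : Cl B) :
    clContr B v (CliffordAlgebra.involute y) = -CliffordAlgebra.involute (clContr B v y) :=
  contractLeft_involute _ _ y

/-- The graded commutator with `x_v` and the contraction by `v` are odd derivations that agree on
generators. An even element commuting with all generators is thus killed by all contractions. -/
theorem clVec_mul_sub_involute_mul (hB : ∀ v w, B v w = B w v) (v : Cx V) (y : Cl B) :
    clVec B v * y - CliffordAlgebra.involute y * clVec B v = clContr B v y := by
  induction y using CliffordAlgebra.left_induction with
  | algebraMap r =>
    rw [AlgHom.commutes, ← Algebra.commutes, sub_self, Algebra.algebraMap_eq_smul_one, map_smul,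
      clContr_one, smul_zero]
  | add x y hx hy => rw [map_add, map_add, ← hx, ← hy, mul_add, add_mul]; abel
  | ι_mul x m hx =>
    rw [map_mul, CliffordAlgebra.involute_ι, clContr_clVec_mul, ← hx, ← mul_assoc,
      eq_sub_of_add_eq (clVec_mul_add_swap B hB v m), sub_mul, mul_sub, Algebra.smul_def]
    simp only [neg_mul, mul_assoc]
    abel

theorem clSymbol_involute (hB : ∀ v w, B v w = B w v) (y : Cl B) :
    clSymbol B (CliffordAlgebra.involute y) =
      CliffordAlgebra.involute (Q := (0 : QuadraticForm ℂ (Cx V))) (clSymbol B y) := by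
  induction y using CliffordAlgebra.left_induction with
  | algebraMap r =>
    rw [AlgHom.commutes, Algebra.algebraMap_eq_smul_one, map_smul, clSymbol_one]
    exact ((map_smul _ _ _).trans (congrArg _ (map_one _))).symm
  | add x y hx hy =>
    rw [map_add, map_add, hx, hy, map_add]
    exact (map_add _ _ _).symm
  | ι_mul x m hx =>
    have h : ∀ z : ExteriorAlgebra ℂ (Cx V),
        CliffordAlgebra.involute (Q := (0 : QuadraticForm ℂ (Cx V))) (ExteriorAlgebra.ι ℂ m * z) =
        -(ExteriorAlgebra.ι ℂ m * CliffordAlgebra.involute (Q := (0 : QuadraticForm ℂ (Cx V))) z) :=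
      fun z => (map_mul _ _ _).trans
        ((congrArg (· * _) (CliffordAlgebra.involute_ι m)).trans (neg_mul _ _))
    have h2 : ∀ a b : ExteriorAlgebra ℂ (Cx V),
        CliffordAlgebra.involute (Q := (0 : QuadraticForm ℂ (Cx V))) (a + (1 / 2 : ℂ) • b) =
        CliffordAlgebra.involute (Q := (0 : QuadraticForm ℂ (Cx V))) a +
        (1 / 2 : ℂ) • CliffordAlgebra.involute (Q := (0 : QuadraticForm ℂ (Cx V))) b :=
      fun a b => (map_add _ _ _).trans (congrArg _ (map_smul _ _ _))
    have h3 := contractLeft_involute (0 : QuadraticForm ℂ (Cx V)) (cxForm B m) (clSymbol B x)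
    rw [map_mul, CliffordAlgebra.involute_ι, neg_mul, map_neg, clSymbol_clVec_mul B hB, hx,
      clSymbol_clVec_mul B hB, h2, h, neg_add]
    congr 1
    rw [← smul_neg]
    congr 1
    exact neg_eq_iff_eq_neg.2 h3

theorem involute_exteriorMap {W W' : Type*} [AddCommGroup W] [Module ℂ W] [AddCommGroup W']
    [Module ℂ W'] (P : W →ₗ[ℂ] W') (y : ExteriorAlgebra ℂ W) :
    CliffordAlgebra.involute (Q := (0 : QuadraticForm ℂ W')) (ExteriorAlgebra.map P y) =
      ExteriorAlgebra.map P (CliffordAlgebra.involute (Q := (0 : QuadraticForm ℂ W)) y) := by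
  have h : (CliffordAlgebra.involute (Q := (0 : QuadraticForm ℂ W'))).comp
      (ExteriorAlgebra.map P : ExteriorAlgebra ℂ W →ₐ[ℂ] ExteriorAlgebra ℂ W') =
      (ExteriorAlgebra.map P : ExteriorAlgebra ℂ W →ₐ[ℂ] ExteriorAlgebra ℂ W').comp
      (CliffordAlgebra.involute (Q := (0 : QuadraticForm ℂ W))) := by
    refine ExteriorAlgebra.hom_ext (LinearMap.ext fun v => ?_)
    have h1 : CliffordAlgebra.involute (Q := (0 : QuadraticForm ℂ W)) (ExteriorAlgebra.ι ℂ v) =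
      -ExteriorAlgebra.ι ℂ v := CliffordAlgebra.involute_ι v
    have h2 : CliffordAlgebra.involute (Q := (0 : QuadraticForm ℂ W')) (ExteriorAlgebra.ι ℂ (P v)) =
      -ExteriorAlgebra.ι ℂ (P v) := CliffordAlgebra.involute_ι (P v)
    have h3 : ExteriorAlgebra.map P (ExteriorAlgebra.ι ℂ v) = ExteriorAlgebra.ι ℂ (P v) :=
      ExteriorAlgebra.map_apply_ι _ _
    have h4 : ExteriorAlgebra.map P (-ExteriorAlgebra.ι ℂ v) = -ExteriorAlgebra.ι ℂ (P v) := by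
      rw [map_neg, h3]
    exact ((congrArg _ h3).trans h2).trans ((congrArg _ h1).trans h4).symm
  exact DFunLike.congr_fun h y

/-- Each contraction anticommutes with the grading involution, so double contractions commute with
it. -/
theorem algExp_sum_clContr_involute [FiniteDimensional ℝ V] {ι : Type*} (s : Finset ι)
    (p m : ι → Cx V) (y : Cl B) :
    algExp ((1 / 2 : ℂ) • ∑ i ∈ s, clContr B (p i) * clContr B (m i))
        (CliffordAlgebra.involute y) =
      CliffordAlgebra.involute
        (algExp ((1 / 2 : ℂ) • ∑ i ∈ s, clContr B (p i) * clContr B (m i)) y) := by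
  have h := algExp_mul_eq (D := (1 / 2 : ℂ) • ∑ i ∈ s, clContr B (p i) * clContr B (m i))
    (X := (CliffordAlgebra.involute (Q := cliffForm B)).toLinearMap) (Z := 0) ?_ (by simp)
  · rw [add_zero] at h
    exact LinearMap.congr_fun h y
  · rw [add_zero, smul_mul_assoc, mul_smul_comm, Finset.sum_mul, Finset.mul_sum]
    congr 1
    refine Finset.sum_congr rfl fun i _ => LinearMap.ext fun y => ?_
    change clContr B (p i) (clContr B (m i) (CliffordAlgebra.involute y)) =
      CliffordAlgebra.involute (clContr B (p i) (clContr B (m i) y))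
    rw [clContr_involute, map_neg, clContr_involute, neg_neg]

end Parity

/-! ### Projections defined through the symbol map. -/

section Projection

variable {W : Type*} [AddCommGroup W] [Module ℝ W] (B' : LinearMap.BilinForm ℝ W) (P : V →ₗ[ℝ] W)

/-- The linear map of Clifford algebras that corresponds to the homomorphism of exterior algebras
defined by `P`. -/
noncomputable def clMapSymbol : Cl B →ₗ[ℂ] Cl B' :=
  (clSymbol B').symm.toLinearMap ∘ₗ (ExteriorAlgebra.map (P.baseChange ℂ)).toLinearMap ∘ₗ
    (clSymbol B).toLinearMap

theorem clSymbol_clMapSymbol (y : Cl B) :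
    clSymbol B' (clMapSymbol B B' P y) = ExteriorAlgebra.map (P.baseChange ℂ) (clSymbol B y) :=
  (clSymbol B').apply_symm_apply _

theorem clMapSymbol_one : clMapSymbol B B' P 1 = 1 := by
  apply (clSymbol B').injective
  rw [clSymbol_clMapSymbol, clSymbol_one, clSymbol_one, map_one]

theorem clMapSymbol_involute (hB : ∀ v w, B v w = B w v) (hB' : ∀ v w, B' v w = B' w v)
    (y : Cl B) : clMapSymbol B B' P (CliffordAlgebra.involute y) =
      CliffordAlgebra.involute (clMapSymbol B B' P y) := by
  apply (clSymbol B').injective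
  rw [clSymbol_clMapSymbol, clSymbol_involute B hB, clSymbol_involute B' hB', clSymbol_clMapSymbol,
    involute_exteriorMap]

/-- Both parts of `v∧ + ½ι_v` pass through the exterior map: the wedge because `v` maps to `w`, the
contraction because the functional `v · _` factors through the projection. -/
theorem clMapSymbol_clVec_mul (hB : ∀ v w, B v w = B w v) (hB' : ∀ v w, B' v w = B' w v)
    (v : Cx V) (w : Cx W) (hvw : P.baseChange ℂ v = w)
    (h : cxForm B v = cxForm B' w ∘ₗ P.baseChange ℂ) (y : Cl B) :
    clMapSymbol B B' P (clVec B v * y) = clVec B' w * clMapSymbol B B' P y := by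
  apply (clSymbol B').injective
  rw [clSymbol_clMapSymbol, clSymbol_clVec_mul B hB, clSymbol_clVec_mul B' hB', clSymbol_clMapSymbol,
    map_add, map_mul, map_smul, h, exteriorMap_contractLeft, ExteriorAlgebra.map_apply_ι, hvw]

/-- The symbol of `x_v - ½ι_v` is the wedge product with `v` alone, which dies when `v` projects to
zero. -/
theorem clMapSymbol_clVec_mul_sub (hB : ∀ v w, B v w = B w v)
    (v : Cx V) (hv : P.baseChange ℂ v = 0) (y : Cl B) :
    clMapSymbol B B' P (clVec B v * y - (1 / 2 : ℂ) • clContr B v y) = 0 := by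
  apply (clSymbol B').injective
  rw [clSymbol_clMapSymbol, map_sub, clSymbol_clVec_mul B hB, map_smul, clSymbol_clContr,
    add_sub_cancel_right, map_mul, ExteriorAlgebra.map_apply_ι, hv, map_zero, zero_mul, map_zero]

end Projection

/-! ### The twisted projection and the ideal that it annihilates. -/

section Vacuum

variable [FiniteDimensional ℝ V] {W : Type*} [AddCommGroup W] [Module ℝ W]
  (B' : LinearMap.BilinForm ℝ W) (P : V →ₗ[ℝ] W) {ι : Type*} (s : Finset ι) (p m : ι → Cx V)

/-- The composition of `clMapSymbol` with the exponential of a sum of double contractions. -/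
noncomputable def clNormal : Cl B →ₗ[ℂ] Cl B' :=
  clMapSymbol B B' P ∘ₗ algExp ((1 / 2 : ℂ) • ∑ i ∈ s, clContr B (p i) * clContr B (m i))

theorem clNormal_one : clNormal B B' P s p m 1 = 1 := by
  rw [clNormal, LinearMap.comp_apply, algExp_sum_clContr_one, clMapSymbol_one]

theorem clNormal_involute (hB : ∀ v w, B v w = B w v) (hB' : ∀ v w, B' v w = B' w v)
    (y : Cl B) : clNormal B B' P s p m (CliffordAlgebra.involute y) =
      CliffordAlgebra.involute (clNormal B B' P s p m y) := by
  rw [clNormal, LinearMap.comp_apply, algExp_sum_clContr_involute, clMapSymbol_involute B B' P hB hB']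
  rfl

/-- The vectors `p i` and `m i` project to zero, hence are orthogonal to `v`; the twist then
commutes with `x_v`. -/
theorem clNormal_clVec_mul (hB : ∀ v w, B v w = B w v) (hB' : ∀ v w, B' v w = B' w v)
    (hp : ∀ i ∈ s, P.baseChange ℂ (p i) = 0) (hm : ∀ i ∈ s, P.baseChange ℂ (m i) = 0)
    (v : Cx V) (w : Cx W) (hvw : P.baseChange ℂ v = w)
    (h : cxForm B v = cxForm B' w ∘ₗ P.baseChange ℂ) (y : Cl B) :
    clNormal B B' P s p m (clVec B v * y) = clVec B' w * clNormal B B' P s p m y := by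
  have hz : ∑ i ∈ s, (cxForm B (m i) v • p i - cxForm B (p i) v • m i) = 0 := by
    refine Finset.sum_eq_zero fun i hi => ?_
    rw [cxForm_symm B hB, cxForm_symm B hB (p i), h, LinearMap.comp_apply, LinearMap.comp_apply,
      hp i hi, hm i hi, map_zero, zero_smul, zero_smul, sub_zero]
  rw [clNormal, LinearMap.comp_apply, algExp_sum_clContr_clVec_mul, hz, smul_zero, map_zero,
    LinearMap.zero_apply, add_zero, clMapSymbol_clVec_mul B B' P hB hB' v w hvw h]
  rfl

/-- The duality relations make the correction produced by the twist equal to `-½ι_{m j}`. It cancels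
the contraction part of Clifford multiplication, leaving a wedge product with a vector that projects
to zero. -/
theorem clNormal_clVec_mul_eq_zero [DecidableEq ι] (hB : ∀ v w, B v w = B w v)
    (hm : ∀ i ∈ s, P.baseChange ℂ (m i) = 0)
    (hmm : ∀ i ∈ s, ∀ j ∈ s, cxForm B (m i) (m j) = 0)
    (hpm : ∀ i ∈ s, ∀ j ∈ s, cxForm B (p i) (m j) = if i = j then 1 else 0)
    {j : ι} (hj : j ∈ s) (y : Cl B) :
    clNormal B B' P s p m (clVec B (m j) * y) = 0 := by
  have hz : ∑ i ∈ s, (cxForm B (m i) (m j) • p i - cxForm B (p i) (m j) • m i) = -m j := by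
    rw [Finset.sum_eq_single j]
    · rw [hmm j hj j hj, hpm j hj j hj, if_pos rfl, zero_smul, one_smul, zero_sub]
    · intro i hi hij
      rw [hmm i hi j hj, hpm i hi j hj, if_neg hij, zero_smul, zero_smul, sub_zero]
    · exact fun h => absurd hj h
  rw [clNormal, LinearMap.comp_apply, algExp_sum_clContr_clVec_mul, hz, smul_neg, map_neg,
    map_smul, LinearMap.neg_apply, LinearMap.smul_apply, ← sub_eq_add_neg,
    clMapSymbol_clVec_mul_sub B B' P hB _ (hm j hj)]

end Vacuum

end Clifford
-- One-parameter subgroups of a Lie group.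
section LieExp

theorem comp_smulRight_one {E₁ E₂ : Type*} [NormedAddCommGroup E₁] [NormedSpace ℝ E₁]
    [NormedAddCommGroup E₂] [NormedSpace ℝ E₂] (L : E₁ →L[ℝ] E₂) (v : E₁) :
    L.comp ((1 : ℝ →L[ℝ] ℝ).smulRight v) = (1 : ℝ →L[ℝ] ℝ).smulRight (L v) :=
  ContinuousLinearMap.ext fun r => map_smul L r v

/-- The chain rule, with the derivatives regarded as maps between the model spaces. -/
theorem hasMFDerivAt_comp_of_eq {E₁ E₂ E₃ M₁ M₂ M₃ : Type*} [NormedAddCommGroup E₁]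
    [NormedSpace ℝ E₁] [NormedAddCommGroup E₂] [NormedSpace ℝ E₂] [NormedAddCommGroup E₃]
    [NormedSpace ℝ E₃] [TopologicalSpace M₁] [ChartedSpace E₁ M₁] [TopologicalSpace M₂]
    [ChartedSpace E₂ M₂] [TopologicalSpace M₃] [ChartedSpace E₃ M₃] {f : M₁ → M₂} {g : M₂ → M₃}
    {x : M₁} {y : M₂} {f' : E₁ →L[ℝ] E₂} {g' : E₂ →L[ℝ] E₃}
    (hg : HasMFDerivAt 𝓘(ℝ, E₂) 𝓘(ℝ, E₃) g y g') (hf : HasMFDerivAt 𝓘(ℝ, E₁) 𝓘(ℝ, E₂) f x f')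
    (hy : f x = y) : HasMFDerivAt 𝓘(ℝ, E₁) 𝓘(ℝ, E₃) (fun z => g (f z)) x (g'.comp f') := by
  subst hy
  exact HasMFDerivAt.comp x hg hf

variable {E : Type*} [NormedAddCommGroup E] [NormedSpace ℝ E] [FiniteDimensional ℝ E]
  {G : Type*} [TopologicalSpace G] [ChartedSpace E G] [Group G] [LieGroup 𝓘(ℝ, E) ∞ G]

theorem contMDiff_one_mulInvariantVectorField (ξ : LieAlg E G) :
    ContMDiff 𝓘(ℝ, E) 𝓘(ℝ, E).tangent 1
      (fun g : G => (⟨g, mulInvariantVectorField ξ g⟩ : TangentBundle 𝓘(ℝ, E) G)) := by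
  have h := contMDiff_mulInvariantVectorField (I := 𝓘(ℝ, E)) (G := G) ξ
  exact h.of_le (by rw [minSmoothness_of_isRCLikeNormedField]; norm_num)

theorem contMDiff_mul_left_one (g : G) : ContMDiff 𝓘(ℝ, E) 𝓘(ℝ, E) 1 (fun h : G => g * h) :=
  (contMDiff_mul_left (I := 𝓘(ℝ, E)) (n := ∞)).of_le (by norm_num)

theorem mdifferentiableAt_mul_left (g h : G) :
    MDifferentiableAt 𝓘(ℝ, E) 𝓘(ℝ, E) (fun h : G => g * h) h :=
  (contMDiff_mul_left_one g).mdifferentiableAt (by norm_num)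

theorem mfderiv_mul_left_mulInvariantVectorField (ξ : LieAlg E G) (g h : G) :
    mfderiv 𝓘(ℝ, E) 𝓘(ℝ, E) (fun x : G => g * x) h (mulInvariantVectorField ξ h) =
      mulInvariantVectorField ξ (g * h) := by
  have h1 : (fun x : G => g * h * x) = (fun x => g * x) ∘ (fun x => h * x) := by
    ext x; simp [mul_assoc]
  have h2 : ∀ k, h = k → ∀ v : E, (mfderiv 𝓘(ℝ, E) 𝓘(ℝ, E) (fun x : G => g * x) h v : E) =
      (mfderiv 𝓘(ℝ, E) 𝓘(ℝ, E) (fun x : G => g * x) k v : E) := by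
    rintro _ rfl _
    rfl
  rw [mulInvariantVectorField, mulInvariantVectorField, h1,
    mfderiv_comp (I' := 𝓘(ℝ, E)) _ (mdifferentiableAt_mul_left _ _) (mdifferentiableAt_mul_left _ _)]
  exact h2 _ (mul_one h).symm _

theorem IsMIntegralCurveOn.mul_left {γ : ℝ → G} {ξ : LieAlg E G} {s : Set ℝ}
    (hγ : IsMIntegralCurveOn (I := 𝓘(ℝ, E)) γ (mulInvariantVectorField ξ) s) (g : G) :
    IsMIntegralCurveOn (I := 𝓘(ℝ, E)) (fun t => g * γ t) (mulInvariantVectorField ξ) s := by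
  intro t ht
  have h := (mdifferentiableAt_mul_left (E := E) g (γ t)).hasMFDerivAt.comp_hasMFDerivWithinAt t
    (hγ t ht)
  refine h.congr_mfderiv ?_
  rw [← mfderiv_mul_left_mulInvariantVectorField]
  exact comp_smulRight_one (E₁ := E) (E₂ := E) (mfderiv 𝓘(ℝ, E) 𝓘(ℝ, E) (fun h : G => g * h) (γ t)) _

/-- A local solution at the unit can be left translated to every point, so all points share one time
of existence `ε`, and the solution extends to all of `ℝ`. In particular `lieExp` never takes its
default value. -/
theorem exists_isMIntegralCurve (ξ : LieAlg E G) [T2Space G] :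
    ∃ γ : ℝ → G, γ 0 = 1 ∧ IsMIntegralCurve (I := 𝓘(ℝ, E)) γ (mulInvariantVectorField ξ) := by
  have : IsManifold 𝓘(ℝ, E) 1 G := IsManifold.of_le (n := ∞) (by norm_num)
  obtain ⟨γ, h0, hγ⟩ := exists_isMIntegralCurveAt_of_contMDiffAt_boundaryless (I := 𝓘(ℝ, E)) 0
    (contMDiff_one_mulInvariantVectorField ξ).contMDiffAt (x₀ := (1 : G))
  obtain ⟨ε, hε, h⟩ := isMIntegralCurveAt_iff'.1 hγ
  refine exists_isMIntegralCurve_of_isMIntegralCurveOn (contMDiff_one_mulInvariantVectorField ξ) hε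
    (fun x => ⟨fun t => x * γ t, by simp [h0], ?_⟩) 1
  rw [Real.ball_eq_Ioo, zero_sub, zero_add] at h
  exact IsMIntegralCurveOn.mul_left h x

theorem IsMIntegralCurve.mul_left {γ : ℝ → G} {ξ : LieAlg E G}
    (hγ : IsMIntegralCurve (I := 𝓘(ℝ, E)) γ (mulInvariantVectorField ξ)) (g : G) :
    IsMIntegralCurve (I := 𝓘(ℝ, E)) (fun t => g * γ t) (mulInvariantVectorField ξ) := by
  rw [isMIntegralCurve_iff_isMIntegralCurveOn] at *
  exact IsMIntegralCurveOn.mul_left hγ g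

variable [T2Space G]

theorem isMIntegralCurve_unique {γ γ' : ℝ → G} {ξ : LieAlg E G}
    (hγ : IsMIntegralCurve (I := 𝓘(ℝ, E)) γ (mulInvariantVectorField ξ))
    (hγ' : IsMIntegralCurve (I := 𝓘(ℝ, E)) γ' (mulInvariantVectorField ξ)) (h : γ 0 = γ' 0) :
    γ = γ' := by
  have : IsManifold 𝓘(ℝ, E) 1 G := IsManifold.of_le (n := ∞) (by norm_num)
  exact isMIntegralCurve_Ioo_eq_of_contMDiff_boundaryless
    (contMDiff_one_mulInvariantVectorField ξ) hγ hγ' h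

theorem lieExp_eq_of_isMIntegralCurve {γ : ℝ → G} {ξ : LieAlg E G}
    (hγ : IsMIntegralCurve (I := 𝓘(ℝ, E)) γ (mulInvariantVectorField ξ)) (h0 : γ 0 = 1) (s : ℝ) :
    lieExp (s • ξ) = γ s := by
  have h1 : IsMIntegralCurve (I := 𝓘(ℝ, E)) (γ ∘ (· * s)) (mulInvariantVectorField (s • ξ)) := by
    rw [mulInvariantVectorField_smul]
    exact hγ.comp_mul s
  have h : ∃ γ : ℝ → G, γ 0 = 1 ∧
      IsMIntegralCurve (I := 𝓘(ℝ, E)) γ (mulInvariantVectorField (s • ξ)) :=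
    ⟨_, by simp [h0], h1⟩
  rw [lieExp, dif_pos h, isMIntegralCurve_unique h.choose_spec.2 h1
    (by rw [h.choose_spec.1]; simp [h0])]
  simp

theorem isMIntegralCurve_lieExp (ξ : LieAlg E G) :
    IsMIntegralCurve (I := 𝓘(ℝ, E)) (fun s : ℝ => (lieExp (s • ξ) : G))
      (mulInvariantVectorField ξ) := by
  obtain ⟨γ, h0, hγ⟩ := exists_isMIntegralCurve ξ
  have : (fun s : ℝ => (lieExp (s • ξ) : G)) = γ :=
    funext fun s => lieExp_eq_of_isMIntegralCurve hγ h0 s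
  rwa [this]

theorem lieExp_zero : lieExp (0 : LieAlg E G) = (1 : G) := by
  obtain ⟨γ, h0, hγ⟩ := exists_isMIntegralCurve (0 : LieAlg E G)
  have h := lieExp_eq_of_isMIntegralCurve hγ h0 0
  rwa [smul_zero, h0] at h

theorem lieExp_add_smul (ξ : LieAlg E G) (s t : ℝ) :
    (lieExp ((s + t) • ξ) : G) = lieExp (s • ξ) * lieExp (t • ξ) := by
  have h1 := IsMIntegralCurve.mul_left (isMIntegralCurve_lieExp ξ) (lieExp (s • ξ) : G)
  have h2 := (isMIntegralCurve_lieExp (G := G) ξ).comp_add s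
  have h3 := congrFun (isMIntegralCurve_unique h1 h2 (by simp [lieExp_zero])) t
  simp only [Function.comp_apply] at h3
  rw [h3, add_comm]

theorem lieExp_neg (ξ : LieAlg E G) : (lieExp (-ξ) : G) = (lieExp ξ)⁻¹ := by
  rw [eq_inv_iff_mul_eq_one]
  have h := lieExp_add_smul (G := G) ξ (-1) 1
  rw [neg_add_cancel, zero_smul, lieExp_zero, one_smul, neg_smul, one_smul] at h
  exact h.symm

theorem continuous_lieExp_smul (ξ : LieAlg E G) : Continuous fun s : ℝ => (lieExp (s • ξ) : G) :=
  (isMIntegralCurve_lieExp ξ).continuous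

theorem hasMFDerivAt_lieExp_smul_zero (ξ : LieAlg E G) :
    HasMFDerivAt 𝓘(ℝ, ℝ) 𝓘(ℝ, E) (fun s : ℝ => (lieExp (s • ξ) : G)) 0
      ((1 : ℝ →L[ℝ] ℝ).smulRight (ξ : E)) := by
  have h := isMIntegralCurve_lieExp (G := G) ξ 0
  have h2 : ∀ g : G, g = 1 → (mulInvariantVectorField ξ g : E) = ξ := by
    rintro g rfl
    have : (fun x : G => 1 * x) = id := by ext; simp
    rw [mulInvariantVectorField, this, mfderiv_id]
    rfl
  refine h.congr_mfderiv ?_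
  exact congrArg (fun v : E => (1 : ℝ →L[ℝ] ℝ).smulRight v) (h2 _ (by simp [lieExp_zero]))

/-- A homomorphism `ℝ → G` with derivative `ξ` at zero is `s ↦ exp (s ξ)`. -/
theorem eq_lieExp_of_hom {c : ℝ → G} {ξ : LieAlg E G} (hc : ∀ s t, c (s + t) = c s * c t)
    (hd : HasMFDerivAt 𝓘(ℝ, ℝ) 𝓘(ℝ, E) c 0 ((1 : ℝ →L[ℝ] ℝ).smulRight (ξ : E))) (s : ℝ) :
    c s = lieExp (s • ξ) := by
  have h0 : c 0 = 1 := by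
    have := hc 0 0
    rw [add_zero] at this
    exact left_eq_mul.1 this
  refine (lieExp_eq_of_isMIntegralCurve (fun t => ?_) h0 s).symm
  -- The homomorphism property moves the derivative at `0` to any time `t` by left translation, so
  -- `c` is an integral curve.
  have h1 : c = (fun x => c t * x) ∘ c ∘ (fun s => s - t) := by
    ext s
    simp [← hc]
  have h2 : HasMFDerivAt 𝓘(ℝ, ℝ) 𝓘(ℝ, ℝ) (fun s : ℝ => s - t) t (ContinuousLinearMap.id ℝ ℝ) :=
    ((hasFDerivAt_id t).sub_const t).hasMFDerivAt
  have h3 := hasMFDerivAt_comp_of_eq hd h2 (sub_self t)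
  have h4 := hasMFDerivAt_comp_of_eq
    (mdifferentiableAt_mul_left (E := E) (c t) (1 : G)).hasMFDerivAt h3 (by simp [h0])
  have h5 : (fun z => c t * c (z - t)) = c := h1.symm
  rw [h5] at h4
  exact h4.congr_mfderiv
    (comp_smulRight_one (E₁ := E) (E₂ := E) (mfderiv 𝓘(ℝ, E) 𝓘(ℝ, E) (fun h : G => c t * h) 1) _)

/-- Differentiation at `s = 0` recovers the vector. Identities for the adjoint representation are
checked in this way on the group. -/
theorem eq_of_lieExp_smul_eq {ξ η : LieAlg E G}
    (h : ∀ s : ℝ, (lieExp (s • ξ) : G) = lieExp (s • η)) : ξ = η := by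
  have h1 := hasMFDerivAt_lieExp_smul_zero (G := G) ξ
  rw [funext h] at h1
  have h2 := hasMFDerivAt_unique h1 (hasMFDerivAt_lieExp_smul_zero (G := G) η)
  have h3 : (1 : ℝ) • (ξ : E) = (1 : ℝ) • (η : E) := DFunLike.congr_fun h2 (1 : ℝ)
  simpa only [one_smul] using h3

theorem lieExp_mfderiv {E' G' : Type*} [NormedAddCommGroup E'] [NormedSpace ℝ E']
    [FiniteDimensional ℝ E'] [TopologicalSpace G'] [ChartedSpace E' G'] [Group G']
    [LieGroup 𝓘(ℝ, E') ∞ G'] [T2Space G'] (φ : G →* G')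
    (hφ : MDifferentiableAt 𝓘(ℝ, E) 𝓘(ℝ, E') φ 1) (ξ : LieAlg E G) :
    (lieExp (E := E') (G := G') (mfderiv 𝓘(ℝ, E) 𝓘(ℝ, E') φ 1 ξ : E')) = φ (lieExp ξ) := by
  have h1 := hasMFDerivAt_comp_of_eq hφ.hasMFDerivAt (hasMFDerivAt_lieExp_smul_zero ξ)
    (by simp [lieExp_zero])
  have h2 := eq_lieExp_of_hom (fun s t => by rw [lieExp_add_smul, map_mul])
    (h1.congr_mfderiv (comp_smulRight_one (E₁ := E) (E₂ := E') _ _)) 1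
  rw [one_smul] at h2
  have h3 : (1 : ℝ) • (mfderiv 𝓘(ℝ, E) 𝓘(ℝ, E') φ 1 ξ : E') = mfderiv 𝓘(ℝ, E) 𝓘(ℝ, E') φ 1 ξ :=
    one_smul _ _
  exact (h2.trans (congrArg (lieExp (E := E') (G := G')) h3)).symm

/-- The product rule for maps into a Lie group, at a point where both maps take the value one. -/
theorem hasMFDerivAt_mul_of_eq_one {E₁ M₁ : Type*} [NormedAddCommGroup E₁] [NormedSpace ℝ E₁]
    [TopologicalSpace M₁] [ChartedSpace E₁ M₁] {f g : M₁ → G} {x : M₁} {f' g' : E₁ →L[ℝ] E}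
    (hf : HasMFDerivAt 𝓘(ℝ, E₁) 𝓘(ℝ, E) f x f') (hg : HasMFDerivAt 𝓘(ℝ, E₁) 𝓘(ℝ, E) g x g')
    (hf1 : f x = 1) (hg1 : g x = 1) :
    HasMFDerivAt 𝓘(ℝ, E₁) 𝓘(ℝ, E) (fun z => f z * g z) x (f' + g') := by
  have hm : MDifferentiableAt (𝓘(ℝ, E).prod 𝓘(ℝ, E)) 𝓘(ℝ, E) (fun p : G × G => p.1 * p.2)
      (f x, g x) := (contMDiff_mul 𝓘(ℝ, E) ∞).mdifferentiableAt (by norm_num)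
  have h1 := hm.hasMFDerivAt.comp x (hf.prodMk hg)
  refine HasMFDerivAt.congr_mfderiv h1 (ContinuousLinearMap.ext fun v => ?_)
  have h2 := mfderiv_prod_eq_add_apply (v := ((f' v, g' v) : E × E)) hm
  refine Eq.trans h2 ?_
  have h3 : ∀ y : G, y = 1 → ∀ z w, (mfderiv 𝓘(ℝ, E) 𝓘(ℝ, E) (fun z : G => z * y) z w : E) = w := by
    rintro _ rfl z w
    have : (fun z : G => z * 1) = id := by ext; simp
    rw [this, mfderiv_id]
    rfl
  have h4 : ∀ y : G, y = 1 → ∀ z w, (mfderiv 𝓘(ℝ, E) 𝓘(ℝ, E) (fun z : G => y * z) z w : E) = w := by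
    rintro _ rfl z w
    have : (fun z : G => 1 * z) = id := by ext; simp
    rw [this, mfderiv_id]
    rfl
  exact congrArg₂ (fun a b : E => a + b) (h3 _ hg1 _ _) (h4 _ hf1 _ _)

theorem lieExp_add_of_commute {ξ η : LieAlg E G}
    (h : ∀ s t : ℝ, Commute (lieExp (s • ξ) : G) (lieExp (t • η))) :
    (lieExp (ξ + η) : G) = lieExp ξ * lieExp η := by
  have h1 := hasMFDerivAt_mul_of_eq_one (hasMFDerivAt_lieExp_smul_zero (G := G) ξ)
    (hasMFDerivAt_lieExp_smul_zero (G := G) η) (by simp [lieExp_zero]) (by simp [lieExp_zero])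
  have h2 : ((1 : ℝ →L[ℝ] ℝ).smulRight (ξ : E)) + ((1 : ℝ →L[ℝ] ℝ).smulRight (η : E)) =
      (1 : ℝ →L[ℝ] ℝ).smulRight ((ξ : E) + (η : E)) :=
    ContinuousLinearMap.ext fun r => (smul_add r (ξ : E) (η : E)).symm
  have h3 := eq_lieExp_of_hom (fun s t => ?_) (h1.congr_mfderiv h2) 1
  · simp only [one_smul] at h3
    exact h3.symm
  · rw [lieExp_add_smul, lieExp_add_smul, mul_assoc, mul_assoc, ← mul_assoc (lieExp (t • ξ)),
      (h t s).eq, mul_assoc]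

/-- In a chart the velocity is the continuous left-invariant field along a continuous curve. Class
`C¹` is enough for the inverse function theorem applied to products of exponentials. -/
theorem contMDiff_lieExp_smul (ξ : LieAlg E G) :
    ContMDiff 𝓘(ℝ, ℝ) 𝓘(ℝ, E) 1 (fun s : ℝ => (lieExp (s • ξ) : G)) := by
  have hM : IsManifold 𝓘(ℝ, E) 1 G := IsManifold.of_le (n := ∞) (by norm_num)
  set γ : ℝ → G := fun s => lieExp (s • ξ) with hγ
  have hc : Continuous γ := continuous_lieExp_smul ξ
  have hi := isMIntegralCurve_lieExp (G := G) ξ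
  intro t
  have h1 := (hi.isMIntegralCurveAt t).eventually_hasDerivAt
  rw [contMDiffAt_iff_target]
  refine ⟨hc.continuousAt, ContDiffAt.contMDiffAt ?_⟩
  have h2 : ∀ᶠ s in 𝓝 t, γ s ∈ (chartAt E (γ t)).source :=
    hc.continuousAt.preimage_mem_nhds ((chartAt E (γ t)).open_source.mem_nhds (mem_chart_source _ _))
  obtain ⟨u, hu, hu'⟩ := (h1.and h2).exists_mem
  refine contDiffAt_one_iff.2 ⟨fun s => (1 : ℝ →L[ℝ] ℝ).smulRight
    (tangentCoordChange 𝓘(ℝ, E) (γ s) (γ t) (γ s) (mulInvariantVectorField ξ (γ s)) : E), u, hu, ?_,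
    fun s hs => (hu' s hs).1⟩
  have h3 : ContinuousOn (fun s => (trivializationAt E (TangentSpace 𝓘(ℝ, E)) (γ t)
      (⟨γ s, mulInvariantVectorField ξ (γ s)⟩ : TangentBundle 𝓘(ℝ, E) G)).2) u := by
    refine continuous_snd.comp_continuousOn ?_
    refine (trivializationAt E (TangentSpace 𝓘(ℝ, E)) (γ t)).continuousOn.comp
      ((contMDiff_one_mulInvariantVectorField ξ).continuous.comp hc).continuousOn fun s hs => ?_
    rw [Bundle.Trivialization.mem_source]
    exact (hu' s hs).2
  exact (ContinuousLinearMap.smulRightL ℝ ℝ E 1).continuous.comp_continuousOn h3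

end LieExp
-- The derivative of conjugation in local coordinates.
section Calculus

variable {E : Type*} [NormedAddCommGroup E] [NormedSpace ℝ E]

theorem fderiv_comp_prodMk {F : Type*} [NormedAddCommGroup F] [NormedSpace ℝ F] {m : E × E → F}
    {x e : E} (h : DifferentiableAt ℝ m (x, e)) (v : E) :
    fderiv ℝ (fun y => m (x, y)) e v = fderiv ℝ m (x, e) (0, v) := by
  have h1 := h.hasFDerivAt.comp e (hasFDerivAt_prodMk_right x e)
  rw [HasFDerivAt.fderiv (f := fun y => m (x, y)) h1]
  simp

theorem eventually_differentiableAt_prodMk {F : Type*} [NormedAddCommGroup F] [NormedSpace ℝ F]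
    {m : E × E → F} {e : E} (h : ContDiffAt ℝ ∞ m (e, e)) :
    ∀ᶠ p in 𝓝 (e, e), DifferentiableAt ℝ m p := by
  have h1 : ContDiffAt ℝ 1 m (e, e) := h.of_le (by norm_num)
  filter_upwards [h1.eventually (by norm_num)] with p hp
  exact hp.differentiableAt (by norm_num)

theorem hasFDerivAt_fderiv_prodMk {F : Type*} [NormedAddCommGroup F] [NormedSpace ℝ F]
    {m : E × E → F} {e : E} (h : ContDiffAt ℝ ∞ m (e, e)) :
    HasFDerivAt (fderiv ℝ m) (fderiv ℝ (fderiv ℝ m) (e, e)) (e, e) := by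
  have h1 : ContDiffAt ℝ 1 (fderiv ℝ m) (e, e) := h.fderiv_right
    (by rw [one_add_one_eq_two]; exact WithTop.coe_le_coe.2 (le_top : (2 : ℕ∞) ≤ ⊤))
  exact (h1.differentiableAt (by norm_num)).hasFDerivAt

theorem hasFDerivAt_partial {F : Type*} [NormedAddCommGroup F] [NormedSpace ℝ F]
    {m : E × E → F} {e : E} (h : ContDiffAt ℝ ∞ m (e, e)) (v : E) :
    HasFDerivAt (fun x => fderiv ℝ (fun y => m (x, y)) e v)
      (((fderiv ℝ (fderiv ℝ m) (e, e)).comp (ContinuousLinearMap.inl ℝ E E)).flip (0, v)) e := by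
  have h1 : HasFDerivAt (fun x => fderiv ℝ m (x, e)) _ e :=
    HasFDerivAt.comp (f := fun x => (x, e)) e (hasFDerivAt_fderiv_prodMk h)
      (hasFDerivAt_prodMk_left e e)
  have h2 := h1.clm_apply (hasFDerivAt_const ((0, v) : E × E) e)
  refine (h2.congr_fderiv ?_).congr_of_eventuallyEq ?_
  · ext w
    simp
  · have h3 : Filter.Tendsto (fun x => (x, e)) (𝓝 e) (𝓝 (e, e)) :=
      (Continuous.prodMk_left e).tendsto e
    filter_upwards [h3.eventually (eventually_differentiableAt_prodMk h)] with x hx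
    exact fderiv_comp_prodMk hx v

/-- If `m` is a local multiplication on `E` with unit `e` and `k` is the conjugation, the
derivative of the adjoint action is the bracket of left-invariant vector fields. -/
theorem hasFDerivAt_conj_eq_lieBracket {m k : E × E → E} {e : E} (hm : ContDiffAt ℝ ∞ m (e, e))
    (hk : ContDiffAt ℝ ∞ k (e, e)) (hm1 : ∀ᶠ x in 𝓝 e, m (x, e) = x)
    (hm2 : ∀ᶠ x in 𝓝 e, m (e, x) = x)
    (hk1 : ∀ᶠ x in 𝓝 e, k (e, x) = x) (hk2 : ∀ x, k (x, e) = e)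
    (hmk : ∀ᶠ p in 𝓝 (e, e), m p = m (k p, p.1)) (v w : E) :
    fderiv ℝ (fun x => fderiv ℝ (fun y => k (x, y)) e w) e v =
      VectorField.lieBracket ℝ (fun x => fderiv ℝ (fun y => m (x, y)) e v)
        (fun x => fderiv ℝ (fun y => m (x, y)) e w) e := by
  have ht : Filter.Tendsto (fun x => (x, e)) (𝓝 e) (𝓝 (e, e)) :=
    (Continuous.prodMk_left e).tendsto e
  have ht' : Filter.Tendsto (fun x => (e, x)) (𝓝 e) (𝓝 (e, e)) :=
    (Continuous.prodMk_right e).tendsto e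
  have hme : DifferentiableAt ℝ m (e, e) := (eventually_differentiableAt_prodMk hm).self_of_nhds
  have hid : ∀ f : E → E, (∀ᶠ x in 𝓝 e, f x = x) → ∀ u, fderiv ℝ f e u = u := by
    intro f hf u
    have : f =ᶠ[𝓝 e] id := hf
    rw [this.fderiv_eq, fderiv_id, ContinuousLinearMap.id_apply]
  have hmv : ∀ u, fderiv ℝ (fun y => m (e, y)) e u = u := hid _ hm2
  have hmu : ∀ u, fderiv ℝ m (e, e) (u, 0) = u := by
    intro u
    have h1 := HasFDerivAt.comp (f := fun x => (x, e)) e hme.hasFDerivAt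
      (hasFDerivAt_prodMk_left e e)
    have h2 := hid _ hm1 u
    rw [HasFDerivAt.fderiv (f := fun y => m (y, e)) h1] at h2
    simpa using h2
  set a : E → E := fun x => fderiv ℝ (fun y => k (x, y)) e w with ha
  have hae : a e = w := hid _ hk1 w
  -- Differentiating `m (x, y) = m (k (x, y), x)` in `y` at the unit expresses the left-invariant
  -- field of `w` at `x` as the right translate of `Ad_x w`.
  have hev : (fun x => fderiv ℝ (fun y => m (x, y)) e w) =ᶠ[𝓝 e]
      fun x => fderiv ℝ m (e, x) (a x, 0) := by
    filter_upwards [ht.eventually (eventually_eventually_nhds.2 hmk),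
      ht.eventually (eventually_differentiableAt_prodMk hk),
      ht'.eventually (eventually_differentiableAt_prodMk hm)] with x h1 h2 h3
    have h4 : (fun y => m (x, y)) =ᶠ[𝓝 e] fun y => m (k (x, y), x) :=
      ((Continuous.prodMk_right x).tendsto e).eventually h1
    rw [h4.fderiv_eq]
    have h5 : HasFDerivAt (fun y => k (x, y)) _ e :=
      h2.hasFDerivAt.comp e (hasFDerivAt_prodMk_right x e)
    have h6 := h5.prodMk (hasFDerivAt_const x e)
    have h7 : HasFDerivAt m (fderiv ℝ m (e, x)) (k (x, e), x) := by
      rw [hk2]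
      exact h3.hasFDerivAt
    rw [HasFDerivAt.fderiv (f := fun y => m (k (x, y), x)) (h7.comp e h6)]
    simp [ha, fderiv_comp_prodMk h2]
  have hA := (hasFDerivAt_partial hk w).differentiableAt.hasFDerivAt
  have h1 : HasFDerivAt (fun x => fderiv ℝ m (e, x)) _ e :=
    (hasFDerivAt_fderiv_prodMk hm).comp e (hasFDerivAt_prodMk_right e e)
  have h2 := h1.clm_apply (hA.prodMk (hasFDerivAt_const (0 : E) e))
  have h3 := (hasFDerivAt_partial hm w).unique (h2.congr_of_eventuallyEq hev)
  have h4 := DFunLike.congr_fun h3 v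
  -- `h4` writes the mixed second derivative of `m` as the derivative of `Ad` plus the mixed
  -- derivative in the opposite order. Symmetry turns the latter into the other term of the Lie
  -- bracket.
  have hsym : IsSymmSndFDerivAt ℝ m (e, e) := hm.isSymmSndFDerivAt
    (by rw [minSmoothness_of_isRCLikeNormedField]; exact
      WithTop.coe_le_coe.2 (le_top : (2 : ℕ∞) ≤ ⊤))
  have h5 := hsym (w, 0) (0, v)
  simp only [← ha] at h4
  rw [VectorField.lieBracket, (hasFDerivAt_partial hm w).fderiv, (hasFDerivAt_partial hm v).fderiv,
    hmv, hmv]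
  have hae' : fderiv ℝ (fun y => k (e, y)) e w = w := hae
  simp [hmu, hae'] at h4 ⊢
  rw [h4, h5, add_sub_cancel_right]

end Calculus

/-! ### The adjoint representation and its derivative. -/

section Adjoint

variable {E : Type*} [NormedAddCommGroup E] [NormedSpace ℝ E] [FiniteDimensional ℝ E]
  {G : Type*} [TopologicalSpace G] [ChartedSpace E G] [Group G] [LieGroup 𝓘(ℝ, E) ∞ G]

theorem contMDiff_conj (g : G) : ContMDiff 𝓘(ℝ, E) 𝓘(ℝ, E) ∞ (fun h : G => g * h * g⁻¹) :=
  (contMDiff_mul_right (I := 𝓘(ℝ, E)) (n := ∞)).comp (contMDiff_mul_left (I := 𝓘(ℝ, E)) (n := ∞))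

/-- The adjoint representation of a Lie group. -/
noncomputable def lieAd (g : G) : LieAlg E G →ₗ[ℝ] LieAlg E G :=
  (show E →L[ℝ] E from mfderiv 𝓘(ℝ, E) 𝓘(ℝ, E) (fun h : G => g * h * g⁻¹) 1).toLinearMap

/-- The adjoint representation, as a map of the model space. -/
noncomputable def lieAdE (E : Type*) [NormedAddCommGroup E] [NormedSpace ℝ E] {G : Type*}
    [TopologicalSpace G] [ChartedSpace E G] [Group G] (g : G) : E →L[ℝ] E :=
  mfderiv 𝓘(ℝ, E) 𝓘(ℝ, E) (fun h : G => g * h * g⁻¹) 1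

section

variable [T2Space G]

theorem lieExp_lieAd (g : G) (ξ : LieAlg E G) :
    (lieExp (lieAd g ξ) : G) = g * lieExp ξ * g⁻¹ :=
  lieExp_mfderiv (E' := E) (G' := G) (MulAut.conj g).toMonoidHom
    ((contMDiff_conj g).mdifferentiableAt (by norm_num)) ξ

theorem lieAd_mul (g h : G) (ξ : LieAlg E G) : lieAd (g * h) ξ = lieAd g (lieAd h ξ) := by
  refine eq_of_lieExp_smul_eq (G := G) fun s => ?_
  rw [← map_smul, ← map_smul, ← map_smul, lieExp_lieAd, lieExp_lieAd, lieExp_lieAd]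
  group

theorem lieAd_eq_self {g : G} {ξ : LieAlg E G} (h : ∀ s : ℝ, Commute g (lieExp (s • ξ))) :
    lieAd g ξ = ξ := by
  refine eq_of_lieExp_smul_eq (G := G) fun s => ?_
  rw [← map_smul, lieExp_lieAd, (h s).eq, mul_inv_cancel_right]

theorem lieAd_one (ξ : LieAlg E G) : lieAd (1 : G) ξ = ξ :=
  lieAd_eq_self fun _ => Commute.one_left _

end

/-- The multiplication of a Lie group, in the chart at the unit. -/
noncomputable def chartMul (E G : Type*) [NormedAddCommGroup E] [NormedSpace ℝ E]
    [TopologicalSpace G] [ChartedSpace E G] [Group G] (p : E × E) : E :=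
  extChartAt 𝓘(ℝ, E) (1 : G)
    ((extChartAt 𝓘(ℝ, E) (1 : G)).symm p.1 * (extChartAt 𝓘(ℝ, E) (1 : G)).symm p.2)

/-- Conjugation in a Lie group, in the chart at the unit. -/
noncomputable def chartConj (E G : Type*) [NormedAddCommGroup E] [NormedSpace ℝ E]
    [TopologicalSpace G] [ChartedSpace E G] [Group G] (p : E × E) : E :=
  extChartAt 𝓘(ℝ, E) (1 : G)
    ((extChartAt 𝓘(ℝ, E) (1 : G)).symm p.1 * (extChartAt 𝓘(ℝ, E) (1 : G)).symm p.2 *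
      ((extChartAt 𝓘(ℝ, E) (1 : G)).symm p.1)⁻¹)

local notation "φ" => extChartAt 𝓘(ℝ, E) (1 : G)

theorem contMDiffAt_chart_symm : ContMDiffAt 𝓘(ℝ, E) 𝓘(ℝ, E) ∞ (φ).symm (φ 1) := by
  have : IsManifold 𝓘(ℝ, E) ∞ G := inferInstance
  exact (contMDiffOn_extChartAt_symm (I := 𝓘(ℝ, E)) (n := ∞) (1 : G)).contMDiffAt
    (extChartAt_target_mem_nhds _)

theorem chart_symm_one : (φ).symm (φ (1 : G)) = 1 := extChartAt_to_inv 1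

theorem contMDiffAt_chart_symm_comp {H : Type*} [NormedAddCommGroup H] [NormedSpace ℝ H]
    {f : H → E} {p : H} (hf : ContDiffAt ℝ ∞ f p) (hp : f p = φ (1 : G)) :
    ContMDiffAt 𝓘(ℝ, H) 𝓘(ℝ, E) ∞ (fun q => (φ).symm (f q) : H → G) p := by
  refine ContMDiffAt.comp p (g := (φ).symm) ?_ hf.contMDiffAt
  rw [hp]
  exact contMDiffAt_chart_symm

theorem contDiffAt_chart_comp {H : Type*} [NormedAddCommGroup H] [NormedSpace ℝ H]
    {f : H → G} {p : H} (hf : ContMDiffAt 𝓘(ℝ, H) 𝓘(ℝ, E) ∞ f p) (hp : f p = 1) :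
    ContDiffAt ℝ ∞ (fun q => φ (f q)) p := by
  have : IsManifold 𝓘(ℝ, E) ∞ G := inferInstance
  rw [← contMDiffAt_iff_contDiffAt]
  refine ContMDiffAt.comp p (g := φ) ?_ hf
  rw [hp]
  exact contMDiffAt_extChartAt

theorem contDiffAt_chartMul : ContDiffAt ℝ ∞ (chartMul E G) (φ 1, φ 1) := by
  refine contDiffAt_chart_comp (ContMDiffAt.mul
    (contMDiffAt_chart_symm_comp contDiffAt_fst rfl)
    (contMDiffAt_chart_symm_comp contDiffAt_snd rfl)) ?_
  simp

theorem contDiffAt_chartConj : ContDiffAt ℝ ∞ (chartConj E G) (φ 1, φ 1) := by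
  refine contDiffAt_chart_comp (ContMDiffAt.mul (ContMDiffAt.mul
    (contMDiffAt_chart_symm_comp contDiffAt_fst rfl)
    (contMDiffAt_chart_symm_comp contDiffAt_snd rfl))
    (contMDiffAt_chart_symm_comp contDiffAt_fst rfl).inv) ?_
  simp

theorem hasMFDerivAt_chart_one :
    HasMFDerivAt 𝓘(ℝ, E) 𝓘(ℝ, E) (φ) (1 : G) (ContinuousLinearMap.id ℝ E) := by
  have : IsManifold 𝓘(ℝ, E) 1 G := inferInstance
  have h := (mdifferentiableAt_extChartAt (I := 𝓘(ℝ, E)) (mem_chart_source E (1 : G))).hasMFDerivAt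
  exact h.congr_mfderiv mfderiv_extChartAt_self

theorem hasMFDerivAt_chart_symm_one :
    HasMFDerivAt 𝓘(ℝ, E) 𝓘(ℝ, E) (φ).symm (φ (1 : G)) (ContinuousLinearMap.id ℝ E) := by
  have : IsManifold 𝓘(ℝ, E) 1 G := inferInstance
  have h := (contMDiffAt_chart_symm (E := E) (G := G)).mdifferentiableAt (by norm_num)
  refine h.hasMFDerivAt.congr_mfderiv ?_
  have h2 := mfderivWithin_range_extChartAt_symm (I := 𝓘(ℝ, E)) (x := (1 : G))
  rwa [ModelWithCorners.range_eq_univ, mfderivWithin_univ] at h2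

theorem hasFDerivAt_of_hasMFDerivAt {E₁ E₂ : Type*} [NormedAddCommGroup E₁] [NormedSpace ℝ E₁]
    [NormedAddCommGroup E₂] [NormedSpace ℝ E₂] {f : E₁ → E₂} {x : E₁} {f' : E₁ →L[ℝ] E₂}
    (h : HasMFDerivAt 𝓘(ℝ, E₁) 𝓘(ℝ, E₂) f x f') : HasFDerivAt f f' x :=
  hasMFDerivAt_iff_hasFDerivAt.1 h

/-- A left-invariant vector field in the chart at the unit. -/
theorem hasFDerivAt_chartMul_right {x : E} (hx : x ∈ (φ : PartialEquiv G E).target) :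
    HasFDerivAt (fun y => chartMul E G (x, y))
      ((show E →L[ℝ] E from mfderiv 𝓘(ℝ, E) 𝓘(ℝ, E) (φ) ((φ).symm x)).comp
        (show E →L[ℝ] E from mfderiv 𝓘(ℝ, E) 𝓘(ℝ, E) (fun h : G => (φ).symm x * h) 1))
      (φ (1 : G)) := by
  have : IsManifold 𝓘(ℝ, E) 1 G := inferInstance
  have h1 := (mdifferentiableAt_extChartAt (I := 𝓘(ℝ, E)) (x := (1 : G)) (y := (φ).symm x)
    (by have := (φ).map_target hx; rwa [extChartAt_source] at this)).hasMFDerivAt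
  have h2 := (mdifferentiableAt_mul_left (E := E) ((φ).symm x) (1 : G)).hasMFDerivAt
  have h3 := hasMFDerivAt_comp_of_eq h2 hasMFDerivAt_chart_symm_one chart_symm_one
  have h4 := hasMFDerivAt_comp_of_eq
    (g' := (show E →L[ℝ] E from mfderiv 𝓘(ℝ, E) 𝓘(ℝ, E) (φ) ((φ).symm x))) h1 h3
    (by rw [chart_symm_one, mul_one])
  exact hasFDerivAt_of_hasMFDerivAt h4

theorem hasFDerivAt_chartConj_right {x : E} :
    HasFDerivAt (fun y => chartConj E G (x, y))
      (show E →L[ℝ] E from mfderiv 𝓘(ℝ, E) 𝓘(ℝ, E)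
        (fun h : G => (φ).symm x * h * ((φ).symm x)⁻¹) 1) (φ (1 : G)) := by
  have h2 := ((contMDiff_conj (E := E) ((φ).symm x : G)).mdifferentiableAt (x := 1)
    (by norm_num)).hasMFDerivAt
  have h3 := hasMFDerivAt_comp_of_eq h2 hasMFDerivAt_chart_symm_one chart_symm_one
  exact hasFDerivAt_of_hasMFDerivAt
    (hasMFDerivAt_comp_of_eq (E₂ := E) (E₃ := E) hasMFDerivAt_chart_one h3 (by simp))

theorem chartMul_one_left {y : E} (hy : y ∈ (φ : PartialEquiv G E).target) :
    chartMul E G (φ (1 : G), y) = y := by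
  rw [chartMul, chart_symm_one, one_mul, (φ).right_inv hy]

theorem chartMul_one_right {y : E} (hy : y ∈ (φ : PartialEquiv G E).target) :
    chartMul E G (y, φ (1 : G)) = y := by
  rw [chartMul, chart_symm_one, mul_one, (φ).right_inv hy]

theorem chartConj_one_right (x : E) : chartConj E G (x, φ (1 : G)) = φ (1 : G) := by
  simp [chartConj]

theorem mpullbackWithin_mulInvariantVectorField (ξ : LieAlg E G) {x : E}
    (hx : x ∈ (φ : PartialEquiv G E).target) :
    (VectorField.mpullbackWithin 𝓘(ℝ, E) 𝓘(ℝ, E) (φ).symm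
      (mulInvariantVectorField ξ : ∀ g : G, TangentSpace 𝓘(ℝ, E) g) (Set.range 𝓘(ℝ, E)) x : E) =
      fderiv ℝ (fun y => chartMul E G (x, y)) (φ (1 : G)) ξ := by
  have : IsManifold 𝓘(ℝ, E) 1 G := inferInstance
  rw [(hasFDerivAt_chartMul_right hx).fderiv, VectorField.mpullbackWithin_apply,
    ContinuousLinearMap.inverse_eq
      (mfderivWithin_extChartAt_symm_comp_mfderiv_extChartAt (I := 𝓘(ℝ, E)) hx)
      (mfderiv_extChartAt_comp_mfderivWithin_extChartAt_symm (I := 𝓘(ℝ, E)) hx)]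
  rfl

theorem eventually_mem_chart_target : ∀ᶠ x in 𝓝 (φ (1 : G)), x ∈ (φ : PartialEquiv G E).target :=
  extChartAt_target_mem_nhds _

/-- The differential of the chart at its base point is the identity, so the bracket of
left-invariant fields can be computed from the multiplication in that chart. -/
theorem lie_eq_lieBracket_chartMul (μ ξ : LieAlg E G) :
    (⁅μ, ξ⁆ : LieAlg E G) =
      (VectorField.lieBracket ℝ (fun x => fderiv ℝ (fun y => chartMul E G (x, y)) (φ (1 : G)) μ)
        (fun x => fderiv ℝ (fun y => chartMul E G (x, y)) (φ (1 : G)) ξ) (φ (1 : G)) : E) := by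
  have : IsManifold 𝓘(ℝ, E) 1 G := inferInstance
  have hev : ∀ ζ : LieAlg E G, (VectorField.mpullbackWithin 𝓘(ℝ, E) 𝓘(ℝ, E) (φ).symm
      (mulInvariantVectorField ζ : ∀ g : G, TangentSpace 𝓘(ℝ, E) g) (Set.range 𝓘(ℝ, E)) : E → E)
      =ᶠ[𝓝 (φ (1 : G))] fun x => fderiv ℝ (fun y => chartMul E G (x, y)) (φ (1 : G)) ζ := by
    intro ζ
    filter_upwards [eventually_mem_chart_target] with x hx
    exact mpullbackWithin_mulInvariantVectorField ζ hx
  rw [GroupLieAlgebra.bracket_def, VectorField.mlieBracket, VectorField.mlieBracketWithin_apply,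
    mfderiv_extChartAt_self]
  have h1 := Filter.EventuallyEq.lieBracket_vectorField_eq (𝕜 := ℝ) (hev μ) (hev ξ)
  have h2 : (φ : PartialEquiv G E).symm ⁻¹' Set.univ ∩ Set.range 𝓘(ℝ, E) = Set.univ := by simp
  rw [h2, ← h1]
  refine Eq.trans ?_ (congrFun (VectorField.lieBracketWithin_univ (𝕜 := ℝ) (E := E)) _)
  exact DFunLike.congr_fun (ContinuousLinearMap.inverse_id (R := ℝ) (M := E)) _

theorem hasFDerivAt_lieAdE_chart_symm (μ ξ : LieAlg E G) :
    HasFDerivAt (fun x : E => lieAdE E ((φ).symm x : G) ξ)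
      (fderiv ℝ (fun x : E => lieAdE E ((φ).symm x : G) ξ) (φ (1 : G))) (φ (1 : G)) ∧
    fderiv ℝ (fun x : E => lieAdE E ((φ).symm x : G) ξ) (φ (1 : G)) μ =
      (show E from (⁅μ, ξ⁆ : LieAlg E G)) := by
  have hk : (fun x : E => lieAdE E ((φ).symm x : G) ξ) =
      fun x => fderiv ℝ (fun y => chartConj E G (x, y)) (φ (1 : G)) ξ := by
    ext x
    rw [hasFDerivAt_chartConj_right.fderiv]
    rfl
  rw [hk]
  refine ⟨(hasFDerivAt_partial (E := E) contDiffAt_chartConj _).differentiableAt.hasFDerivAt, ?_⟩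
  refine Eq.trans ?_ (lie_eq_lieBracket_chartMul (G := G) μ ξ).symm
  refine hasFDerivAt_conj_eq_lieBracket contDiffAt_chartMul contDiffAt_chartConj ?_ ?_ ?_
    chartConj_one_right ?_ _ _
  · filter_upwards [eventually_mem_chart_target] with x hx using chartMul_one_right hx
  · filter_upwards [eventually_mem_chart_target] with x hx using chartMul_one_left hx
  · filter_upwards [eventually_mem_chart_target] with x hx
    rw [chartConj, chart_symm_one, one_mul, inv_one, mul_one, (φ).right_inv hx]
  -- The relation `gh = (ghg⁻¹)g` can be read in the chart once `ghg⁻¹` lies in the chart domain,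
  -- which continuity gives near the unit.
  · have h1 : ContMDiffAt 𝓘(ℝ, E × E) 𝓘(ℝ, E) ∞ (fun p : E × E => (φ).symm p.1 *
        (φ).symm p.2 * ((φ).symm p.1)⁻¹ : E × E → G) (φ 1, φ 1) :=
      ContMDiffAt.mul (ContMDiffAt.mul
        (contMDiffAt_chart_symm_comp contDiffAt_fst rfl)
        (contMDiffAt_chart_symm_comp contDiffAt_snd rfl))
        (contMDiffAt_chart_symm_comp contDiffAt_fst rfl).inv
    have h2 := h1.continuousAt.eventually (p := fun g => g ∈ (φ : PartialEquiv G E).source)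
      (by
        simp only [chart_symm_one, mul_one, inv_one]
        exact extChartAt_source_mem_nhds _)
    filter_upwards [h2] with p hp
    simp only [chartMul, chartConj, (φ).left_inv hp, inv_mul_cancel_right]

theorem hasDerivAt_lieAdE_zero [T2Space G] (μ ξ : LieAlg E G) :
    HasDerivAt (fun s : ℝ => lieAdE E (lieExp (s • μ) : G) ξ) (show E from (⁅μ, ξ⁆ : LieAlg E G)) 0 := by
  have h0 : (lieExp ((0 : ℝ) • μ) : G) = 1 := by rw [zero_smul, lieExp_zero]
  have h1 := hasMFDerivAt_comp_of_eq (E₂ := E) (E₃ := E) hasMFDerivAt_chart_one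
    (hasMFDerivAt_lieExp_smul_zero μ) h0
  have h2 := hasFDerivAt_of_hasMFDerivAt h1
  obtain ⟨h3, h4⟩ := hasFDerivAt_lieAdE_chart_symm (G := G) μ ξ
  set D := fderiv ℝ (fun x : E => lieAdE E ((φ).symm x : G) ξ) (φ (1 : G)) with hD
  have h3' : HasFDerivAt (fun x : E => lieAdE E ((φ).symm x : G) ξ) D
      (φ (lieExp ((0 : ℝ) • μ) : G)) := by
    rw [h0]
    exact h3
  have h5 := HasFDerivAt.comp (f := fun s : ℝ => (φ (lieExp (s • μ) : G))) (0 : ℝ) h3' h2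
  rw [← h4, hasDerivAt_iff_hasFDerivAt]
  refine (h5.congr_fderiv ?_).congr_of_eventuallyEq ?_
  · exact ContinuousLinearMap.ext fun r => map_smul D r (show E from μ)
  · have h6 : ∀ᶠ s : ℝ in 𝓝 0, (lieExp (s • μ) : G) ∈ (φ : PartialEquiv G E).source :=
      (continuous_lieExp_smul μ).continuousAt.eventually
        (by simp only [h0]; exact extChartAt_source_mem_nhds _)
    filter_upwards [h6] with s hs
    simp only [Function.comp, (φ).left_inv hs]

theorem hasDerivAt_lieAdE [T2Space G] (μ ξ : LieAlg E G) (s : ℝ) :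
    HasDerivAt (fun s : ℝ => lieAdE E (lieExp (s • μ) : G) ξ)
      (lieAdE E (lieExp (s • μ) : G) (show E from (⁅μ, ξ⁆ : LieAlg E G))) s := by
  have h0 := hasDerivAt_lieAdE_zero (G := G) μ ξ
  have h1 := h0.scomp_of_eq s ((hasDerivAt_id s).sub_const s) (by simp)
  have h2 := (lieAdE E (lieExp (s • μ) : G)).hasFDerivAt.comp_hasDerivAt s h1
  refine (h2.congr_deriv (congrArg _ (one_smul ℝ _))).congr_of_eventuallyEq (Filter.Eventually.of_forall fun t => ?_)
  have h3 : (lieExp (t • μ) : G) = lieExp (s • μ) * lieExp ((t - s) • μ) := by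
    rw [← lieExp_add_smul, add_sub_cancel]
  simp only [h3, Function.comp]
  exact lieAd_mul _ _ ξ

end Adjoint
-- Products of exponentials as coordinates near the unit.
section ExpProd

variable {E : Type*} [NormedAddCommGroup E] [NormedSpace ℝ E] [FiniteDimensional ℝ E]
  {G : Type*} [TopologicalSpace G] [ChartedSpace E G] [Group G] [LieGroup 𝓘(ℝ, E) ∞ G] [T2Space G]
  {ι : Type*} [Fintype ι]

/-- The ordered product of the exponentials `exp (t i • v i)`, for `i` in a list. -/
noncomputable def expProd (v : ι → LieAlg E G) (l : List ι) (t : ι → ℝ) : G :=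
  (l.map fun i => lieExp (t i • v i)).prod

theorem expProd_cons (v : ι → LieAlg E G) (i : ι) (l : List ι) (t : ι → ℝ) :
    expProd v (i :: l) t = lieExp (t i • v i) * expProd v l t := by
  simp [expProd]

theorem expProd_zero (v : ι → LieAlg E G) (l : List ι) : expProd v l 0 = 1 := by
  simp [expProd, lieExp_zero]

theorem contMDiff_expProd (v : ι → LieAlg E G) (l : List ι) :
    ContMDiff 𝓘(ℝ, ι → ℝ) 𝓘(ℝ, E) 1 (expProd v l) := by
  have : LieGroup 𝓘(ℝ, E) 1 G := LieGroup.of_le (n := ∞) (by norm_num)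
  induction l with
  | nil => exact contMDiff_const
  | cons i l ih =>
    have h1 : ContMDiff 𝓘(ℝ, ι → ℝ) 𝓘(ℝ, E) 1 fun t : ι → ℝ => (lieExp (t i • v i) : G) :=
      (contMDiff_lieExp_smul (v i)).comp (contDiff_apply ℝ ℝ i).contMDiff
    have h2 := h1.mul ih
    refine h2.congr fun t => ?_
    rw [expProd_cons]
    rfl

/-- The linear map `t ↦ ∑ t i • v i`, the sum being over a list. -/
noncomputable def linComb (v : ι → E) (l : List ι) : (ι → ℝ) →L[ℝ] E :=
  (l.map fun i => (ContinuousLinearMap.proj i : (ι → ℝ) →L[ℝ] ℝ).smulRight (v i)).sum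

theorem linComb_apply (v : ι → E) (l : List ι) (t : ι → ℝ) :
    linComb v l t = (l.map fun i => t i • v i).sum := by
  induction l with
  | nil => rfl
  | cons i l ih =>
    rw [linComb] at ih ⊢
    rw [List.map_cons, List.sum_cons, add_apply, ih, List.map_cons, List.sum_cons]
    rfl

theorem hasMFDerivAt_expProd_zero (v : ι → LieAlg E G) (l : List ι) :
    HasMFDerivAt 𝓘(ℝ, ι → ℝ) 𝓘(ℝ, E) (expProd v l) 0 (linComb (E := E) v l) := by
  induction l with
  | nil => exact hasMFDerivAt_const (1 : G) (0 : ι → ℝ)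
  | cons i l ih =>
    have h0 : HasMFDerivAt 𝓘(ℝ, ι → ℝ) 𝓘(ℝ, ℝ) (fun t : ι → ℝ => t i) 0
        (ContinuousLinearMap.proj i : (ι → ℝ) →L[ℝ] ℝ) :=
      (hasFDerivAt_apply i (0 : ι → ℝ)).hasMFDerivAt
    have h1 := hasMFDerivAt_comp_of_eq (hasMFDerivAt_lieExp_smul_zero (v i)) h0 rfl
    have h2 := hasMFDerivAt_mul_of_eq_one h1 ih (by simp [lieExp_zero]) (expProd_zero v l)
    have h3 : (fun t => lieExp (t i • v i) * expProd v l t) = expProd v (i :: l) :=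
      funext fun t => (expProd_cons v i l t).symm
    rw [h3] at h2
    refine h2.congr_mfderiv ?_
    refine Eq.trans ?_ (List.sum_cons (α := (ι → ℝ) →L[ℝ] E)).symm
    exact congrArg₂ (· + ·) (ContinuousLinearMap.ext fun t => rfl) rfl

theorem hasStrictFDerivAt_chart_expProd (v : ι → LieAlg E G) (l : List ι) :
    HasStrictFDerivAt (fun t => extChartAt 𝓘(ℝ, E) (1 : G) (expProd v l t))
      (linComb (E := E) v l) 0 := by
  have : IsManifold 𝓘(ℝ, E) 1 G := IsManifold.of_le (n := ∞) (by norm_num)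
  have h1 : ContDiffAt ℝ 1 (fun t => extChartAt 𝓘(ℝ, E) (1 : G) (expProd v l t)) 0 := by
    rw [← contMDiffAt_iff_contDiffAt]
    refine ContMDiffAt.comp (0 : ι → ℝ) (g := extChartAt 𝓘(ℝ, E) (1 : G)) ?_
      ((contMDiff_expProd v l) 0)
    rw [expProd_zero]
    exact contMDiffAt_extChartAt
  have h2 := hasFDerivAt_of_hasMFDerivAt (hasMFDerivAt_comp_of_eq hasMFDerivAt_chart_one
    (hasMFDerivAt_expProd_zero v l) (expProd_zero v l))
  exact h1.hasStrictFDerivAt' (h2.congr_fderiv (ContinuousLinearMap.id_comp _)) (by norm_num)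

/-- The derivative at zero is `t ↦ ∑ t i • v i`, which is onto for a basis, so the map is open at
zero. The hypothesis on `l` says that each index occurs once. -/
theorem map_nhds_expProd (v : Module.Basis ι ℝ (LieAlg E G)) (l : List ι)
    (hl : ∀ f : ι → E, (l.map f).sum = ∑ i, f i) :
    Filter.map (expProd v l) (𝓝 0) = 𝓝 1 := by
  have h1 := (hasStrictFDerivAt_chart_expProd v l).map_nhds_eq_of_surj (by
    rw [LinearMap.range_eq_top]
    exact fun w => ⟨v.repr w, (linComb_apply (E := E) _ _ _).trans ((hl _).trans (v.sum_repr w))⟩)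
  have h2 : Filter.map (fun t => (extChartAt 𝓘(ℝ, E) (1 : G)).symm
      (extChartAt 𝓘(ℝ, E) (1 : G) (expProd v l t))) (𝓝 0) = 𝓝 1 := by
    have h3 := congrArg (Filter.map (extChartAt 𝓘(ℝ, E) (1 : G)).symm) h1
    rw [Filter.map_map, expProd_zero, ← map_extChartAt_nhds_of_boundaryless (I := 𝓘(ℝ, E)) (1 : G),
      Filter.map_map] at h3
    refine h3.trans ?_
    conv_rhs => rw [← Filter.map_id (f := 𝓝 (1 : G))]
    refine Filter.map_congr ?_
    filter_upwards [extChartAt_source_mem_nhds (I := 𝓘(ℝ, E)) (1 : G)] with g hg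
    exact (extChartAt 𝓘(ℝ, E) (1 : G)).left_inv hg
  rw [← h2]
  refine Filter.map_congr ?_
  have h4 : ∀ᶠ t in 𝓝 (0 : ι → ℝ), expProd v l t ∈ (extChartAt 𝓘(ℝ, E) (1 : G)).source :=
    (contMDiff_expProd v l).continuous.continuousAt.eventually
      (by rw [expProd_zero]; exact extChartAt_source_mem_nhds _)
  filter_upwards [h4] with t ht
  exact ((extChartAt 𝓘(ℝ, E) (1 : G)).left_inv ht).symm

/-- Independence gives the derivative at zero a left inverse `P`; the chart expression followed by
`P` has identity derivative and is a local homeomorphism. The independent family need not be a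
basis. -/
theorem exists_injOn_expProd {v : ι → LieAlg E G} (hv : LinearIndependent ℝ v) (l : List ι)
    (hl : ∀ f : ι → E, (l.map f).sum = ∑ i, f i) :
    ∃ U ∈ 𝓝 (0 : ι → ℝ), Set.InjOn (expProd v l) U := by
  have hs := hasStrictFDerivAt_chart_expProd v l
  obtain ⟨P, hP⟩ : ∃ P : E →L[ℝ] (ι → ℝ), P.comp (linComb (E := E) v l) =
      ((ContinuousLinearEquiv.refl ℝ (ι → ℝ) : (ι → ℝ) ≃L[ℝ] (ι → ℝ)) :
        (ι → ℝ) →L[ℝ] (ι → ℝ)) := by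
    have hinj : Function.Injective (linComb (E := E) v l) :=
      (injective_iff_map_eq_zero _).2 fun t ht => funext (Fintype.linearIndependent_iff.1 hv t
        (((linComb_apply (E := E) _ _ _).trans (hl _)).symm.trans ht))
    obtain ⟨P, hP⟩ := (linComb (E := E) v l).toLinearMap.exists_leftInverse_of_injective
      (LinearMap.ker_eq_bot.2 hinj)
    exact ⟨LinearMap.toContinuousLinearMap P,
      ContinuousLinearMap.ext fun t => DFunLike.congr_fun hP t⟩
  have h1 := P.hasStrictFDerivAt.comp 0 hs
  rw [hP] at h1
  refine ⟨(h1.toOpenPartialHomeomorph _).source,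
    (h1.toOpenPartialHomeomorph _).open_source.mem_nhds h1.mem_toOpenPartialHomeomorph_source, ?_⟩
  intro s hs t ht hst
  refine (h1.toOpenPartialHomeomorph _).injOn hs ht ?_
  simp [hst]

theorem map_nhds_expProd_basis (v : Module.Basis ι ℝ (LieAlg E G)) :
    Filter.map (expProd v Finset.univ.toList) (𝓝 0) = 𝓝 1 :=
  map_nhds_expProd v _ fun f => by simp

theorem eventually_exists_expProd (v : Module.Basis ι ℝ (LieAlg E G)) {U : Set (ι → ℝ)}
    (hU : U ∈ 𝓝 0) : ∀ᶠ g in 𝓝 (1 : G), ∃ t ∈ U, expProd v Finset.univ.toList t = g := by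
  rw [← map_nhds_expProd_basis v]
  filter_upwards [Filter.image_mem_map hU] with g hg
  exact hg

theorem eq_top_of_nhds_one_mem (E : Type*) [NormedAddCommGroup E] [NormedSpace ℝ E]
    {G : Type*} [TopologicalSpace G] [ChartedSpace E G] [Group G] [LieGroup 𝓘(ℝ, E) ∞ G] [ConnectedSpace G] {H : Subgroup G} (hH : (H : Set G) ∈ 𝓝 1) :
    H = ⊤ := by
  have : IsTopologicalGroup G := topologicalGroup_of_lieGroup 𝓘(ℝ, E) ∞
  have h1 := H.isOpen_of_mem_nhds hH
  have h2 := H.isClosed_of_isOpen h1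
  have h3 := IsClopen.eq_univ ⟨h2, h1⟩ ⟨1, H.one_mem⟩
  exact SetLike.coe_injective h3

/-- A connected Lie group is generated by exponentials. -/
theorem closure_range_lieExp [ConnectedSpace G] :
    Subgroup.closure (Set.range (lieExp : LieAlg E G → G)) = ⊤ := by
  refine eq_top_of_nhds_one_mem E ?_
  filter_upwards [eventually_exists_expProd (G := G) (E := E) (Module.finBasis ℝ E)
    Filter.univ_mem] with g hg
  obtain ⟨t, -, rfl⟩ := hg
  refine Subgroup.list_prod_mem _ fun x hx => ?_
  obtain ⟨i, -, rfl⟩ := List.mem_map.1 hx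
  exact Subgroup.subset_closure ⟨_, rfl⟩

/-- The derivative of `s ↦ Ad(exp sμ) ξ` is `Ad(exp sμ)[μ, ξ] = 0`, so `exp μ` fixes `ξ`. -/
theorem lieExp_commute_of_lie_eq_zero {μ ξ : LieAlg E G} (h : ⁅μ, ξ⁆ = 0) :
    Commute (lieExp μ : G) (lieExp ξ) := by
  have h1 : ∀ s, HasDerivAt (fun s : ℝ => lieAdE E (lieExp (s • μ) : G) ξ) 0 s := by
    intro s
    have h2 := hasDerivAt_lieAdE (G := G) μ ξ s
    rw [h] at h2
    exact h2.congr_deriv (map_zero _)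
  have h3 := is_const_of_deriv_eq_zero (fun s => (h1 s).differentiableAt) (fun s => (h1 s).deriv) 1 0
  have h4 : lieAd (lieExp μ : G) ξ = ξ := by
    have h5 : lieAdE E (lieExp ((1 : ℝ) • μ) : G) ξ = lieAdE E (lieExp ((0 : ℝ) • μ) : G) ξ := h3
    rw [one_smul, zero_smul, lieExp_zero] at h5
    exact h5.trans (lieAd_one ξ)
  have h6 := lieExp_lieAd (lieExp μ : G) ξ
  rw [h4, eq_mul_inv_iff_mul_eq] at h6
  exact h6.symm

theorem lie_eq_zero_of_commute {μ ξ : LieAlg E G}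
    (h : ∀ s t : ℝ, Commute (lieExp (s • μ) : G) (lieExp (t • ξ))) : ⁅μ, ξ⁆ = 0 := by
  have h1 := hasDerivAt_lieAdE_zero (G := G) μ ξ
  have h2 : (fun s : ℝ => lieAdE E (lieExp (s • μ) : G) ξ) = fun _ => (show E from ξ) :=
    funext fun s => lieAd_eq_self (h s)
  rw [h2] at h1
  exact h1.unique (hasDerivAt_const 0 _)

end ExpProd

/-! ### The exponential map and the characters of a torus. -/

section Torus

variable {F T : Type*} [NormedAddCommGroup F] [NormedSpace ℝ F] [FiniteDimensional ℝ F]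
  [TopologicalSpace T] [ChartedSpace F T] [CommGroup T] [LieGroup 𝓘(ℝ, F) ∞ T] [T2Space T]

theorem lieExp_add_comm (ξ η : LieAlg F T) : (lieExp (ξ + η) : T) = lieExp ξ * lieExp η :=
  lieExp_add_of_commute fun _ _ => Commute.all _ _

/-- In an abelian group the image of the exponential is a subgroup, and exponentials generate a
connected group. -/
theorem lieExp_surjective [ConnectedSpace T] (t : T) : ∃ ξ : LieAlg F T, lieExp ξ = t := by
  let H : Subgroup T :=
    { carrier := Set.range (lieExp : LieAlg F T → T)
      one_mem' := ⟨0, lieExp_zero⟩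
      mul_mem' := by
        rintro _ _ ⟨ξ, rfl⟩ ⟨η, rfl⟩
        exact ⟨ξ + η, lieExp_add_comm ξ η⟩
      inv_mem' := by
        rintro _ ⟨ξ, rfl⟩
        exact ⟨-ξ, lieExp_neg ξ⟩ }
  have h1 : (⊤ : Subgroup T) ≤ H := by
    rw [← closure_range_lieExp (E := F), Subgroup.closure_le]
    exact subset_rfl
  exact h1 (Subgroup.mem_top t)

variable {E G : Type*} [NormedAddCommGroup E] [NormedSpace ℝ E]
  [FiniteDimensional ℝ E] [TopologicalSpace G] [ChartedSpace E G] [Group G] [LieGroup 𝓘(ℝ, E) ∞ G]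
  [T2Space G]

namespace TorusData

variable (S : TorusData E F G T)

theorem lieExp_lieMap (ξ : LieAlg F T) :
    (lieExp (lieMap S.incl ξ : LieAlg E G) : G) = S.incl (lieExp ξ) :=
  lieExp_mfderiv S.incl (S.incl_smooth.mdifferentiableAt (by norm_num)) ξ

theorem lieExp_smul_lieMap (s : ℝ) (ξ : LieAlg F T) :
    (lieExp (s • (lieMap S.incl ξ : LieAlg E G)) : G) = S.incl (lieExp (s • ξ)) := by
  rw [← S.lieExp_lieMap, map_smul]

theorem lieMap_basisT_linearIndependent :
    LinearIndependent ℝ fun k => (lieMap S.incl (S.basisT k) : LieAlg E G) := by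
  refine Fintype.linearIndependent_iff.2 fun c hc l => ?_
  have h := congrArg (fun x : LieAlg E G => S.form x (lieMap S.incl (S.basisT l))) hc
  simpa [S.basisT_orthonormal] using h

theorem lieMap_injective : Function.Injective (lieMap S.incl : LieAlg F T →ₗ[ℝ] LieAlg E G) := by
  refine (injective_iff_map_eq_zero _).2 fun ξ hξ => ?_
  rw [← S.basisT.sum_repr ξ, map_sum] at hξ
  simp only [map_smul] at hξ
  have h := Fintype.linearIndependent_iff.1 S.lieMap_basisT_linearIndependent _ hξ
  rw [← S.basisT.sum_repr ξ]
  simp [h]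

theorem lie_lieMap (ξ η : LieAlg F T) :
    ⁅(lieMap S.incl ξ : LieAlg E G), (lieMap S.incl η : LieAlg E G)⁆ = 0 := by
  refine lie_eq_zero_of_commute (E := E) (G := G) fun s t => ?_
  rw [S.lieExp_smul_lieMap, S.lieExp_smul_lieMap]
  exact (Commute.all _ _).map S.incl

/-- Two logarithms of the same point differ by an element of the integral lattice, on which a weight
is integral. The arbitrary choice of logarithm in `tpow` is therefore harmless. -/
theorem tpow_lieExp {ν : LieAlg F T} (hν : ν ∈ S.weightLattice) (ξ : LieAlg F T) :
    S.tpow (lieExp ξ) ν = Complex.exp (2 * Real.pi * Complex.I * (S.formT ν ξ : ℂ)) := by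
  rw [tpow]
  set η := Classical.epsilon fun η : LieAlg F T => (lieExp η : T) = lieExp ξ with hη
  have h1 : (lieExp η : T) = lieExp ξ :=
    Classical.epsilon_spec (p := fun η : LieAlg F T => (lieExp η : T) = lieExp ξ) ⟨ξ, rfl⟩
  have h2 : (lieExp (η - ξ) : T) = 1 := by
    rw [sub_eq_add_neg, lieExp_add_comm, lieExp_neg, h1, mul_inv_cancel]
  obtain ⟨m, hm⟩ := hν _ h2
  have h3 : S.formT ν η = S.formT ν ξ + m := by
    rw [← hm, map_sub]; ring
  rw [Complex.exp_eq_exp_iff_exists_int]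
  refine ⟨m, ?_⟩
  rw [h3]
  push_cast
  ring

end TorusData
end Torus
-- Maximality of the torus: its Lie algebra is its own centralizer.
section Centralizer

variable {F T : Type*} [NormedAddCommGroup F] [NormedSpace ℝ F] [FiniteDimensional ℝ F]
  [TopologicalSpace T] [ChartedSpace F T] [CommGroup T] [LieGroup 𝓘(ℝ, F) ∞ T] [T2Space T]
  {E G : Type*} [NormedAddCommGroup E] [NormedSpace ℝ E]
  [FiniteDimensional ℝ E] [TopologicalSpace G] [ChartedSpace E G] [Group G] [LieGroup 𝓘(ℝ, E) ∞ G]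
  [T2Space G]

namespace TorusData

variable (S : TorusData E F G T)

/-- A one-parameter subgroup with values in the maximal torus is tangent to it. -/
theorem mem_range_lieMap_of_lieExp_mem [CompactSpace T] {ξ : LieAlg E G}
    (h : ∀ s : ℝ, (lieExp (s • ξ) : G) ∈ S.incl.range) :
    ∃ η : LieAlg F T, lieMap S.incl η = ξ := by
  classical
  by_contra hξ
  have hspan : ξ ∉ Submodule.span ℝ (Set.range fun k => (lieMap S.incl (S.basisT k) : LieAlg E G)) := by
    intro hmem
    refine hξ ?_
    have h1 : Submodule.span ℝ (Set.range fun k => (lieMap S.incl (S.basisT k) : LieAlg E G)) ≤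
        LinearMap.range (lieMap S.incl : LieAlg F T →ₗ[ℝ] LieAlg E G) := by
      rw [Submodule.span_le]
      rintro _ ⟨k, rfl⟩
      exact ⟨_, rfl⟩
    exact h1 hmem
  -- If `ξ` were not tangent to `T`, it would be independent of the basis of `t`, and products
  -- `exp(sξ) ∏ exp(t_k e_k)` would have unique coordinates near zero.
  have hli := S.lieMap_basisT_linearIndependent.option hspan
  set v : Option (Fin (Module.finrank ℝ F)) → LieAlg E G :=
    fun o => Option.casesOn' o ξ fun k => lieMap S.incl (S.basisT k) with hv
  set l' : List (Fin (Module.finrank ℝ F)) := Finset.univ.toList with hl'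
  obtain ⟨U, hU, hinj⟩ := exists_injOn_expProd (G := G) hli (none :: l'.map some) (by
    intro f
    simp [Fintype.sum_option, hl', Function.comp_def])
  have hA : Continuous fun s : ℝ => (fun o : Option (Fin (Module.finrank ℝ F)) =>
      Option.casesOn' o s fun _ => (0 : ℝ)) := by
    refine continuous_pi fun o => ?_
    cases o
    · exact continuous_id
    · exact continuous_const
  have hB : Continuous fun t : Fin (Module.finrank ℝ F) → ℝ =>
      (fun o : Option (Fin (Module.finrank ℝ F)) => Option.casesOn' o (0 : ℝ) t) := by
    refine continuous_pi fun o => ?_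
    cases o
    · exact continuous_const
    · exact continuous_apply _
  have hA0 : (fun o : Option (Fin (Module.finrank ℝ F)) =>
      Option.casesOn' o (0 : ℝ) fun _ => (0 : ℝ)) = 0 := by
    ext o; cases o <;> rfl
  have hAU := (hA.continuousAt (x := 0)).eventually (p := fun x => x ∈ U) (by
    simp only [hA0]; exact hU)
  have hBU := (hB.continuousAt (x := 0)).preimage_mem_nhds (t := U)
    (by
      have : (fun o : Option (Fin (Module.finrank ℝ F)) => Option.casesOn' o (0 : ℝ)
        (0 : Fin (Module.finrank ℝ F) → ℝ)) = 0 := hA0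
      rwa [this])
  have hT := eventually_exists_expProd (G := T) S.basisT hBU
  choose τ hτ using h
  -- Compactness makes the inclusion an embedding, so the points `τ s` of `T` over `exp(sξ)` tend to
  -- `1` and acquire small coordinates in `T`.
  have hemb := (S.incl_smooth.continuous.isClosedEmbedding S.incl_injective).isInducing
  have hτ0 : Filter.Tendsto τ (𝓝 0) (𝓝 1) := by
    rw [hemb.tendsto_nhds_iff, map_one]
    have h1 := (continuous_lieExp_smul (G := G) ξ).tendsto 0
    rw [zero_smul, lieExp_zero] at h1
    exact h1.congr fun s => (hτ s).symm
  obtain ⟨s, ⟨hs1, hs2⟩, hs0⟩ := (((hAU.and (hτ0.eventually hT)).filter_mono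
    nhdsWithin_le_nhds).and (eventually_mem_nhdsWithin (a := (0 : ℝ)) (s := {0}ᶜ))).exists
  obtain ⟨t, ht, hts⟩ := hs2
  refine hs0 ?_
  -- The coordinates `(s, 0)` and `(0, t)` give the same point of `G`. Injectivity forces `s = 0`,
  -- although `s` was chosen nonzero.
  have h3 := hinj hs1 ht ?_
  · exact congrFun h3 none
  · simp only [expProd_cons]
    have h4 : ∀ r : Option (Fin (Module.finrank ℝ F)) → ℝ, expProd v (l'.map some) r =
        S.incl (expProd S.basisT l' fun k => r (some k)) := by
      intro r
      simp only [expProd, List.map_map, Function.comp_def, hv, Option.casesOn', map_list_prod,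
        S.lieExp_smul_lieMap]
    rw [h4, h4]
    change lieExp (s • ξ) * S.incl (expProd S.basisT l' 0) =
      lieExp ((0 : ℝ) • ξ) * S.incl (expProd S.basisT l' t)
    rw [expProd_zero, map_one, mul_one, zero_smul, lieExp_zero, one_mul, hts, hτ]

theorem incl_commute_lieExp [ConnectedSpace T] {ξ : LieAlg E G}
    (h : ∀ η : LieAlg F T, ⁅(lieMap S.incl η : LieAlg E G), ξ⁆ = 0) (t : T) (s : ℝ) :
    Commute (S.incl t) (lieExp (s • ξ)) := by
  obtain ⟨η, rfl⟩ := lieExp_surjective (F := F) t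
  rw [← S.lieExp_lieMap]
  exact lieExp_commute_of_lie_eq_zero (by rw [lie_smul, h, smul_zero])

/-- The Lie algebra of a maximal torus is its own centralizer. -/
theorem mem_range_lieMap_of_lie_eq_zero [CompactSpace T] [ConnectedSpace T] {ξ : LieAlg E G}
    (h : ∀ η : LieAlg F T, ⁅(lieMap S.incl η : LieAlg E G), ξ⁆ = 0) :
    ∃ η : LieAlg F T, lieMap S.incl η = ξ := by
  have hG : IsTopologicalGroup G := topologicalGroup_of_lieGroup 𝓘(ℝ, E) ∞
  have hc := S.incl_commute_lieExp h
  have hcs : ∀ s s' : ℝ, Commute (lieExp (s • ξ) : G) (lieExp (s' • ξ)) := fun s s' => by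
    rw [Commute, SemiconjBy, ← lieExp_add_smul, ← lieExp_add_smul, add_comm]
  -- The group `T · exp(ℝξ)` is connected and abelian, and so is its closure; maximality then places
  -- `exp(sξ)` in `T`.
  let H₀ : Subgroup G :=
    { carrier := Set.range fun p : T × ℝ => S.incl p.1 * lieExp (p.2 • ξ)
      one_mem' := ⟨(1, 0), by simp [lieExp_zero]⟩
      mul_mem' := by
        rintro _ _ ⟨⟨t, s⟩, rfl⟩ ⟨⟨t', s'⟩, rfl⟩
        refine ⟨(t * t', s + s'), ?_⟩
        simp only [map_mul, lieExp_add_smul]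
        rw [mul_assoc, mul_assoc, ← mul_assoc (S.incl t'), (hc t' s).eq, mul_assoc]
      inv_mem' := by
        rintro _ ⟨⟨t, s⟩, rfl⟩
        refine ⟨(t⁻¹, -s), ?_⟩
        simp only [map_inv, neg_smul, lieExp_neg, mul_inv_rev]
        exact ((hc t s).inv_inv).eq }
  have hH₀ : ∀ a ∈ H₀, ∀ b ∈ H₀, a * b = b * a := by
    rintro _ ⟨⟨t, s⟩, rfl⟩ _ ⟨⟨t', s'⟩, rfl⟩
    exact (((Commute.all t t').map S.incl).mul_left (hc t' s).symm).mul_right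
      ((hc t s').mul_left (hcs s s'))
  have hcomm : ∀ a ∈ closure (H₀ : Set G), ∀ b ∈ closure (H₀ : Set G), a * b = b * a := by
    have h1 : ∀ b ∈ H₀, ∀ a ∈ closure (H₀ : Set G), a * b = b * a := fun b hb =>
      closure_minimal (t := {a | a * b = b * a}) (fun a ha => hH₀ a ha b hb)
        (isClosed_eq (continuous_id.mul continuous_const) (continuous_const.mul continuous_id))
    intro a ha
    exact closure_minimal (t := {b | a * b = b * a}) (fun b hb => h1 b hb a ha)
      (isClosed_eq (continuous_const.mul continuous_id) (continuous_id.mul continuous_const))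
  have hconn : IsConnected (H₀ : Set G) := by
    refine isConnected_range (f := fun p : T × ℝ => S.incl p.1 * (lieExp (p.2 • ξ) : G)) ?_
    exact (S.incl_smooth.continuous.comp continuous_fst).mul
      ((continuous_lieExp_smul ξ).comp continuous_snd)
  have hmax := S.incl_maximal H₀.topologicalClosure H₀.isClosed_topologicalClosure hconn.closure
    hcomm (le_trans (by
      rintro _ ⟨t, rfl⟩
      exact ⟨(t, 0), by simp [lieExp_zero]⟩) H₀.le_topologicalClosure)
  refine S.mem_range_lieMap_of_lieExp_mem fun s => ?_
  rw [← hmax]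
  exact H₀.le_topologicalClosure ⟨(1, s), by simp⟩

end TorusData
end Centralizer
-- Complexification of a real inner product space.
section Complexification

variable {V : Type*} [AddCommGroup V] [Module ℝ V] (B : LinearMap.BilinForm ℝ V)

theorem cxForm_tmul (a b : ℂ) (v w : V) : cxForm B (a ⊗ₜ v) (b ⊗ₜ w) = a * b * (B v w : ℂ) := by
  simp only [cxForm, LinearMap.BilinForm.baseChange_tmul]
  simp [mul_comm]

theorem cxConj_tmul (a : ℂ) (v : V) : cxConj (a ⊗ₜ[ℝ] v) = (starRingEnd ℂ a) ⊗ₜ[ℝ] v := rfl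

theorem cxConj_cxConj (x : Cx V) : cxConj (cxConj x) = x := by
  induction x using TensorProduct.induction_on with
  | zero => simp
  | add x y hx hy => rw [map_add, map_add, hx, hy]
  | tmul a v => simp [cxConj_tmul]

theorem cxConj_smul (c : ℂ) (x : Cx V) : cxConj (c • x) = (starRingEnd ℂ c) • cxConj x := by
  induction x using TensorProduct.induction_on with
  | zero => simp
  | add x y hx hy => rw [smul_add, map_add, map_add, hx, hy, smul_add]
  | tmul a v => simp [cxConj_tmul, TensorProduct.smul_tmul']

theorem cxForm_cxConj (x y : Cx V) :
    cxForm B (cxConj x) (cxConj y) = starRingEnd ℂ (cxForm B x y) := by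
  induction x using TensorProduct.induction_on with
  | zero => simp
  | add x x' hx hx' => simp only [map_add, LinearMap.add_apply, hx, hx']
  | tmul a v =>
    induction y using TensorProduct.induction_on with
    | zero => simp
    | add y y' hy hy' => simp only [map_add, hy, hy']
    | tmul b w => simp only [cxConj_tmul, cxForm_tmul, map_mul, Complex.conj_ofReal]

/-- The real part of an element of the complexification. -/
noncomputable def cxRe : Cx V →ₗ[ℝ] V :=
  (TensorProduct.lid ℝ V).toLinearMap ∘ₗ LinearMap.rTensor V Complex.reLm

/-- The imaginary part of an element of the complexification. -/
noncomputable def cxIm : Cx V →ₗ[ℝ] V :=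
  (TensorProduct.lid ℝ V).toLinearMap ∘ₗ LinearMap.rTensor V Complex.imLm

theorem cxRe_tmul (a : ℂ) (v : V) : cxRe (a ⊗ₜ[ℝ] v) = a.re • v := by simp [cxRe]

theorem cxIm_tmul (a : ℂ) (v : V) : cxIm (a ⊗ₜ[ℝ] v) = a.im • v := by simp [cxIm]

theorem cx_eq_re_add_im (x : Cx V) :
    x = (1 : ℂ) ⊗ₜ[ℝ] cxRe x + Complex.I ⊗ₜ[ℝ] cxIm x := by
  induction x using TensorProduct.induction_on with
  | zero => simp
  | add x y hx hy =>
    rw [map_add, map_add, TensorProduct.tmul_add, TensorProduct.tmul_add]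
    nth_rewrite 1 [hx, hy]
    abel
  | tmul a v =>
    rw [cxRe_tmul, cxIm_tmul, ← TensorProduct.smul_tmul, ← TensorProduct.smul_tmul,
      ← TensorProduct.add_tmul]
    congr 1
    apply Complex.ext <;> simp

theorem cxRe_baseChange (f : V →ₗ[ℝ] V) (x : Cx V) : cxRe (f.baseChange ℂ x) = f (cxRe x) := by
  induction x using TensorProduct.induction_on with
  | zero => simp
  | add x y hx hy => simp only [map_add, hx, hy]
  | tmul a v => simp [cxRe_tmul]

theorem cxIm_baseChange (f : V →ₗ[ℝ] V) (x : Cx V) : cxIm (f.baseChange ℂ x) = f (cxIm x) := by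
  induction x using TensorProduct.induction_on with
  | zero => simp
  | add x y hx hy => simp only [map_add, hx, hy]
  | tmul a v => simp [cxIm_tmul]

variable {B}

theorem cxForm_cxConj_self (hB : ∀ v w, B v w = B w v) (x : Cx V) :
    cxForm B (cxConj x) x = ((B (cxRe x) (cxRe x) + B (cxIm x) (cxIm x) : ℝ) : ℂ) := by
  have h := cx_eq_re_add_im x
  set u := cxRe x
  set w := cxIm x
  rw [h]
  simp only [map_add, LinearMap.add_apply, cxConj_tmul, cxForm_tmul, hB w u]
  push_cast
  simp only [map_one, Complex.conj_I]
  linear_combination -(B w w : ℂ) * Complex.I_mul_I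

theorem cxForm_cxConj_self_nonneg (hB : ∀ v w, B v w = B w v) (hpos : ∀ v, v ≠ 0 → 0 < B v v)
    (x : Cx V) : 0 ≤ (cxForm B (cxConj x) x).re := by
  have h : ∀ v, 0 ≤ B v v := fun v => by
    by_cases hv : v = 0
    · simp [hv]
    · exact (hpos v hv).le
  rw [cxForm_cxConj_self hB, Complex.ofReal_re]
  exact add_nonneg (h _) (h _)

theorem eq_zero_of_cxForm_cxConj_self (hB : ∀ v w, B v w = B w v) (hpos : ∀ v, v ≠ 0 → 0 < B v v)
    {x : Cx V} (hx : (cxForm B (cxConj x) x).re ≤ 0) : x = 0 := by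
  have h : ∀ v, 0 ≤ B v v := fun v => by
    by_cases hv : v = 0
    · simp [hv]
    · exact (hpos v hv).le
  have h0 : ∀ v, B v v ≤ 0 → v = 0 := fun v hv => by
    by_contra h1
    exact absurd (hpos v h1) hv.not_gt
  rw [cxForm_cxConj_self hB, Complex.ofReal_re] at hx
  rw [cx_eq_re_add_im x, h0 (cxRe x) (by linarith [h (cxIm x)]),
    h0 (cxIm x) (by linarith [h (cxRe x)])]
  simp

/-- The hermitian inner product on the complexification of a real inner product space. -/
@[reducible]
noncomputable def cxInner (hB : ∀ v w, B v w = B w v) (hpos : ∀ v, v ≠ 0 → 0 < B v v) :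
    InnerProductSpace.Core ℂ (Cx V) where
  inner x y := cxForm B (cxConj x) y
  conj_inner_symm x y := by
    rw [← cxForm_cxConj, cxConj_cxConj, cxForm_symm B hB]
  re_inner_nonneg x := cxForm_cxConj_self_nonneg hB hpos x
  add_left x y z := by simp
  smul_left x y r := by simp [cxConj_smul]
  definite x hx := eq_zero_of_cxForm_cxConj_self hB hpos (by rw [hx]; simp)

/-- Commuting operators on the complexification, symmetric for the hermitian inner product, have
joint eigenvectors that span. -/
theorem eq_zero_of_forall_joint_eigenvector [FiniteDimensional ℝ V] (hB : ∀ v w, B v w = B w v)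
    (hpos : ∀ v, v ≠ 0 → 0 < B v v) {ι : Type*} (A : ι → Module.End ℂ (Cx V))
    (hA : ∀ i x y, cxForm B (cxConj (A i x)) y = cxForm B (cxConj x) (A i y))
    (hc : ∀ i j, Commute (A i) (A j)) (z : Cx V)
    (hz : ∀ (χ : ι → ℝ) (x : Cx V), (∀ i, A i x = (χ i : ℂ) • x) → cxForm B z x = 0) : z = 0 := by
  let c := cxInner hB hpos
  let _ : NormedAddCommGroup (Cx V) := c.toNormedAddCommGroup
  let _ : InnerProductSpace ℂ (Cx V) := InnerProductSpace.ofCore c.toCore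
  have hsymm : ∀ i, (A i).IsSymmetric := fun i x y => hA i x y
  have htop := LinearMap.IsSymmetric.iSup_iInf_eq_top_of_commute hsymm fun i j _ => hc i j
  have hker : ∀ x, x ∈ LinearMap.ker (cxForm B z) := by
    intro x
    have hx : x ∈ ⨆ χ : ι → ℂ, ⨅ i, Module.End.eigenspace (A i) (χ i) := by
      rw [htop]; trivial
    refine (iSup_le fun χ => ?_ : _ ≤ LinearMap.ker (cxForm B z)) hx
    intro y hy
    rw [Submodule.mem_iInf] at hy
    simp only [Module.End.mem_eigenspace_iff] at hy
    rw [LinearMap.mem_ker]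
    by_cases hy0 : y = 0
    · rw [hy0, map_zero]
    -- Symmetric operators have real eigenvalues, so testing against real `χ` suffices.
    refine hz (fun i => (χ i).re) y fun i => ?_
    have h1 : Module.End.HasEigenvalue (A i) (χ i) :=
      Module.End.hasEigenvalue_of_hasEigenvector ⟨Module.End.mem_eigenspace_iff.2 (hy i), hy0⟩
    have h2 := (hsymm i).conj_eigenvalue_eq_self h1
    rw [hy i, Complex.conj_eq_iff_re.1 h2]
  have h3 : cxConj z = 0 := by
    refine eq_zero_of_cxForm_cxConj_self hB hpos ?_
    rw [cxConj_cxConj, LinearMap.mem_ker.1 (hker _)]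
    simp
  rw [← cxConj_cxConj z, h3, map_zero]

end Complexification

/-! ### The complexified Lie algebra and its invariant form. -/

section LieAlgebra

variable {L : Type*} [LieRing L] [LieAlgebra ℝ L] (B : LinearMap.BilinForm ℝ L)

/-- The bracket of the complexified Lie algebra. -/
noncomputable def cxLie : Cx L →ₗ[ℂ] Cx L →ₗ[ℂ] Cx L :=
  LinearMap.mk₂ ℂ (fun x y => ⁅x, y⁆) (fun x y z => add_lie x y z) (fun c x y => smul_lie c x y)
    (fun x y z => lie_add x y z) (fun c x y => lie_smul c x y)

theorem cxLie_tmul (a b : ℂ) (x y : L) :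
    cxLie (a ⊗ₜ[ℝ] x) (b ⊗ₜ[ℝ] y) = (a * b) ⊗ₜ[ℝ] ⁅x, y⁆ := rfl

theorem cxLie_skew (x y : Cx L) : cxLie x y = -cxLie y x := (lie_skew x y).symm

theorem cxLie_jacobi (x y z : Cx L) :
    cxLie x (cxLie y z) = cxLie (cxLie x y) z + cxLie y (cxLie x z) := leibniz_lie x y z

theorem ad_baseChange_apply (ξ : L) (x : Cx L) :
    (LieAlgebra.ad ℝ L ξ).baseChange ℂ x = cxLie ((1 : ℂ) ⊗ₜ[ℝ] ξ) x := by
  induction x using TensorProduct.induction_on with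
  | zero => simp
  | add x y hx hy => rw [map_add, map_add, hx, hy]
  | tmul a v => simp [cxLie_tmul]

theorem cxConj_cxLie (x y : Cx L) : cxConj (cxLie x y) = cxLie (cxConj x) (cxConj y) := by
  induction x using TensorProduct.induction_on with
  | zero => simp
  | add x x' hx hx' => simp only [map_add, LinearMap.add_apply, hx, hx']
  | tmul a v =>
    induction y using TensorProduct.induction_on with
    | zero => simp
    | add y y' hy hy' => simp only [map_add, hy, hy']
    | tmul b w => simp [cxLie_tmul, cxConj_tmul]

variable {B}

theorem cxForm_cxLie (hinv : ∀ ξ η ζ, B ⁅ξ, η⁆ ζ = B ξ ⁅η, ζ⁆) (x y z : Cx L) :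
    cxForm B (cxLie x y) z = cxForm B x (cxLie y z) := by
  induction x using TensorProduct.induction_on with
  | zero => simp
  | add x x' hx hx' => simp only [map_add, LinearMap.add_apply, hx, hx']
  | tmul a u =>
    induction y using TensorProduct.induction_on with
    | zero => simp
    | add y y' hy hy' => simp only [map_add, LinearMap.add_apply, hy, hy']
    | tmul b v =>
      induction z using TensorProduct.induction_on with
      | zero => simp
      | add z z' hz hz' => simp only [map_add, hz, hz']
      | tmul c w =>
        simp only [cxLie_tmul, cxForm_tmul, hinv]
        ring

end LieAlgebra

/-- A compact Lie algebra with an abelian subalgebra that is its own centralizer. -/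
structure ToralPair (L H : Type*) [LieRing L] [LieAlgebra ℝ L] [AddCommGroup H] [Module ℝ H] where
  form : LinearMap.BilinForm ℝ L
  form_symm : ∀ ξ η, form ξ η = form η ξ
  form_pos : ∀ ξ, ξ ≠ 0 → 0 < form ξ ξ
  form_invariant : ∀ ξ η ζ, form ⁅ξ, η⁆ ζ = form ξ ⁅η, ζ⁆
  incl : H →ₗ[ℝ] L
  incl_injective : Function.Injective incl
  lie_incl : ∀ ξ η, ⁅incl ξ, incl η⁆ = 0
  centralizer : ∀ x, (∀ η, ⁅incl η, x⁆ = 0) → ∃ η, incl η = x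

/-! ### Weight spaces of the adjoint representation. -/

namespace ToralPair

variable {L H : Type*} [LieRing L] [LieAlgebra ℝ L] [AddCommGroup H] [Module ℝ H]
  (S : ToralPair L H)

/-- The inner product on the abelian subalgebra. -/
noncomputable def formH : LinearMap.BilinForm ℝ H := S.form.compl₁₂ S.incl S.incl

/-- Weight vectors of the adjoint representation. -/
def IsWeightVector (α : H) (x : Cx L) : Prop :=
  ∀ ξ : H, (LieAlgebra.ad ℝ L (S.incl ξ)).baseChange ℂ x =
    (2 * Real.pi * Complex.I * (S.formH α ξ : ℂ)) • x

/-- The nonzero weights of the adjoint representation. -/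
def roots : Set H := {α | α ≠ 0 ∧ ∃ x : Cx L, x ≠ 0 ∧ S.IsWeightVector α x}

variable {S}

theorem formH_symm (ξ η : H) : S.formH ξ η = S.formH η ξ := S.form_symm _ _

theorem formH_pos {ξ : H} (h : ξ ≠ 0) : 0 < S.formH ξ ξ :=
  S.form_pos _ fun h0 => h (S.incl_injective (h0.trans (map_zero _).symm))

theorem isWeightVector_iff {α : H} {x : Cx L} : S.IsWeightVector α x ↔
    ∀ ξ : H, cxLie ((1 : ℂ) ⊗ₜ[ℝ] S.incl ξ) x = (2 * Real.pi * Complex.I * (S.formH α ξ : ℂ)) • x := by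
  simp only [IsWeightVector, ad_baseChange_apply]

theorem IsWeightVector.conj {α : H} {x : Cx L} (h : S.IsWeightVector α x) :
    S.IsWeightVector (-α) (cxConj x) := by
  rw [isWeightVector_iff] at h ⊢
  intro ξ
  have h1 := congrArg cxConj (h ξ)
  rw [cxConj_cxLie, cxConj_smul, cxConj_tmul, map_one] at h1
  rw [h1]
  congr 1
  rw [map_neg, LinearMap.neg_apply, map_mul, map_mul, map_mul, Complex.conj_I, Complex.conj_ofReal,
    Complex.conj_ofReal, show (2 : ℂ) = ((2 : ℝ) : ℂ) by norm_num, Complex.conj_ofReal]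
  push_cast
  ring

theorem IsWeightVector.lie {α β : H} {x y : Cx L} (hx : S.IsWeightVector α x)
    (hy : S.IsWeightVector β y) : S.IsWeightVector (α + β) (cxLie x y) := by
  rw [isWeightVector_iff] at hx hy ⊢
  intro ξ
  rw [cxLie_jacobi, hx, hy, map_smul, map_smul, LinearMap.smul_apply, ← add_smul]
  congr 1
  simp only [map_add, LinearMap.add_apply]
  push_cast
  ring

theorem IsWeightVector.smul {α : H} {x : Cx L} (hx : S.IsWeightVector α x) (c : ℂ) :
    S.IsWeightVector α (c • x) := by
  intro ξ
  rw [map_smul, hx ξ, smul_comm]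

theorem IsWeightVector.sub {α : H} {x y : Cx L} (hx : S.IsWeightVector α x)
    (hy : S.IsWeightVector α y) : S.IsWeightVector α (x - y) := by
  intro ξ
  rw [map_sub, hx ξ, hy ξ, smul_sub]

theorem isWeightVector_incl (ξ : H) : S.IsWeightVector 0 ((1 : ℂ) ⊗ₜ[ℝ] S.incl ξ) := by
  rw [isWeightVector_iff]
  intro η
  simp [cxLie_tmul, S.lie_incl]

/-- Weight spaces are orthogonal unless the weights are opposite. -/
theorem IsWeightVector.form_eq_zero {α β : H} {x y : Cx L} (hx : S.IsWeightVector α x)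
    (hy : S.IsWeightVector β y) (h : α + β ≠ 0) : cxForm S.form x y = 0 := by
  rw [isWeightVector_iff] at hx hy
  have h1 := cxForm_cxLie S.form_invariant x ((1 : ℂ) ⊗ₜ[ℝ] S.incl (α + β)) y
  rw [cxLie_skew, hx, hy, map_neg, map_smul, map_smul, LinearMap.neg_apply, LinearMap.smul_apply,
    smul_eq_mul, smul_eq_mul, neg_eq_iff_add_eq_zero, ← add_mul, mul_eq_zero] at h1
  refine h1.resolve_left fun h2 => ?_
  have h3 : ((S.formH (α + β) (α + β) : ℝ) : ℂ) * (2 * Real.pi * Complex.I) = 0 := by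
    rw [← h2]
    simp only [map_add, LinearMap.add_apply]
    push_cast
    ring
  rcases mul_eq_zero.1 h3 with h4 | h4
  · exact (formH_pos h).ne' (by exact_mod_cast h4)
  · simp [Real.pi_ne_zero] at h4

/-- The zero weight space is the complexified abelian subalgebra. -/
theorem exists_of_isWeightVector_zero {x : Cx L} (hx : S.IsWeightVector 0 x) :
    ∃ ξ η : H, x = (1 : ℂ) ⊗ₜ[ℝ] S.incl ξ + Complex.I ⊗ₜ[ℝ] S.incl η := by
  have h0 : ∀ ξ, (LieAlgebra.ad ℝ L (S.incl ξ)).baseChange ℂ x = 0 := fun ξ => by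
    rw [hx ξ]
    simp
  obtain ⟨ξ, hξ⟩ := S.centralizer (cxRe x) fun ξ => by
    have h1 := congrArg cxRe (h0 ξ)
    rwa [cxRe_baseChange, map_zero] at h1
  obtain ⟨η, hη⟩ := S.centralizer (cxIm x) fun ξ => by
    have h1 := congrArg cxIm (h0 ξ)
    rwa [cxIm_baseChange, map_zero] at h1
  exact ⟨ξ, η, by rw [hξ, hη]; exact cx_eq_re_add_im x⟩

theorem form_eq_zero_of_isWeightVector_zero {x z : Cx L} (hx : S.IsWeightVector 0 x)
    (hz : ∀ ξ, cxForm S.form z ((1 : ℂ) ⊗ₜ[ℝ] S.incl ξ) = 0) : cxForm S.form z x = 0 := by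
  obtain ⟨ξ, η, rfl⟩ := exists_of_isWeightVector_zero hx
  have h1 : Complex.I ⊗ₜ[ℝ] S.incl η = Complex.I • ((1 : ℂ) ⊗ₜ[ℝ] S.incl η) := by
    rw [TensorProduct.smul_tmul', smul_eq_mul, mul_one]
  rw [map_add, hz, h1, map_smul, hz, smul_zero, add_zero]

theorem eq_zero_of_isWeightVector_zero {x : Cx L} (hx : S.IsWeightVector 0 x)
    (h : ∀ ξ, cxForm S.form x ((1 : ℂ) ⊗ₜ[ℝ] S.incl ξ) = 0) : x = 0 := by
  have h1 : cxForm S.form x (cxConj x) = 0 :=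
    form_eq_zero_of_isWeightVector_zero (by simpa using hx.conj) h
  refine eq_zero_of_cxForm_cxConj_self S.form_symm S.form_pos ?_
  rw [cxForm_symm _ S.form_symm, h1]
  simp

/-- The bracket of a root vector with its conjugate. -/
theorem cxLie_cxConj {α : H} {e : Cx L} (he : S.IsWeightVector α e)
    (hn : cxForm S.form e (cxConj e) = 1) :
    cxLie e (cxConj e) = (2 * Real.pi * Complex.I) • ((1 : ℂ) ⊗ₜ[ℝ] S.incl α) := by
  rw [← sub_eq_zero]
  have hw : S.IsWeightVector 0 (cxLie e (cxConj e)) := by simpa using he.lie he.conj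
  refine eq_zero_of_isWeightVector_zero (hw.sub ((isWeightVector_incl α).smul _)) fun ξ => ?_
  have hc := isWeightVector_iff.1 he.conj ξ
  rw [map_sub, LinearMap.sub_apply, cxForm_cxLie S.form_invariant, cxLie_skew (cxConj e), hc,
    map_neg, map_smul, hn, map_smul, LinearMap.smul_apply, cxForm_tmul]
  have : S.form (S.incl α) (S.incl ξ) = S.formH α ξ := rfl
  rw [this]
  simp

/-- The root spaces of a compact Lie algebra are one-dimensional. -/
theorem eq_zero_of_form_cxConj_eq_zero {α : H} (hα : α ≠ 0) {e x : Cx L}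
    (he : S.IsWeightVector α e) (hn : cxForm S.form e (cxConj e) = 1)
    (hx : S.IsWeightVector α x) (h : cxForm S.form x (cxConj e) = 0) : x = 0 := by
  -- This bracket has weight zero, and its product with `ξ` is a multiple of `x · ē = 0`.
  have h1 : cxLie (cxConj e) x = 0 := by
    refine eq_zero_of_isWeightVector_zero (by simpa using he.conj.lie hx) fun ξ => ?_
    rw [cxForm_cxLie S.form_invariant, cxLie_skew, isWeightVector_iff.1 hx, map_neg, map_smul,
      cxForm_symm _ S.form_symm, h]
    simp
  have h2 : cxLie (cxConj e) (cxLie e x) =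
      ((4 * Real.pi ^ 2 * S.formH α α : ℝ) : ℂ) • x := by
    rw [cxLie_jacobi, h1, map_zero, add_zero, cxLie_skew (cxConj e), cxLie_cxConj he hn, map_neg,
      map_smul, LinearMap.neg_apply, LinearMap.smul_apply, isWeightVector_iff.1 hx, smul_smul,
      ← neg_smul]
    congr 1
    push_cast
    linear_combination (-4 * (Real.pi : ℂ) ^ 2 * (S.formH α α : ℂ)) * Complex.I_mul_I
  -- By `h2`, the hermitian square of `[e, x]` is `-4π²|α|²` times that of `x`. Nonnegativity of
  -- both squares leaves only `x = 0`.
  have h3 : cxForm S.form (cxConj (cxLie e x)) (cxLie e x) =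
      -((4 * Real.pi ^ 2 * S.formH α α : ℝ) : ℂ) * cxForm S.form (cxConj x) x := by
    rw [cxConj_cxLie, cxLie_skew, map_neg, LinearMap.neg_apply, cxForm_cxLie S.form_invariant, h2,
      map_smul, smul_eq_mul, neg_mul]
  have h4 := cxForm_cxConj_self_nonneg S.form_symm S.form_pos (cxLie e x)
  rw [h3, ← Complex.ofReal_neg, Complex.re_ofReal_mul] at h4
  refine eq_zero_of_cxForm_cxConj_self S.form_symm S.form_pos ?_
  have h5 : 0 < 4 * Real.pi ^ 2 * S.formH α α := by
    have := formH_pos (S := S) hα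
    have := Real.pi_pos
    positivity
  nlinarith

theorem eq_smul_of_isWeightVector {α : H} (hα : α ≠ 0) {e x : Cx L}
    (he : S.IsWeightVector α e) (hn : cxForm S.form e (cxConj e) = 1)
    (hx : S.IsWeightVector α x) : x = cxForm S.form x (cxConj e) • e := by
  rw [← sub_eq_zero]
  refine eq_zero_of_form_cxConj_eq_zero hα he hn (hx.sub (he.smul _)) ?_
  simp [hn]

end ToralPair
theorem sum_cxForm_smul_basis {V ι : Type*} [AddCommGroup V] [Module ℝ V] [Fintype ι]
    [DecidableEq ι] {B : LinearMap.BilinForm ℝ V} (b : Module.Basis ι ℝ V)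
    (hb : ∀ i j, B (b i) (b j) = if i = j then 1 else 0) (z : Cx V) :
    ∑ i, cxForm B ((1 : ℂ) ⊗ₜ[ℝ] b i) z • ((1 : ℂ) ⊗ₜ[ℝ] b i) = z := by
  induction z using TensorProduct.induction_on with
  | zero => simp
  | add x y hx hy =>
    simp only [map_add, add_smul, Finset.sum_add_distrib, hx, hy]
  | tmul a v =>
    have h : ∀ i, B (b i) v = b.repr v i := fun i => by
      have h1 := congrArg (B (b i)) (b.sum_repr v)
      simp only [map_sum, map_smul, hb, smul_eq_mul, mul_ite, mul_one, mul_zero,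
        Finset.sum_ite_eq, Finset.mem_univ, if_true] at h1
      exact h1.symm
    simp only [cxForm_tmul, one_mul, TensorProduct.smul_tmul', smul_eq_mul, mul_one, h]
    conv_rhs => rw [← b.sum_repr v, TensorProduct.tmul_sum]
    refine Finset.sum_congr rfl fun i _ => ?_
    rw [← TensorProduct.smul_tmul]
    congr 1
    rw [Complex.real_smul, mul_comm]

/-! ### The adjoint representation inside the Clifford algebra. -/

section Spin

variable {L ι : Type*} [LieRing L] [LieAlgebra ℝ L] [Fintype ι] [DecidableEq ι]
  (B : LinearMap.BilinForm ℝ L) (b : Module.Basis ι ℝ L)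

/-- The image of `μ` under the map `L → so(L) ⊆ Cl(L)` defined by the adjoint representation. -/
noncomputable def spinElem (μ : L) : Cl B :=
  (-(1 / 2 : ℂ)) • ∑ i, clVec B ((1 : ℂ) ⊗ₜ[ℝ] b i) *
    clVec B (cxLie ((1 : ℂ) ⊗ₜ[ℝ] μ) ((1 : ℂ) ⊗ₜ[ℝ] b i))

variable {B}

theorem clVec_mul_clVec_mul_clVec (hB : ∀ v w, B v w = B w v) (v w z : Cx L) :
    clVec B v * clVec B w * clVec B z = clVec B z * (clVec B v * clVec B w) +
      (cxForm B w z • clVec B v - cxForm B v z • clVec B w) := by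
  rw [mul_assoc, eq_sub_of_add_eq (clVec_mul_add_swap B hB w z), mul_sub, ← mul_assoc (clVec B v),
    eq_sub_of_add_eq (clVec_mul_add_swap B hB v z), sub_mul, mul_assoc, ← Algebra.commutes,
    Algebra.smul_def, Algebra.smul_def]
  abel

/-- Invariance of the form makes the two terms of the commutator sum equal, each giving
`-x_{[μ,z]}`; the prefactor `-½` makes the total exactly `x_{[μ,z]}`. -/
theorem spinElem_mul_clVec (hB : ∀ v w, B v w = B w v)
    (hinv : ∀ ξ η ζ, B ⁅ξ, η⁆ ζ = B ξ ⁅η, ζ⁆)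
    (hb : ∀ i j, B (b i) (b j) = if i = j then 1 else 0) (μ : L) (z : Cx L) :
    spinElem B b μ * clVec B z =
      clVec B z * spinElem B b μ + clVec B (cxLie ((1 : ℂ) ⊗ₜ[ℝ] μ) z) := by
  have h1 : ∀ i, cxForm B (cxLie ((1 : ℂ) ⊗ₜ[ℝ] μ) ((1 : ℂ) ⊗ₜ[ℝ] b i)) z =
      -cxForm B ((1 : ℂ) ⊗ₜ[ℝ] b i) (cxLie ((1 : ℂ) ⊗ₜ[ℝ] μ) z) := fun i => by
    rw [cxLie_skew, map_neg, LinearMap.neg_apply, cxForm_cxLie hinv]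
  have h2 : ∑ i, (cxForm B (cxLie ((1 : ℂ) ⊗ₜ[ℝ] μ) ((1 : ℂ) ⊗ₜ[ℝ] b i)) z •
      clVec B ((1 : ℂ) ⊗ₜ[ℝ] b i) - cxForm B ((1 : ℂ) ⊗ₜ[ℝ] b i) z •
        clVec B (cxLie ((1 : ℂ) ⊗ₜ[ℝ] μ) ((1 : ℂ) ⊗ₜ[ℝ] b i))) =
      -(2 : ℂ) • clVec B (cxLie ((1 : ℂ) ⊗ₜ[ℝ] μ) z) := by
    have h3 := congrArg (clVec B) (sum_cxForm_smul_basis b hb (cxLie ((1 : ℂ) ⊗ₜ[ℝ] μ) z))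
    have h4 := congrArg (fun w => clVec B (cxLie ((1 : ℂ) ⊗ₜ[ℝ] μ) w))
      (sum_cxForm_smul_basis b hb z)
    simp only [map_sum, map_smul] at h3 h4
    simp only [h1, neg_smul, Finset.sum_sub_distrib, Finset.sum_neg_distrib, h3, h4]
    module
  rw [spinElem, smul_mul_assoc, mul_smul_comm, Finset.sum_mul, Finset.mul_sum]
  simp only [clVec_mul_clVec_mul_clVec hB]
  rw [Finset.sum_add_distrib, h2]
  module

end Spin

/-! ### Positive systems and the root space decomposition. -/

namespace ToralPair

variable {L H : Type*} [LieRing L] [LieAlgebra ℝ L] [AddCommGroup H] [Module ℝ H]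

/-- A choice of positive roots, with normalized root vectors. -/
structure PositiveSystem (S : ToralPair L H) where
  reg : H
  reg_ne : ∀ α ∈ S.roots, S.formH α reg ≠ 0
  vec : H → Cx L
  vec_weight : ∀ α ∈ S.roots, 0 < S.formH α reg → S.IsWeightVector α (vec α)
  vec_norm : ∀ α ∈ S.roots, 0 < S.formH α reg → cxForm S.form (vec α) (cxConj (vec α)) = 1

namespace PositiveSystem

variable {S : ToralPair L H} (R : S.PositiveSystem)

/-- The positive roots. -/
def pos : Set H := {α ∈ S.roots | 0 < S.formH α R.reg}

variable {R}

theorem weight {α : H} (h : α ∈ R.pos) : S.IsWeightVector α (R.vec α) := R.vec_weight α h.1 h.2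

theorem norm {α : H} (h : α ∈ R.pos) : cxForm S.form (R.vec α) (cxConj (R.vec α)) = 1 :=
  R.vec_norm α h.1 h.2

theorem add_ne_zero {α β : H} (hα : α ∈ R.pos) (hβ : β ∈ R.pos) : α + β ≠ 0 := by
  intro h
  have h1 := hα.2
  have h2 := hβ.2
  have h3 : S.formH α R.reg + S.formH β R.reg = 0 := by
    rw [← LinearMap.add_apply, ← map_add, h, map_zero, LinearMap.zero_apply]
  linarith

theorem form_vec_vec {α β : H} (hα : α ∈ R.pos) (hβ : β ∈ R.pos) :
    cxForm S.form (R.vec α) (R.vec β) = 0 :=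
  (weight hα).form_eq_zero (weight hβ) (add_ne_zero hα hβ)

theorem form_conj_conj {α β : H} (hα : α ∈ R.pos) (hβ : β ∈ R.pos) :
    cxForm S.form (cxConj (R.vec α)) (cxConj (R.vec β)) = 0 := by
  rw [cxForm_cxConj, form_vec_vec hα hβ, map_zero]

theorem form_vec_conj [DecidableEq H] {α β : H} (hα : α ∈ R.pos) (hβ : β ∈ R.pos) :
    cxForm S.form (R.vec α) (cxConj (R.vec β)) = if α = β then 1 else 0 := by
  split_ifs with h
  · rw [← h, norm hα]
  · exact (weight hα).form_eq_zero (weight hβ).conj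
      (by rwa [← sub_eq_add_neg, sub_ne_zero])

theorem form_incl_vec {α : H} (hα : α ∈ R.pos) (ξ : H) :
    cxForm S.form ((1 : ℂ) ⊗ₜ[ℝ] S.incl ξ) (R.vec α) = 0 :=
  (isWeightVector_incl ξ).form_eq_zero (weight hα) (by rw [zero_add]; exact hα.1.1)

theorem form_incl_conj {α : H} (hα : α ∈ R.pos) (ξ : H) :
    cxForm S.form ((1 : ℂ) ⊗ₜ[ℝ] S.incl ξ) (cxConj (R.vec α)) = 0 :=
  (isWeightVector_incl ξ).form_eq_zero (weight hα).conj
    (by rw [zero_add]; exact neg_ne_zero.2 hα.1.1)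

/-- The conjugate root vectors are dual to the root vectors, which are therefore linearly
independent. -/
theorem finite_pos [FiniteDimensional ℝ L] : R.pos.Finite := by
  classical
  have h : LinearIndependent ℂ fun α : R.pos => R.vec α := by
    rw [linearIndependent_iff']
    intro s c hc α hα
    have h1 := congrArg (fun x => cxForm S.form x (cxConj (R.vec α))) hc
    simp only [map_sum, map_smul, LinearMap.sum_apply, LinearMap.smul_apply, map_zero,
      LinearMap.zero_apply] at h1
    rw [Finset.sum_eq_single α] at h1
    · rwa [norm α.2, smul_eq_mul, mul_one] at h1
    · intro β _ hβ
      rw [form_vec_conj β.2 α.2, if_neg (fun h => hβ (Subtype.ext h)), smul_zero]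
    · exact fun h => absurd hα h
  have := h.finite
  exact Set.toFinite _

variable {κ : Type*} [Fintype κ] [DecidableEq κ]

/-- A vector orthogonal to the abelian subalgebra and to all root vectors vanishes. -/
theorem eq_zero_of_orthogonal [FiniteDimensional ℝ L] (t : Module.Basis κ ℝ H)
    (ht : ∀ k l, S.formH (t k) (t l) = if k = l then 1 else 0) {z : Cx L}
    (h0 : ∀ k, cxForm S.form z ((1 : ℂ) ⊗ₜ[ℝ] S.incl (t k)) = 0)
    (h1 : ∀ α ∈ R.pos, cxForm S.form z (R.vec α) = 0)
    (h2 : ∀ α ∈ R.pos, cxForm S.form z (cxConj (R.vec α)) = 0) : z = 0 := by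
  have hpi : (2 * Real.pi * Complex.I : ℂ) ≠ 0 := by simp [Real.pi_ne_zero]
  have h0' : ∀ ξ, cxForm S.form z ((1 : ℂ) ⊗ₜ[ℝ] S.incl ξ) = 0 := by
    intro ξ
    rw [← t.sum_repr ξ, map_sum, TensorProduct.tmul_sum, map_sum]
    refine Finset.sum_eq_zero fun k _ => ?_
    rw [map_smul, TensorProduct.tmul_smul, LinearMap.map_smul_of_tower, h0, smul_zero]
  -- Division by `2πi` makes the operators `ad(e_k)` hermitian. They commute, and a joint eigenvalue
  -- `χ` is the coordinate vector of a weight `∑ χ_k e_k`.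
  refine eq_zero_of_forall_joint_eigenvector S.form_symm S.form_pos
    (fun k => (2 * Real.pi * Complex.I : ℂ)⁻¹ • cxLie ((1 : ℂ) ⊗ₜ[ℝ] S.incl (t k))) ?_ ?_ z ?_
  · intro k x y
    rw [LinearMap.smul_apply, LinearMap.smul_apply, cxConj_smul, cxConj_cxLie, cxConj_tmul, map_one,
      map_smul, map_smul, LinearMap.smul_apply, cxLie_skew, map_neg, LinearMap.neg_apply,
      cxForm_cxLie S.form_invariant, smul_neg, ← neg_smul]
    congr 1
    rw [map_inv₀, map_mul, map_mul, Complex.conj_I, Complex.conj_ofReal,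
      show (2 : ℂ) = ((2 : ℝ) : ℂ) by norm_num, Complex.conj_ofReal, mul_neg, inv_neg, neg_neg]
  · intro k l
    refine ((?_ : Commute _ _).smul_left _).smul_right _
    refine LinearMap.ext fun x => ?_
    rw [Module.End.mul_apply, Module.End.mul_apply, cxLie_jacobi, cxLie_tmul, S.lie_incl]
    simp
  · intro χ x hx
    have hx' : S.IsWeightVector (∑ k, χ k • t k) x := by
      rw [isWeightVector_iff]
      intro ξ
      have h3 : ∀ k, cxLie ((1 : ℂ) ⊗ₜ[ℝ] S.incl (t k)) x =
          (2 * Real.pi * Complex.I * χ k : ℂ) • x := by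
        intro k
        have h4 := hx k
        rw [LinearMap.smul_apply, inv_smul_eq_iff₀ hpi, smul_smul] at h4
        exact h4
      have h5 : S.formH (∑ k, χ k • t k) ξ = ∑ k, χ k * t.repr ξ k := by
        have h6 : ∀ k, S.formH (t k) ξ = t.repr ξ k := fun k => by
          have h7 := congrArg (S.formH (t k)) (t.sum_repr ξ)
          simp only [map_sum, map_smul, ht, smul_eq_mul, mul_ite, mul_one, mul_zero,
            Finset.sum_ite_eq, Finset.mem_univ, if_true] at h7
          exact h7.symm
        simp only [map_sum, map_smul, LinearMap.sum_apply, LinearMap.smul_apply, h6, smul_eq_mul]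
      rw [h5]
      conv_lhs => rw [← t.sum_repr ξ]
      rw [map_sum, TensorProduct.tmul_sum, map_sum, LinearMap.sum_apply]
      push_cast
      rw [Finset.mul_sum, Finset.sum_smul]
      refine Finset.sum_congr rfl fun k _ => ?_
      rw [map_smul, TensorProduct.tmul_smul, LinearMap.map_smul_of_tower, LinearMap.smul_apply, h3,
        ← algebraMap_smul ℂ (t.repr ξ k), smul_smul, Complex.coe_algebraMap]
      congr 1
      ring
    generalize hα : ∑ k, χ k • t k = α at hx'
    by_cases hx0 : x = 0
    · rw [hx0, map_zero]
    by_cases hα0 : α = 0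
    · rw [hα0] at hx'
      exact form_eq_zero_of_isWeightVector_zero hx' h0'
    have hroot : α ∈ S.roots := ⟨hα0, x, hx0, hx'⟩
    -- Either `-α` or `α` is positive. Since root spaces are lines, `x` is a multiple of a conjugate
    -- root vector or of a root vector, and both are covered by the hypotheses.
    rcases lt_or_gt_of_ne (R.reg_ne α hroot) with hneg | hpos
    · have hm : -α ∈ R.pos := by
        refine ⟨⟨neg_ne_zero.2 hα0, cxConj x, fun h => hx0 ?_, hx'.conj⟩, by simpa using hneg⟩
        rw [← cxConj_cxConj x, h, map_zero]
      have h3 := eq_smul_of_isWeightVector (neg_ne_zero.2 hα0) (weight hm) (norm hm) hx'.conj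
      rw [← cxConj_cxConj x, h3, cxConj_smul, map_smul, h2 _ hm, smul_zero]
    · have hm : α ∈ R.pos := ⟨hroot, hpos⟩
      rw [eq_smul_of_isWeightVector hα0 (weight hm) (norm hm) hx', map_smul, h1 _ hm, smul_zero]

/-- The difference of the two sides is orthogonal to `t` and to all root vectors and their
conjugates. -/
theorem eq_sum_root_vectors [FiniteDimensional ℝ L] (t : Module.Basis κ ℝ H)
    (ht : ∀ k l, S.formH (t k) (t l) = if k = l then 1 else 0) {s : Finset H}
    (hs : ∀ α, α ∈ s ↔ α ∈ R.pos) (z : Cx L) :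
    z = ∑ k, cxForm S.form ((1 : ℂ) ⊗ₜ[ℝ] S.incl (t k)) z • ((1 : ℂ) ⊗ₜ[ℝ] S.incl (t k)) +
      ∑ α ∈ s, (cxForm S.form (cxConj (R.vec α)) z • R.vec α +
        cxForm S.form (R.vec α) z • cxConj (R.vec α)) := by
  classical
  have hsymm := cxForm_symm S.form S.form_symm
  rw [← sub_eq_zero]
  refine eq_zero_of_orthogonal (R := R) t ht (fun l => ?_) (fun β hβ => ?_) fun β hβ => ?_
  · have h1 : ∑ α ∈ s, (cxForm S.form (cxConj (R.vec α)) z • cxForm S.form (R.vec α)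
        ((1 : ℂ) ⊗ₜ[ℝ] S.incl (t l)) + cxForm S.form (R.vec α) z • cxForm S.form
        (cxConj (R.vec α)) ((1 : ℂ) ⊗ₜ[ℝ] S.incl (t l))) = 0 := by
      refine Finset.sum_eq_zero fun α hα => ?_
      rw [hsymm (R.vec α), hsymm (cxConj (R.vec α)) (_ ⊗ₜ _), form_incl_vec ((hs α).1 hα),
        form_incl_conj ((hs α).1 hα), smul_zero, smul_zero, add_zero]
    have h2 : ∀ k, cxForm S.form ((1 : ℂ) ⊗ₜ[ℝ] S.incl (t k)) ((1 : ℂ) ⊗ₜ[ℝ] S.incl (t l)) =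
        if k = l then 1 else 0 := fun k => by
      rw [cxForm_tmul, one_mul, one_mul]
      have := ht k l
      rw [show S.form (S.incl (t k)) (S.incl (t l)) = S.formH (t k) (t l) from rfl, this]
      split_ifs <;> simp
    simp only [map_sub, map_add, map_sum, map_smul, LinearMap.sub_apply, LinearMap.add_apply,
      LinearMap.sum_apply, LinearMap.smul_apply, h2, smul_eq_mul, mul_ite, mul_one, mul_zero,
      Finset.sum_ite_eq', Finset.mem_univ, if_true]
    simp only [smul_eq_mul] at h1
    rw [hsymm z, h1, add_zero, sub_self]
  · have h1 : ∀ k, cxForm S.form ((1 : ℂ) ⊗ₜ[ℝ] S.incl (t k)) (R.vec β) = 0 := fun k =>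
      form_incl_vec hβ _
    have h2 : ∑ α ∈ s, (cxForm S.form (cxConj (R.vec α)) z • cxForm S.form (R.vec α) (R.vec β) +
        cxForm S.form (R.vec α) z • cxForm S.form (cxConj (R.vec α)) (R.vec β)) =
        cxForm S.form (R.vec β) z := by
      rw [Finset.sum_eq_single β]
      · rw [form_vec_vec hβ hβ, hsymm (cxConj _) (R.vec β), norm hβ, smul_zero, zero_add, smul_eq_mul, mul_one]
      · intro α hα hne
        rw [form_vec_vec ((hs α).1 hα) hβ, hsymm (cxConj _) (R.vec β),
          form_vec_conj hβ ((hs α).1 hα), if_neg (Ne.symm hne), smul_zero, smul_zero, add_zero]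
      · exact fun h => absurd ((hs β).2 hβ) h
    simp only [map_sub, map_add, map_sum, map_smul, LinearMap.sub_apply, LinearMap.add_apply,
      LinearMap.sum_apply, LinearMap.smul_apply, h1, h2, smul_zero, Finset.sum_const_zero, zero_add]
    rw [hsymm z, sub_self]
  · have h1 : ∀ k, cxForm S.form ((1 : ℂ) ⊗ₜ[ℝ] S.incl (t k)) (cxConj (R.vec β)) = 0 := fun k =>
      form_incl_conj hβ _
    have h2 : ∑ α ∈ s, (cxForm S.form (cxConj (R.vec α)) z • cxForm S.form (R.vec α)
        (cxConj (R.vec β)) + cxForm S.form (R.vec α) z • cxForm S.form (cxConj (R.vec α))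
        (cxConj (R.vec β))) = cxForm S.form (cxConj (R.vec β)) z := by
      rw [Finset.sum_eq_single β]
      · rw [form_conj_conj hβ hβ, norm hβ, smul_zero, add_zero, smul_eq_mul, mul_one]
      · intro α hα hne
        rw [form_conj_conj ((hs α).1 hα) hβ, form_vec_conj ((hs α).1 hα) hβ, if_neg hne, smul_zero,
          smul_zero, add_zero]
      · exact fun h => absurd ((hs β).2 hβ) h
    simp only [map_sub, map_add, map_sum, map_smul, LinearMap.sub_apply, LinearMap.add_apply,
      LinearMap.sum_apply, LinearMap.smul_apply, h1, h2, smul_zero, Finset.sum_const_zero, zero_add]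
    rw [hsymm z, sub_self]

/-- The canonical element of `L ⊗ L`, in terms of root vectors. -/
theorem sum_basis_eq_sum_root_vectors [FiniteDimensional ℝ L] {ι M : Type*} [Fintype ι]
    [DecidableEq ι] [AddCommGroup M] [Module ℂ M] (b : Module.Basis ι ℝ L)
    (hb : ∀ i j, S.form (b i) (b j) = if i = j then 1 else 0) (t : Module.Basis κ ℝ H)
    (ht : ∀ k l, S.formH (t k) (t l) = if k = l then 1 else 0) {s : Finset H}
    (hs : ∀ α, α ∈ s ↔ α ∈ R.pos) (Φ : Cx L →ₗ[ℂ] Cx L →ₗ[ℂ] M) :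
    ∑ i, Φ ((1 : ℂ) ⊗ₜ[ℝ] b i) ((1 : ℂ) ⊗ₜ[ℝ] b i) =
      ∑ k, Φ ((1 : ℂ) ⊗ₜ[ℝ] S.incl (t k)) ((1 : ℂ) ⊗ₜ[ℝ] S.incl (t k)) +
        ∑ α ∈ s, (Φ (R.vec α) (cxConj (R.vec α)) + Φ (cxConj (R.vec α)) (R.vec α)) := by
  have h1 : ∀ w y : Cx L, ∑ i, cxForm S.form w ((1 : ℂ) ⊗ₜ[ℝ] b i) • Φ ((1 : ℂ) ⊗ₜ[ℝ] b i) y =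
      Φ w y := by
    intro w y
    have h2 := congrArg (fun x => Φ x y) (sum_cxForm_smul_basis b hb w)
    simp only [map_sum, map_smul, LinearMap.sum_apply, LinearMap.smul_apply] at h2
    rw [← h2]
    exact Finset.sum_congr rfl fun i _ => by rw [cxForm_symm _ S.form_symm]
  have h3 : ∀ i, Φ ((1 : ℂ) ⊗ₜ[ℝ] b i) ((1 : ℂ) ⊗ₜ[ℝ] b i) =
      ∑ k, cxForm S.form ((1 : ℂ) ⊗ₜ[ℝ] S.incl (t k)) ((1 : ℂ) ⊗ₜ[ℝ] b i) •
        Φ ((1 : ℂ) ⊗ₜ[ℝ] b i) ((1 : ℂ) ⊗ₜ[ℝ] S.incl (t k)) +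
      ∑ α ∈ s, (cxForm S.form (cxConj (R.vec α)) ((1 : ℂ) ⊗ₜ[ℝ] b i) •
          Φ ((1 : ℂ) ⊗ₜ[ℝ] b i) (R.vec α) +
        cxForm S.form (R.vec α) ((1 : ℂ) ⊗ₜ[ℝ] b i) •
          Φ ((1 : ℂ) ⊗ₜ[ℝ] b i) (cxConj (R.vec α))) := by
    intro i
    have h4 := congrArg (Φ ((1 : ℂ) ⊗ₜ[ℝ] b i)) (eq_sum_root_vectors t ht hs ((1 : ℂ) ⊗ₜ[ℝ] b i))
    simpa only [map_add, map_sum, map_smul] using h4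
  rw [Finset.sum_congr rfl fun i _ => h3 i, Finset.sum_add_distrib, Finset.sum_comm,
    Finset.sum_comm (t := s)]
  simp only [Finset.sum_add_distrib, h1]
  congr 1
  rw [add_comm]

end PositiveSystem
end ToralPair
end GroupLocalization

namespace GroupLocalization
-- The twisted restriction from the Clifford algebra of `g` to that of `t`.
namespace ToralPair
namespace PositiveSystem

variable {L H : Type*} [LieRing L] [LieAlgebra ℝ L] [AddCommGroup H] [Module ℝ H]
  {S : ToralPair L H} {R : S.PositiveSystem} [FiniteDimensional ℝ L]
  {κ : Type*} [Fintype κ] [DecidableEq κ] (t : Module.Basis κ ℝ H)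

variable (S) in
/-- The orthogonal projection onto the abelian subalgebra. -/
noncomputable def proj : L →ₗ[ℝ] H := ∑ k, (S.form (S.incl (t k))).smulRight (t k)

theorem baseChange_proj (z : Cx L) : (proj S t).baseChange ℂ z =
    ∑ k, cxForm S.form ((1 : ℂ) ⊗ₜ[ℝ] S.incl (t k)) z • ((1 : ℂ) ⊗ₜ[ℝ] t k) := by
  induction z using TensorProduct.induction_on with
  | zero => simp
  | add x y hx hy => simp only [map_add, add_smul, Finset.sum_add_distrib, hx, hy]
  | tmul a v =>
    rw [LinearMap.baseChange_tmul, proj, LinearMap.sum_apply, TensorProduct.tmul_sum]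
    refine Finset.sum_congr rfl fun k _ => ?_
    rw [LinearMap.smulRight_apply, cxForm_tmul, one_mul, TensorProduct.smul_tmul',
      ← TensorProduct.smul_tmul, smul_eq_mul, mul_one, Complex.real_smul, mul_comm]

theorem baseChange_proj_vec {α : H} (hα : α ∈ R.pos) :
    (proj S t).baseChange ℂ (R.vec α) = 0 := by
  rw [baseChange_proj]
  exact Finset.sum_eq_zero fun k _ => by rw [form_incl_vec hα, zero_smul]

theorem baseChange_proj_conj {α : H} (hα : α ∈ R.pos) :
    (proj S t).baseChange ℂ (cxConj (R.vec α)) = 0 := by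
  rw [baseChange_proj]
  exact Finset.sum_eq_zero fun k _ => by rw [form_incl_conj hα, zero_smul]

variable {t} (ht : ∀ k l, S.formH (t k) (t l) = if k = l then 1 else 0)
include ht

theorem proj_incl (ξ : H) : proj S t (S.incl ξ) = ξ := by
  have h : proj S t ∘ₗ S.incl = LinearMap.id := by
    refine t.ext fun l => ?_
    have h1 : ∀ k, S.form (S.incl (t k)) (S.incl (t l)) = if k = l then 1 else 0 := fun k => ht k l
    simp [proj, h1]
  exact LinearMap.congr_fun h ξ

theorem formH_proj (ξ : H) (v : L) : S.formH ξ (proj S t v) = S.form (S.incl ξ) v := by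
  have h1 : ξ = ∑ k, S.formH (t k) ξ • t k := by
    have h2 : ∀ k, S.formH (t k) ξ = t.repr ξ k := fun k => by
      have h7 := congrArg (S.formH (t k)) (t.sum_repr ξ)
      simp only [map_sum, map_smul, ht, smul_eq_mul, mul_ite, mul_one, mul_zero,
        Finset.sum_ite_eq, Finset.mem_univ, if_true] at h7
      exact h7.symm
    simp only [h2, t.sum_repr]
  conv_rhs => rw [h1]
  simp only [proj, LinearMap.sum_apply, LinearMap.smulRight_apply, map_sum, map_smul, smul_eq_mul,
    LinearMap.smul_apply]
  exact Finset.sum_congr rfl fun k _ => by rw [formH_symm, mul_comm]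

theorem cxForm_incl_eq (ξ : H) : cxForm S.form ((1 : ℂ) ⊗ₜ[ℝ] S.incl ξ) =
    cxForm S.formH ((1 : ℂ) ⊗ₜ[ℝ] ξ) ∘ₗ (proj S t).baseChange ℂ := by
  refine LinearMap.ext fun z => ?_
  induction z using TensorProduct.induction_on with
  | zero => simp
  | add x y hx hy => rw [map_add, map_add, hx, hy]
  | tmul a v =>
    rw [LinearMap.comp_apply, LinearMap.baseChange_tmul, cxForm_tmul, cxForm_tmul, formH_proj ht]

variable (R) (t) in
omit ht in
/-- The restriction of the Clifford algebra to the abelian subalgebra, twisted by the classical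
`r`-matrix. -/
noncomputable def restr (s : Finset H) : Cl S.form →ₗ[ℂ] Cl S.formH :=
  clNormal S.form S.formH (proj S t) s R.vec (cxConj ∘ R.vec)

omit ht in
theorem restr_involute (s : Finset H) (y : Cl S.form) :
    restr R t s (CliffordAlgebra.involute y) = CliffordAlgebra.involute (restr R t s y) :=
  clNormal_involute _ _ _ _ _ _ S.form_symm formH_symm y

variable {s : Finset H} (hs : ∀ α, α ∈ s ↔ α ∈ R.pos)
include hs

theorem restr_clVec_incl_mul (ξ : H) (y : Cl S.form) :
    restr R t s (clVec S.form ((1 : ℂ) ⊗ₜ[ℝ] S.incl ξ) * y) =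
      clVec S.formH ((1 : ℂ) ⊗ₜ[ℝ] ξ) * restr R t s y := by
  refine clNormal_clVec_mul _ _ _ _ _ _ S.form_symm formH_symm
    (fun α hα => baseChange_proj_vec t ((hs α).1 hα))
    (fun α hα => baseChange_proj_conj t ((hs α).1 hα)) _ _ ?_ (cxForm_incl_eq ht ξ) y
  rw [LinearMap.baseChange_tmul, proj_incl ht]

-- The pairs `(e_α, e_{-α})` satisfy the duality relations of `clNormal_clVec_mul_eq_zero`. This is
-- the annihilated right ideal that makes `t^ρ` appear.
omit ht in
theorem restr_clVec_conj_mul {α : H} (hα : α ∈ s) (y : Cl S.form) :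
    restr R t s (clVec S.form (cxConj (R.vec α)) * y) = 0 := by
  classical
  exact clNormal_clVec_mul_eq_zero S.form S.formH (proj S t) s R.vec (cxConj ∘ R.vec) S.form_symm
    (fun α hα => baseChange_proj_conj t ((hs α).1 hα))
    (fun α hα β hβ => form_conj_conj ((hs α).1 hα) ((hs β).1 hβ))
    (fun α hα β hβ => form_vec_conj ((hs α).1 hα) ((hs β).1 hβ)) hα y

variable {ι : Type*} [Fintype ι] [DecidableEq ι] (b : Module.Basis ι ℝ L)
  (hb : ∀ i j, S.form (b i) (b j) = if i = j then 1 else 0)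
include hb

/-- In root vectors the contribution of `α` is `πi⟨α, ξ⟩(x_α x_{-α} - x_{-α} x_α)`. Replacing `x_α
x_{-α}` by `1 - x_{-α} x_α` puts the negative root vectors on the left, and the constants add up to
`2πi⟨ρ, ξ⟩`. -/
theorem spinElem_incl (ξ : H) : spinElem S.form b (S.incl ξ) =
    algebraMap ℂ (Cl S.form)
      (2 * Real.pi * Complex.I * (S.formH ((1 / 2 : ℝ) • ∑ α ∈ s, α) ξ : ℂ)) +
    -∑ α ∈ s, (2 * Real.pi * Complex.I * (S.formH α ξ : ℂ)) •
      (clVec S.form (cxConj (R.vec α)) * clVec S.form (R.vec α)) := by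
  let Φ : Cx L →ₗ[ℂ] Cx L →ₗ[ℂ] Cl S.form := (LinearMap.mul ℂ (Cl S.form)).compl₁₂
    (clVec S.form) (clVec S.form ∘ₗ cxLie ((1 : ℂ) ⊗ₜ[ℝ] S.incl ξ))
  have hΦ : ∀ x y, Φ x y = clVec S.form x * clVec S.form (cxLie ((1 : ℂ) ⊗ₜ[ℝ] S.incl ξ) y) :=
    fun _ _ => rfl
  have h1 := sum_basis_eq_sum_root_vectors (R := R) b hb t ht hs Φ
  simp only [hΦ] at h1
  have h2 : ∑ k, clVec S.form ((1 : ℂ) ⊗ₜ[ℝ] S.incl (t k)) * clVec S.form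
      (cxLie ((1 : ℂ) ⊗ₜ[ℝ] S.incl ξ) ((1 : ℂ) ⊗ₜ[ℝ] S.incl (t k))) = 0 := by
    refine Finset.sum_eq_zero fun k _ => ?_
    rw [cxLie_tmul, S.lie_incl, TensorProduct.tmul_zero, map_zero, mul_zero]
  rw [spinElem, h1, h2, zero_add, Finset.smul_sum]
  have h3 : ∀ α ∈ s, (-(1 / 2 : ℂ)) • (clVec S.form (R.vec α) *
        clVec S.form (cxLie ((1 : ℂ) ⊗ₜ[ℝ] S.incl ξ) (cxConj (R.vec α))) +
      clVec S.form (cxConj (R.vec α)) *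
        clVec S.form (cxLie ((1 : ℂ) ⊗ₜ[ℝ] S.incl ξ) (R.vec α))) =
      algebraMap ℂ (Cl S.form) (2 * Real.pi * Complex.I * (1 / 2 * (S.formH α ξ : ℂ))) +
      -((2 * Real.pi * Complex.I * (S.formH α ξ : ℂ)) •
        (clVec S.form (cxConj (R.vec α)) * clVec S.form (R.vec α))) := by
    intro α hα
    have hα' := (hs α).1 hα
    have h4 := clVec_mul_add_swap S.form S.form_symm (R.vec α) (cxConj (R.vec α))
    rw [norm hα', map_one] at h4
    rw [isWeightVector_iff.1 (weight hα').conj, isWeightVector_iff.1 (weight hα'), map_neg,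
      LinearMap.neg_apply, map_smul, map_smul, mul_smul_comm, mul_smul_comm, eq_sub_of_add_eq h4,
      Algebra.algebraMap_eq_smul_one]
    push_cast
    module
  rw [Finset.sum_congr rfl h3, Finset.sum_add_distrib, Finset.sum_neg_distrib, ← map_sum]
  congr 2
  rw [← Finset.mul_sum, ← Finset.mul_sum]
  congr 1
  rw [map_smul, map_sum, LinearMap.smul_apply, LinearMap.sum_apply]
  simp

/-- The scalar part commutes with the rest and factors out. The rest lies in the annihilated right
ideal, so its exponential restricts to `1`. -/
theorem restr_algExp_spinElem_incl (ξ : H) : restr R t s (algExp (spinElem S.form b (S.incl ξ))) =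
    algebraMap ℂ (Cl S.formH)
      (Complex.exp (2 * Real.pi * Complex.I * (S.formH ((1 / 2 : ℝ) • ∑ α ∈ s, α) ξ : ℂ))) := by
  have : FiniteDimensional ℝ H := Module.Finite.of_basis t
  rw [spinElem_incl ht hs b hb, algExp_add_of_commute (Algebra.commutes _ _), algExp_algebraMap,
    ← Algebra.smul_def, map_smul, map_algExp_eq_one, restr, clNormal_one,
    ← Algebra.algebraMap_eq_smul_one]
  intro x
  rw [neg_mul, map_neg, Finset.sum_mul, map_sum, neg_eq_zero]
  refine Finset.sum_eq_zero fun α hα => ?_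
  rw [smul_mul_assoc, map_smul, mul_assoc (clVec S.form _), restr_clVec_conj_mul hs hα, smul_zero]

end PositiveSystem
end ToralPair

/-! ### Specialization to the Lie algebras of `G` and its maximal torus. -/

section RootData

variable {F T : Type*} [NormedAddCommGroup F] [NormedSpace ℝ F] [FiniteDimensional ℝ F]
  [TopologicalSpace T] [ChartedSpace F T] [CommGroup T] [LieGroup 𝓘(ℝ, F) ∞ T] [T2Space T]
  [CompactSpace T] [ConnectedSpace T]
  {E G : Type*} [NormedAddCommGroup E] [NormedSpace ℝ E]
  [FiniteDimensional ℝ E] [TopologicalSpace G] [ChartedSpace E G] [Group G] [LieGroup 𝓘(ℝ, E) ∞ G]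
  [T2Space G]

instance : FiniteDimensional ℝ (LieAlg E G) := inferInstanceAs (FiniteDimensional ℝ E)

/-- The Lie algebra of a maximal torus, as an abelian subalgebra that is its own centralizer. -/
noncomputable def TorusData.toralPair (S : TorusData E F G T) :
    ToralPair (LieAlg E G) (LieAlg F T) where
  form := S.form
  form_symm := S.form_symm
  form_pos := S.form_pos
  form_invariant := S.form_invariant
  incl := lieMap S.incl
  incl_injective := S.lieMap_injective
  lie_incl := S.lie_lieMap
  centralizer _ h := S.mem_range_lieMap_of_lie_eq_zero h

namespace RootData

variable (S : RootData E F G T)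

/-- The positive root vectors of `RootData`. -/
noncomputable def positiveSystem : S.toralPair.PositiveSystem where
  reg := S.reg
  reg_ne := S.reg_regular
  vec := S.rootVec
  vec_weight := S.rootVec_isRootVector
  vec_norm := S.rootVec_normalized

theorem finite_posRoots : S.posRoots.Finite :=
  ToralPair.PositiveSystem.finite_pos (R := S.positiveSystem)

theorem mem_toFinset_posRoots (α : LieAlg F T) :
    α ∈ S.finite_posRoots.toFinset ↔ α ∈ S.positiveSystem.pos :=
  S.finite_posRoots.mem_toFinset

theorem rho_eq : S.rho = (1 / 2 : ℝ) • ∑ α ∈ S.finite_posRoots.toFinset, α := by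
  rw [rho, finsum_mem_eq_finite_toFinset_sum]

/-- Connects the twist by the classical `r`-matrix with the sum over pairs `(e_α, e_{-α})`, using
that there are finitely many positive roots. -/
theorem clRestr_eq : S.clRestr =
    ToralPair.PositiveSystem.restr S.positiveSystem S.basisT S.finite_posRoots.toFinset := by
  have h : S.twist = algExp ((1 / 2 : ℂ) • ∑ α ∈ S.finite_posRoots.toFinset,
      clContr S.form (S.rootVec α) * clContr S.form ((cxConj ∘ S.rootVec) α)) := by
    rw [twist, rMatrix, finsum_mem_eq_finite_toFinset_sum _ S.finite_posRoots]
    exact congrArg algExp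
      (half_clContr₂_sum S.form S.finite_posRoots.toFinset S.rootVec (cxConj ∘ S.rootVec))
  rw [clRestr, h]
  rfl

theorem spinLie_eq (μ : LieAlg E G) : S.spinLie μ = spinElem S.form S.basisG μ := by
  have h1 : ∀ v : LieAlg E G, ∑ c, S.form v (S.basisG c) • S.basisG c = v := fun v => by
    have h2 : ∀ c, S.form v (S.basisG c) = S.basisG.repr v c := fun c => by
      have h7 := congrArg (S.form (S.basisG c)) (S.basisG.sum_repr v)
      simp only [map_sum, map_smul, S.basisG_orthonormal, smul_eq_mul, mul_ite, mul_one, mul_zero,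
        Finset.sum_ite_eq, Finset.mem_univ, if_true] at h7
      rw [S.form_symm, h7]
    simp only [h2, S.basisG.sum_repr]
  rw [spinLie, spinElem, Finset.sum_comm]
  congr 1
  refine Finset.sum_congr rfl fun b _ => ?_
  have h3 : ∀ c, ∑ a, S.structConst a b c * S.form μ (S.basisG a) =
      S.form ⁅μ, S.basisG b⁆ (S.basisG c) := fun c => by
    have h4 := congrArg (fun v => S.form ⁅v, S.basisG b⁆ (S.basisG c)) (h1 μ)
    simp only [sum_lie, smul_lie, map_sum, map_smul, LinearMap.sum_apply, LinearMap.smul_apply,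
      smul_eq_mul] at h4
    rw [← h4]
    exact Finset.sum_congr rfl fun a _ => mul_comm _ _
  rw [Finset.sum_comm, cxLie_tmul, one_mul, ← h1 ⁅μ, S.basisG b⁆, TensorProduct.tmul_sum, map_sum,
    Finset.mul_sum]
  refine Finset.sum_congr rfl fun c _ => ?_
  rw [← Finset.sum_smul, ← Complex.ofReal_sum, h3, TensorProduct.tmul_smul,
    ← algebraMap_smul ℂ (S.form ⁅μ, S.basisG b⁆ (S.basisG c)), map_smul, mul_smul_comm]
  rfl

theorem clRestr_algExp_spinLie (ξ : LieAlg F T) :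
    S.clRestr (algExp (S.spinLie (lieMap S.incl ξ))) = algebraMap ℂ (Cl S.formT)
      (Complex.exp (2 * Real.pi * Complex.I * (S.formT S.rho ξ : ℂ))) := by
  rw [clRestr_eq, spinLie_eq, rho_eq]
  exact ToralPair.PositiveSystem.restr_algExp_spinElem_incl (S := S.toralPair)
    S.basisT_orthonormal S.mem_toFinset_posRoots S.basisG S.basisG_orthonormal ξ

theorem clRestr_clGen_lieMap_mul (ξ : LieAlg F T) (y : Cl S.form) :
    S.clRestr (clGen S.form (lieMap S.incl ξ : LieAlg E G) * y) =
      clGen S.formT ξ * S.clRestr y := by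
  rw [clRestr_eq]
  exact ToralPair.PositiveSystem.restr_clVec_incl_mul (S := S.toralPair) S.basisT_orthonormal
    S.mem_toFinset_posRoots ξ y

theorem clRestr_involute (y : Cl S.form) :
    S.clRestr (CliffordAlgebra.involute y) = CliffordAlgebra.involute (S.clRestr y) := by
  rw [clRestr_eq]
  exact ToralPair.PositiveSystem.restr_involute (S := S.toralPair) _ y

end RootData
end RootData
-- Lifting homomorphisms through coverings.
section Lifting

/-- A homomorphism from a simply connected group lifts through a covering homomorphism. -/
theorem exists_monoidHom_lift {X G K : Type*} [Group X] [TopologicalSpace X] [IsTopologicalGroup X]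
    [Group G] [TopologicalSpace G] [IsTopologicalGroup G] {p : X →* G} (hp : Continuous p)
    (hsurj : Function.Surjective p) (hopen : IsOpenMap p) (hdisc : IsDiscrete (p.ker : Set X))
    [Group K] [TopologicalSpace K] [ContinuousMul K] [SimplyConnectedSpace K]
    [LocallyPathConnectedSpace K] {f : K →* G} (hf : Continuous f) :
    ∃ F : K →* X, Continuous F ∧ ∀ k, p (F k) = f k := by
  have hcov : IsCoveringMap p :=
    ((hopen.isQuotientMap hp hsurj).isQuotientCoveringMap_of_isDiscrete_ker_monoidHom
      hdisc).isCoveringMap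
  obtain ⟨F, ⟨hF1, hFp⟩, -⟩ := hcov.existsUnique_continuousMap_lifts ⟨f, hf⟩ 1 1 (by simp)
  have hFp' : ∀ k, p (F k) = f k := fun k => congrFun hFp k
  -- The defect of multiplicativity is a continuous map from the connected space `K × K` to the
  -- discrete kernel, with value `1` at `(1, 1)`.
  have hmul : ∀ k k' : K, F (k * k') = F k * F k' := by
    have h1 : Continuous fun x : K × K => (F (x.1 * x.2))⁻¹ * (F x.1 * F x.2) := by
      fun_prop
    have h2 : Set.MapsTo (fun x : K × K => (F (x.1 * x.2))⁻¹ * (F x.1 * F x.2)) Set.univ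
        (p.ker : Set X) := fun x _ => by
      rw [SetLike.mem_coe, MonoidHom.mem_ker]
      simp [hFp']
    intro k k'
    have h3 := isPreconnected_univ.constant_of_mapsTo hdisc h1.continuousOn h2
      (Set.mem_univ (k, k')) (Set.mem_univ (1, 1))
    simp only [hF1, mul_one, inv_one] at h3
    exact inv_mul_eq_one.1 h3
  exact ⟨MonoidHom.mk' F hmul, F.continuous, hFp'⟩

end Lifting

/-! ### Conjugation by an exponential as the solution of a differential equation. -/

section Intertwining

/-- If `y' = [D, y]`, then `exp D` intertwines `y 0` and `y 1`. -/
theorem exp_mul_of_hasDerivAt {A : Type*} [NormedRing A] [NormedAlgebra ℂ A] [CompleteSpace A]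
    {D : A} {y : ℝ → A} (h : ∀ s, HasDerivAt y (D * y s - y s * D) s) :
    NormedSpace.exp D * y 0 = y 1 * NormedSpace.exp D := by
  let _ : NormedAlgebra ℝ A := NormedAlgebra.restrictScalars ℝ ℂ A
  let _ : NormedAlgebra ℚ A := NormedAlgebra.restrictScalars ℚ ℂ A
  -- Undoing the flow `e^{sD} (·) e^{-sD}` of the equation leaves a constant.
  have h1 : ∀ s : ℝ, HasDerivAt (fun s : ℝ => NormedSpace.exp (s • -D) * y s * NormedSpace.exp (s • D))
      0 s := by
    intro s
    have h2 := (((hasDerivAt_exp_smul_const (𝕂 := ℝ) (-D) s).mul (h s)).mul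
      (hasDerivAt_exp_smul_const' (𝕂 := ℝ) D s))
    refine h2.congr_deriv ?_
    change (NormedSpace.exp (s • -D) * -D * y s + NormedSpace.exp (s • -D) *
      (D * y s - y s * D)) * NormedSpace.exp (s • D) +
      (NormedSpace.exp (s • -D) * y s) * (D * NormedSpace.exp (s • D)) = 0
    noncomm_ring
  have h3 := is_const_of_deriv_eq_zero (fun s => (h1 s).differentiableAt) (fun s => (h1 s).deriv) 0 1
  simp only [zero_smul, NormedSpace.exp_zero, one_mul, mul_one, one_smul] at h3
  have h4 : NormedSpace.exp D * NormedSpace.exp (-D) = 1 := by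
    rw [← NormedSpace.exp_add_of_commute (Commute.neg_right (Commute.refl D)), add_neg_cancel,
      NormedSpace.exp_zero]
  rw [h3, ← mul_assoc, ← mul_assoc, h4, one_mul]

end Intertwining

/-! ### The covering group of the adjoint action. -/

section SpinCover

variable {E : Type*} [NormedAddCommGroup E] [NormedSpace ℝ E] [FiniteDimensional ℝ E]
  {G : Type*} [TopologicalSpace G] [ChartedSpace E G] [Group G] [LieGroup 𝓘(ℝ, E) ∞ G] [T2Space G]

/-- The group of pairs `(g, u)` such that conjugation by `u` covers the adjoint action of `g`. -/
def adjointCover {A : Type*} [Ring A] (c : LieAlg E G →+ A) (M : Subgroup Aˣ) :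
    Subgroup (G × Aˣ) where
  carrier := {x | x.2 ∈ M ∧ ∀ v, (x.2 : A) * c v = c (lieAd x.1 v) * x.2}
  one_mem' := ⟨M.one_mem, fun v => by
    rw [Prod.fst_one, Prod.snd_one, lieAd_one, Units.val_one, one_mul, mul_one]⟩
  mul_mem' := by
    rintro x y ⟨hx, hx'⟩ ⟨hy, hy'⟩
    refine ⟨M.mul_mem hx hy, fun v => ?_⟩
    rw [Prod.fst_mul, Prod.snd_mul, lieAd_mul, Units.val_mul, mul_assoc, hy', ← mul_assoc, hx',
      mul_assoc]
  inv_mem' := by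
    rintro x ⟨hx, hx'⟩
    refine ⟨M.inv_mem hx, fun v => ?_⟩
    have h := hx' (lieAd x.1⁻¹ v)
    rw [← lieAd_mul, mul_inv_cancel, lieAd_one] at h
    rw [Prod.fst_inv, Prod.snd_inv, Units.inv_mul_eq_iff_eq_mul, ← mul_assoc, h, mul_assoc,
      Units.mul_inv, mul_one]

/-- The curve `c(Ad(exp sμ) v)` satisfies `y' = [D, y]`, hence `e^D` conjugates its value at `0` to
its value at `1`. -/
theorem algExp_mul_eq_lieAd_mul {A : Type*} [NormedRing A] [NormedAlgebra ℂ A]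
    [FiniteDimensional ℂ A] {c : LieAlg E G →+ A} (hc : ∀ (r : ℝ) v, c (r • v) = (r : ℂ) • c v)
    {D : A} {μ : LieAlg E G} (hD : ∀ v, c ⁅μ, v⁆ = D * c v - c v * D) (v : LieAlg E G) :
    algExp D * c v = c (lieAd (lieExp μ : G) v) * algExp D := by
  have : CompleteSpace A := FiniteDimensional.complete ℂ A
  let cl : E →ₗ[ℝ] A :=
    { toFun := fun v => c v
      map_add' := fun v w => c.map_add v w
      map_smul' := fun r v => (hc r v).trans (Complex.coe_smul _ _) }
  have h : ∀ s : ℝ, HasDerivAt (fun s => cl (lieAdE E (lieExp (s • μ) : G) v))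
      (D * cl (lieAdE E (lieExp (s • μ) : G) v) - cl (lieAdE E (lieExp (s • μ) : G) v) * D) s := by
    intro s
    -- Splitting off the small time on the left gives the derivative as `[μ, Ad(exp sμ) v]`, the
    -- form to which `hD` applies.
    have h0 := hasDerivAt_lieAdE_zero (G := G) μ (lieAd (lieExp (s • μ) : G) v)
    have h1 := h0.scomp_of_eq s ((hasDerivAt_id s).sub_const s) (by simp)
    have h2 := cl.toContinuousLinearMap.hasFDerivAt.comp_hasDerivAt s h1
    have h3 : (fun s' : ℝ => cl (lieAdE E (lieExp (s' • μ) : G) v)) = cl.toContinuousLinearMap ∘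
        ((fun r => lieAdE E (lieExp (r • μ) : G) (lieAd (lieExp (s • μ) : G) v)) ∘
          fun s' => id s' - s) := by
      funext s'
      refine congrArg cl ?_
      refine Eq.trans ?_ (lieAd_mul (E := E) (lieExp ((s' - s) • μ) : G) (lieExp (s • μ) : G) v)
      rw [← lieExp_add_smul, sub_add_cancel]
      rfl
    rw [h3]
    rw [one_smul] at h2
    exact h2.congr_deriv (hD (lieAd (lieExp (s • μ) : G) v))
  have h5 := exp_mul_of_hasDerivAt h
  rw [zero_smul, one_smul, lieExp_zero, ← algExp_eq_exp] at h5
  refine Eq.trans ?_ h5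
  congr 1
  exact congrArg c (lieAd_one v).symm

end SpinCover
-- Integration of the spin representation to the group.
section SpinLift

variable {E : Type*} [NormedAddCommGroup E] [NormedSpace ℝ E] [FiniteDimensional ℝ E]

theorem continuous_of_continuous_val {A Y : Type*} [NormedRing A] [CompleteSpace A]
    [TopologicalSpace Y] {f : Y → Aˣ} (h : Continuous fun y => (f y : A)) : Continuous f :=
  Units.isOpenEmbedding_val.isEmbedding.continuous_iff.2 h

section

variable {G : Type*} [TopologicalSpace G] [ChartedSpace E G] [Group G] [LieGroup 𝓘(ℝ, E) ∞ G]
  [T2Space G] {A : Type*} [NormedRing A] [NormedAlgebra ℂ A] [FiniteDimensional ℂ A]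

/-- Every exponential has a lift `e μ`, so products of exponentials lift continuously near the unit.
This makes the projection open at `1`; its image is then an open subgroup of a connected group. -/
theorem isOpenMap_adjointCover [ConnectedSpace G] {c : LieAlg E G →+ A} {M : Subgroup Aˣ}
    {e : LieAlg E G → adjointCover c M} (he : ∀ μ, (e μ).1.1 = lieExp μ)
    (hcont : ∀ μ, Continuous fun s : ℝ => e (s • μ)) (he0 : e 0 = 1) :
    IsOpenMap ((MonoidHom.fst G Aˣ).comp (adjointCover c M).subtype) ∧
      Function.Surjective ((MonoidHom.fst G Aˣ).comp (adjointCover c M).subtype) := by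
  have : IsTopologicalGroup G := topologicalGroup_of_lieGroup 𝓘(ℝ, E) ∞
  have : CompleteSpace A := FiniteDimensional.complete ℂ A
  set p := (MonoidHom.fst G Aˣ).comp (adjointCover c M).subtype with hp
  let b : Module.Basis (Fin (Module.finrank ℝ E)) ℝ (LieAlg E G) := Module.finBasis ℝ E
  let σ : (Fin (Module.finrank ℝ E) → ℝ) → adjointCover c M := fun t =>
    (Finset.univ.toList.map fun i => e (t i • b i)).prod
  have hσ : Continuous σ := by
    refine continuous_list_prod _ fun i _ => ?_
    exact (hcont (b i)).comp (continuous_apply i)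
  have hσ0 : σ 0 = 1 := by
    refine List.prod_eq_one fun x hx => ?_
    obtain ⟨i, -, rfl⟩ := List.mem_map.1 hx
    rw [Pi.zero_apply, zero_smul, he0]
  have hpσ : ∀ t, p (σ t) = expProd b Finset.univ.toList t := by
    intro t
    rw [map_list_prod, List.map_map]
    refine congrArg List.prod (List.map_congr_left fun i _ => ?_)
    exact he _
  have hnhds : 𝓝 1 ≤ Filter.map p (𝓝 1) := by
    intro U hU
    have h1 : (p ∘ σ) ⁻¹' U ∈ 𝓝 0 := by
      have := hσ.continuousAt (x := 0)
      rw [ContinuousAt, hσ0] at this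
      exact this hU
    filter_upwards [eventually_exists_expProd b h1] with g hg
    obtain ⟨t, ht, rfl⟩ := hg
    rw [← hpσ]
    exact ht
  refine ⟨IsTopologicalGroup.isOpenMap_iff_nhds_one.2 hnhds, ?_⟩
  rw [← MonoidHom.range_eq_top]
  exact eq_top_of_nhds_one_mem E (hnhds (by
    rw [Filter.mem_map]
    exact Filter.univ_mem' fun x => ⟨x, rfl⟩))

end

/-- The integration of a homomorphism from the Lie algebra of the product of a simply connected
group and a torus to a finite-dimensional algebra that covers the adjoint representation. -/
theorem exists_monoidHom_algExp {G : Type*} [TopologicalSpace G] [ChartedSpace E G] [Group G]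
    [LieGroup 𝓘(ℝ, E) ∞ G] [T2Space G] [ConnectedSpace G] {A : Type*} [Ring A] [Algebra ℂ A]
    [FiniteDimensional ℂ A] (hG : IsSimplyConnectedTimesTorus G)
    {c : LieAlg E G →+ A} (hc : ∀ (r : ℝ) v, c (r • v) = (r : ℂ) • c v) {M : Subgroup Aˣ}
    {D : LieAlg E G → A} (hDsmul : ∀ (r : ℝ) μ, D (r • μ) = (r : ℂ) • D μ)
    (hD : ∀ μ v, c ⁅μ, v⁆ = D μ * c v - c v * D μ)
    (hM : ∀ μ, ∃ u ∈ M, (u : A) = algExp (D μ))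
    (hker : ∀ u ∈ M, (∀ v, (u : A) * c v = c v * u) → u = 1 ∨ u = -1) :
    ∃ τ : G →* A, ∀ μ : LieAlg E G, τ (lieExp μ) = algExp (D μ) := by
  let _ := finiteNormedRing A
  let _ := finiteNormedAlgebra A
  have : IsTopologicalGroup G := topologicalGroup_of_lieGroup 𝓘(ℝ, E) ∞
  have : CompleteSpace A := FiniteDimensional.complete ℂ A
  let _ : NormedAlgebra ℚ A := NormedAlgebra.restrictScalars ℚ ℂ A
  choose eu heuM heu using hM
  let e : LieAlg E G → adjointCover c M := fun μ => ⟨(lieExp μ, eu μ), heuM μ, fun v => by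
    rw [heu]
    exact algExp_mul_eq_lieAd_mul hc (hD μ) v⟩
  have hD0 : D 0 = 0 := by
    have := hDsmul 0 0
    rwa [smul_zero, Complex.ofReal_zero, zero_smul] at this
  have he0 : e 0 = 1 := Subtype.ext (Prod.ext lieExp_zero (Units.ext (by
    change (eu 0 : A) = 1
    rw [heu, hD0, algExp_zero])))
  have hcont : ∀ μ, Continuous fun s : ℝ => e (s • μ) := by
    intro μ
    refine Continuous.subtype_mk ((continuous_lieExp_smul μ).prodMk
      (continuous_of_continuous_val ?_)) _
    simp only [heu, hDsmul, algExp_eq_exp]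
    exact (NormedSpace.exp_continuous (𝔸 := A)).comp
      (Complex.continuous_ofReal.smul continuous_const)
  obtain ⟨hopen, hsurj⟩ := isOpenMap_adjointCover (fun _ => rfl) hcont he0
  set p := (MonoidHom.fst G Aˣ).comp (adjointCover c M).subtype with hp
  have hpcont : Continuous p := continuous_fst.comp continuous_subtype_val
  -- Over `g = 1` only `u = ±1` is possible, by `hker`.
  have hdisc : IsDiscrete (p.ker : Set (adjointCover c M)) := by
    refine Set.Finite.isDiscrete ?_
    refine Set.Finite.of_finite_image (f := Subtype.val) ?_ Subtype.val_injective.injOn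
    refine Set.Finite.subset (Set.toFinite {((1 : G), (1 : Aˣ)), (1, -1)}) ?_
    rintro _ ⟨⟨⟨g, u⟩, hu, hu'⟩, hx, rfl⟩
    have hg : g = 1 := hx
    subst hg
    rcases hker u hu fun v => by rw [hu', lieAd_one] with rfl | rfl
    · exact Or.inl rfl
    · exact Or.inr rfl
  obtain ⟨K, _, _, m, _, ⟨φ⟩⟩ := hG
  have : LocallyPathConnectedSpace G := ChartedSpace.locallyPathConnectedSpace E G
  have : LocallyPathConnectedSpace K :=
    (isOpenMap_fst.isQuotientMap continuous_fst Prod.fst_surjective |>.comp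
      φ.toHomeomorph.isQuotientMap).locallyPathConnectedSpace
  let f : K →* G := φ.symm.toMonoidHom.comp (MonoidHom.inl K (Fin m → Circle))
  have hf : Continuous f := φ.symm.continuous.comp (continuous_id.prodMk continuous_const)
  -- The factor `K` is only given a topology and a group structure; continuity of its multiplication
  -- is inherited from `G`.
  have : ContinuousMul K := ⟨by
    have h1 : (fun x : K × K => x.1 * x.2) = fun x => (φ (f x.1 * f x.2)).1 := by
      funext x
      rw [map_mul]
      change _ = ((φ (φ.symm (x.1, 1))) * (φ (φ.symm (x.2, 1)))).1
      rw [φ.apply_symm_apply, φ.apply_symm_apply]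
      rfl
    rw [h1]
    exact continuous_fst.comp (φ.continuous.comp ((hf.comp continuous_fst).mul
      (hf.comp continuous_snd)))⟩
  obtain ⟨F, hF, hpF⟩ := exists_monoidHom_lift hpcont hsurj hopen hdisc hf
  let q : G →* K := (MonoidHom.fst K (Fin m → Circle)).comp φ.toMonoidHom
  have hq : Continuous q := continuous_fst.comp φ.continuous
  let F' : G →* Aˣ := (MonoidHom.snd G Aˣ).comp ((adjointCover c M).subtype.comp (F.comp q))
  have hF' : Continuous F' := continuous_snd.comp (continuous_subtype_val.comp (hF.comp hq))
  -- `F'` ignores the torus factor. This is allowed because that factor is central in `G`, so it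
  -- acts trivially under `Ad`.
  have hmem : ∀ g, (g, F' g) ∈ adjointCover c M := by
    intro g
    refine ⟨(F (q g)).2.1, fun v => ?_⟩
    have h1 := (F (q g)).2.2 v
    have h2 : (F (q g)).1.1 = f (q g) := hpF _
    rw [h2] at h1
    have h3 : g = f (q g) * φ.symm (1, (φ g).2) := by
      apply φ.injective
      change φ g = φ (φ.symm ((φ g).1, 1) * φ.symm (1, (φ g).2))
      rw [map_mul, φ.apply_symm_apply, φ.apply_symm_apply]
      exact Prod.ext (mul_one _).symm (one_mul _).symm
    have h4 : lieAd (φ.symm (1, (φ g).2)) v = v := by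
      refine lieAd_eq_self fun s => ?_
      apply φ.injective
      rw [map_mul, map_mul, φ.apply_symm_apply]
      exact Prod.ext ((one_mul _).trans (mul_one _).symm) (mul_comm _ _)
    change (F' g : A) * c v = c (lieAd g v) * F' g
    have h5 : lieAd g v = lieAd (f (q g)) v := by
      conv_lhs => rw [h3]
      rw [lieAd_mul, h4]
    rw [h5]
    exact h1
  refine ⟨(Units.coeHom A).comp F', fun μ => ?_⟩
  -- The quotient of two lifts of `s ↦ exp(sμ)` is a continuous curve in the discrete kernel that
  -- starts at `1`; its triviality at `s = 1` is the required formula.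
  let w : ℝ → adjointCover c M := fun s =>
    (e (s • μ))⁻¹ * ⟨(lieExp (s • μ), F' (lieExp (s • μ))), hmem _⟩
  have hw : Continuous w := by
    refine (hcont μ).inv.mul (Continuous.subtype_mk ?_ _)
    exact (continuous_lieExp_smul μ).prodMk (hF'.comp (continuous_lieExp_smul μ))
  have hwker : Set.MapsTo w Set.univ (p.ker : Set (adjointCover c M)) := by
    intro s _
    change (lieExp (s • μ) : G)⁻¹ * lieExp (s • μ) = 1
    rw [inv_mul_cancel]
  have hw01 := isPreconnected_univ.constant_of_mapsTo hdisc hw.continuousOn hwker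
    (Set.mem_univ 1) (Set.mem_univ 0)
  have hw0 : w 0 = 1 := by
    have h0 : (lieExp ((0 : ℝ) • μ) : G) = 1 := by rw [zero_smul, lieExp_zero]
    have h1 : (⟨(lieExp ((0 : ℝ) • μ), F' (lieExp ((0 : ℝ) • μ))), hmem _⟩ : adjointCover c M) = 1 :=
      Subtype.ext (Prod.ext h0 ((congrArg F' h0).trans (map_one F')))
    change (e ((0 : ℝ) • μ))⁻¹ * _ = 1
    rw [h1, zero_smul, he0, inv_one, one_mul]
  rw [hw0] at hw01
  have h2 := congrArg (fun x : adjointCover c M => (x.1.2 : Aˣ)) (inv_mul_eq_one.1 hw01)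
  change eu ((1 : ℝ) • μ) = F' (lieExp ((1 : ℝ) • μ)) at h2
  rw [one_smul] at h2
  change (F' (lieExp μ) : A) = _
  rw [← h2, heu]

end SpinLift
-- A subgroup of Clifford units whose central elements are `±1`.
section SpinGroup

variable {V : Type*} [AddCommGroup V] [Module ℝ V] (B : LinearMap.BilinForm ℝ V)

/-- The even elements of norm one of the complex Clifford algebra. -/
noncomputable def evenUnits : Subgroup (Cl B)ˣ where
  carrier := {u | CliffordAlgebra.involute (u : Cl B) = u ∧
    CliffordAlgebra.reverse (u : Cl B) * u = 1}
  one_mem' := by simp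
  mul_mem' := by
    rintro u w ⟨hu, hu'⟩ ⟨hw, hw'⟩
    refine ⟨by rw [Units.val_mul, map_mul, hu, hw], ?_⟩
    rw [Units.val_mul, CliffordAlgebra.reverse.map_mul, mul_assoc,
      ← mul_assoc (CliffordAlgebra.reverse (u : Cl B)), hu', one_mul, hw']
  inv_mem' := by
    rintro u ⟨hu, hu'⟩
    constructor
    · refine Units.eq_inv_of_mul_eq_one_left ?_
      conv_lhs => rw [← hu]
      rw [← map_mul, Units.mul_inv, map_one]
    · have h := Units.mul_eq_one_iff_eq_inv.1 hu'
      rw [← h, CliffordAlgebra.reverse_reverse, h, Units.mul_inv]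

variable {B}

theorem exists_cxForm_eq {ι : Type*} [Fintype ι] [DecidableEq ι] (b : Module.Basis ι ℝ V)
    (hb : ∀ i j, B (b i) (b j) = if i = j then 1 else 0) (d : Module.Dual ℂ (Cx V)) :
    ∃ v, cxForm B v = d := by
  refine ⟨∑ i, d ((1 : ℂ) ⊗ₜ[ℝ] b i) • ((1 : ℂ) ⊗ₜ[ℝ] b i), LinearMap.ext fun z => ?_⟩
  conv_rhs => rw [← sum_cxForm_smul_basis b hb z]
  simp only [map_sum, map_smul, LinearMap.sum_apply, LinearMap.smul_apply, smul_eq_mul]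
  exact Finset.sum_congr rfl fun i _ => mul_comm _ _

/-- An even element commuting with all generators is killed by all contractions, hence is a scalar
`c`; the condition on the reversal gives `c² = 1`. -/
theorem eq_one_or_neg_one_of_mem_evenUnits [FiniteDimensional ℝ V] {ι : Type*} [Fintype ι]
    [DecidableEq ι] (b : Module.Basis ι ℝ V)
    (hb : ∀ i j, B (b i) (b j) = if i = j then 1 else 0) (hB : ∀ v w, B v w = B w v)
    {u : (Cl B)ˣ} (hu : u ∈ evenUnits B)
    (hc : ∀ v : V, (u : Cl B) * clGen B v = clGen B v * u) : u = 1 ∨ u = -1 := by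
  have h1 : ∀ z : Cx V, (u : Cl B) * clVec B z = clVec B z * u := by
    intro z
    induction z using TensorProduct.induction_on with
    | zero => rw [map_zero, mul_zero, zero_mul]
    | add x y hx hy => rw [map_add, mul_add, add_mul, hx, hy]
    | tmul a v =>
      have h : a ⊗ₜ[ℝ] v = a • ((1 : ℂ) ⊗ₜ[ℝ] v) := by
        rw [TensorProduct.smul_tmul', smul_eq_mul, mul_one]
      rw [h, map_smul, mul_smul_comm, smul_mul_assoc]
      exact congrArg (a • ·) (hc v)
  obtain ⟨c, hc'⟩ := clifford_scalar_of_clContr_eq_zero B (exists_cxForm_eq b hb) (u : Cl B)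
    fun v => by rw [← clVec_mul_sub_involute_mul B hB, hu.1, h1, sub_self]
  rcases subsingleton_or_nontrivial (Cl B) with hs | hs
  · exact Or.inl (Units.ext (Subsingleton.elim _ _))
  have h2 := hu.2
  rw [hc', CliffordAlgebra.reverse.commutes, ← map_mul, ← map_one (algebraMap ℂ (Cl B))] at h2
  rcases mul_self_eq_one_iff.1 ((algebraMap ℂ (Cl B)).injective h2) with h | h
  · exact Or.inl (Units.ext (by rw [hc', h, map_one, Units.val_one]))
  · exact Or.inr (Units.ext (by rw [hc', h, map_neg, map_one, Units.val_neg, Units.val_one]))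

/-- Reversal sends `e^D` to `e^{-D}`, its inverse. -/
theorem exists_mem_evenUnits_eq_algExp [FiniteDimensional ℝ V] {D : Cl B}
    (h1 : CliffordAlgebra.involute D = D) (h2 : CliffordAlgebra.reverse D = -D) :
    ∃ u ∈ evenUnits B, (u : Cl B) = algExp D := by
  have h3 : CliffordAlgebra.involute (algExp D) = algExp D :=
    map_algExp_congr (CliffordAlgebra.involute (Q := cliffForm B)).toLinearMap LinearMap.id D D
      fun n => by rw [AlgHom.toLinearMap_apply, map_pow, h1, LinearMap.id_apply]
  have h4 : CliffordAlgebra.reverse (algExp D) = algExp (-D) := by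
    refine map_algExp_congr (CliffordAlgebra.reverse (Q := cliffForm B)) LinearMap.id D (-D)
      fun n => ?_
    rw [LinearMap.id_apply]
    induction n with
    | zero => simp
    | succ n ih => rw [pow_succ, CliffordAlgebra.reverse.map_mul, ih, h2, ← pow_succ']
  have h5 : algExp (-D) * algExp D = 1 := by
    rw [← algExp_add_of_commute (Commute.neg_left (Commute.refl D)), neg_add_cancel, algExp_zero]
  have h6 : algExp D * algExp (-D) = 1 := by
    rw [← algExp_add_of_commute (Commute.neg_right (Commute.refl D)), add_neg_cancel, algExp_zero]
  exact ⟨⟨algExp D, algExp (-D), h6, h5⟩, ⟨h3, by rw [h4]; exact h5⟩, rfl⟩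

end SpinGroup

/-! ### Parity and reversal of the spin elements. -/

section SpinElem

variable {L ι : Type*} [LieRing L] [LieAlgebra ℝ L] [Fintype ι] [DecidableEq ι]
  {B : LinearMap.BilinForm ℝ L} (b : Module.Basis ι ℝ L)

theorem spinElem_smul (r : ℝ) (μ : L) : spinElem B b (r • μ) = (r : ℂ) • spinElem B b μ := by
  have h : ∀ z, cxLie ((1 : ℂ) ⊗ₜ[ℝ] (r • μ)) z = (r : ℂ) • cxLie ((1 : ℂ) ⊗ₜ[ℝ] μ) z := fun z => by
    rw [TensorProduct.tmul_smul, ← algebraMap_smul ℂ r ((1 : ℂ) ⊗ₜ[ℝ] μ), map_smul]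
    rfl
  simp only [spinElem, h, map_smul, mul_smul_comm, ← Finset.smul_sum]
  rw [smul_comm]

theorem involute_spinElem (μ : L) :
    CliffordAlgebra.involute (spinElem B b μ) = spinElem B b μ := by
  rw [spinElem, map_smul, map_sum]
  congr 1
  refine Finset.sum_congr rfl fun i _ => ?_
  rw [map_mul, CliffordAlgebra.involute_ι, CliffordAlgebra.involute_ι, neg_mul_neg]

/-- By invariance `b i` is orthogonal to `[μ, b i]`, so the two generators anticommute and reversing
their product changes its sign. -/
theorem reverse_spinElem (hB : ∀ v w, B v w = B w v)
    (hinv : ∀ ξ η ζ, B ⁅ξ, η⁆ ζ = B ξ ⁅η, ζ⁆) (μ : L) :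
    CliffordAlgebra.reverse (spinElem B b μ) = -spinElem B b μ := by
  rw [spinElem, map_smul, map_sum, ← smul_neg, ← Finset.sum_neg_distrib]
  congr 1
  refine Finset.sum_congr rfl fun i _ => ?_
  have h1 : B (b i) ⁅μ, b i⁆ = 0 := by
    have h2 := hinv (b i) μ (b i)
    rw [hB, ← lie_skew, map_neg, ← h2, hB] at h2
    have h3 := hinv (b i) μ (b i)
    have h4 : B ⁅b i, μ⁆ (b i) = -B (b i) ⁅μ, b i⁆ := by
      rw [← lie_skew, map_neg, LinearMap.neg_apply, hB]
    linarith
  rw [CliffordAlgebra.reverse.map_mul, CliffordAlgebra.reverse_ι, CliffordAlgebra.reverse_ι,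
    eq_neg_iff_add_eq_zero, clVec_mul_add_swap B hB, cxLie_tmul, cxForm_tmul, hB, h1]
  simp

end SpinElem

/-! ### The homomorphism `τ`, its restriction to the torus, and integrality of `ρ`. -/

section Tau

variable {F T : Type*} [NormedAddCommGroup F] [NormedSpace ℝ F] [FiniteDimensional ℝ F]
  [TopologicalSpace T] [ChartedSpace F T] [CommGroup T] [LieGroup 𝓘(ℝ, F) ∞ T] [T2Space T]
  [CompactSpace T] [ConnectedSpace T]
  {E G : Type*} [NormedAddCommGroup E] [NormedSpace ℝ E]
  [FiniteDimensional ℝ E] [TopologicalSpace G] [ChartedSpace E G] [Group G] [LieGroup 𝓘(ℝ, E) ∞ G]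
  [T2Space G] [ConnectedSpace G]

namespace RootData

variable (S : RootData E F G T)

/-- The spin elements are even, odd under reversal and induce the adjoint action, so the integration
theorem applies and `tau` is not its default value. -/
theorem tau_lieExp (hG : IsSimplyConnectedTimesTorus G) (μ : LieAlg E G) :
    S.tau (lieExp μ) = algExp (S.spinLie μ) := by
  have h : ∃ τ : G →* Cl S.form, ∀ μ : LieAlg E G, τ (lieExp μ) = algExp (S.spinLie μ) := by
    let c : LieAlg E G →+ Cl S.form :=
      { toFun := clGen S.form
        map_zero' := by rw [clGen, TensorProduct.tmul_zero, map_zero]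
        map_add' := fun v w => by rw [clGen, TensorProduct.tmul_add, map_add]; rfl }
    refine exists_monoidHom_algExp hG (c := c) (M := evenUnits S.form) ?_ ?_ ?_ ?_ ?_
    · intro r v
      change clGen S.form (r • v) = (r : ℂ) • clGen S.form v
      rw [clGen, TensorProduct.tmul_smul, ← algebraMap_smul ℂ r, map_smul]
      rfl
    · intro r μ
      rw [spinLie_eq, spinLie_eq, spinElem_smul]
    · intro μ v
      rw [spinLie_eq, eq_sub_iff_add_eq']
      have h := spinElem_mul_clVec S.basisG S.form_symm S.form_invariant S.basisG_orthonormal μ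
        (1 ⊗ₜ v)
      rw [cxLie_tmul, one_mul] at h
      exact h.symm
    · intro μ
      rw [spinLie_eq]
      exact exists_mem_evenUnits_eq_algExp (involute_spinElem _ μ)
        (reverse_spinElem _ S.form_symm S.form_invariant μ)
    · intro u hu huc
      exact eq_one_or_neg_one_of_mem_evenUnits S.basisG S.basisG_orthonormal S.form_symm hu huc
  rw [tau, dif_pos h]
  exact h.choose_spec μ

theorem clRestr_tau_incl_lieExp (hG : IsSimplyConnectedTimesTorus G) (ξ : LieAlg F T) :
    S.clRestr (S.tau (S.incl (lieExp ξ))) = algebraMap ℂ (Cl S.formT)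
      (Complex.exp (2 * Real.pi * Complex.I * (S.formT S.rho ξ : ℂ))) := by
  rw [← S.lieExp_lieMap, S.tau_lieExp hG, clRestr_algExp_spinLie]

theorem clRestr_one : S.clRestr 1 = 1 := by
  rw [clRestr_eq]
  exact clNormal_one _ _ _ _ _ _

/-- If `exp ξ = 1` then `τ` and the restriction both give `1`, so `e^{2πi⟨ρ, ξ⟩} = 1`. The global
existence of `τ` on `G` is what forces integrality. -/
theorem rho_mem_weightLattice (hG : IsSimplyConnectedTimesTorus G) : S.rho ∈ S.weightLattice := by
  intro ξ hξ
  have h1 := S.clRestr_tau_incl_lieExp hG ξ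
  rw [hξ, map_one, map_one, clRestr_one] at h1
  have h2 : Complex.exp (2 * Real.pi * Complex.I * (S.formT S.rho ξ : ℂ)) = 1 := by
    rw [← map_one (algebraMap ℂ (Cl S.formT))] at h1
    have : Nontrivial (Cl S.formT) := inferInstance
    exact ((algebraMap ℂ (Cl S.formT)).injective h1).symm
  obtain ⟨n, hn⟩ := Complex.exp_eq_one_iff.1 h2
  refine ⟨n, ?_⟩
  have h3 : (2 * Real.pi * Complex.I : ℂ) ≠ 0 := by simp [Real.pi_ne_zero]
  rw [mul_comm (n : ℂ)] at hn
  exact_mod_cast mul_left_cancel₀ h3 hn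

theorem clRestr_tau_incl (hG : IsSimplyConnectedTimesTorus G) (t : T) :
    S.clRestr (S.tau (S.incl t)) = algebraMap ℂ (Cl S.formT) (S.tpow t S.rho) := by
  obtain ⟨ξ, rfl⟩ := lieExp_surjective (F := F) t
  rw [S.clRestr_tau_incl_lieExp hG, S.tpow_lieExp (S.rho_mem_weightLattice hG)]

end RootData
end Tau
-- Graded tensor products with differential forms.
section GradedProduct

/-- The bilinear map underlying the graded tensor product of two Clifford algebras. -/
noncomputable def gradedMk {V W : Type*} [AddCommGroup V] [Module ℂ V] [AddCommGroup W]
    [Module ℂ W] (Q : QuadraticForm ℂ V) (Q' : QuadraticForm ℂ W) :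
    CliffordAlgebra Q →ₗ[ℂ] CliffordAlgebra Q' →ₗ[ℂ]
      GradedTensorProduct ℂ (CliffordAlgebra.evenOdd Q) (CliffordAlgebra.evenOdd Q') :=
  (TensorProduct.mk ℂ _ _).compr₂ (GradedTensorProduct.of ℂ _ _).toLinearMap

theorem tmul_eq_gradedMk {V W : Type*} [AddCommGroup V] [Module ℂ V] [AddCommGroup W]
    [Module ℂ W] (Q : QuadraticForm ℂ V) (Q' : QuadraticForm ℂ W) (x : CliffordAlgebra Q)
    (w : CliffordAlgebra Q') :
    (GradedTensorProduct.tmul ℂ x w :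
      GradedTensorProduct ℂ (CliffordAlgebra.evenOdd Q) (CliffordAlgebra.evenOdd Q')) =
      gradedMk Q Q' x w := rfl

/-- Moving a one-form past `s` costs the sign of the parity of `s`, which the grading involution
records for inhomogeneous `s`. -/
theorem tmul_ι_mul_tmul {V W : Type*} [AddCommGroup V] [Module ℂ V] [AddCommGroup W] [Module ℂ W]
    (Q : QuadraticForm ℂ V) (Q' : QuadraticForm ℂ W) (x s : CliffordAlgebra Q) (θ : W)
    (w : CliffordAlgebra Q') :
    (GradedTensorProduct.tmul ℂ x (CliffordAlgebra.ι Q' θ) * GradedTensorProduct.tmul ℂ s w :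
      GradedTensorProduct ℂ (CliffordAlgebra.evenOdd Q) (CliffordAlgebra.evenOdd Q')) =
      GradedTensorProduct.tmul ℂ (x * CliffordAlgebra.involute s) (CliffordAlgebra.ι Q' θ * w) := by
  induction s using DirectSum.Decomposition.inductionOn (CliffordAlgebra.evenOdd Q) with
  | zero =>
    rw [tmul_eq_gradedMk _ _ 0, map_zero, LinearMap.zero_apply, mul_zero, map_zero, mul_zero,
      tmul_eq_gradedMk, map_zero, LinearMap.zero_apply]
  | @homogeneous i m =>
    have h := GradedTensorProduct.tmul_coe_mul_coe_tmul (R := ℂ) (CliffordAlgebra.evenOdd Q)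
      (CliffordAlgebra.evenOdd Q') x ⟨_, CliffordAlgebra.ι_mem_evenOdd_one Q' θ⟩ m w
    refine h.trans ?_
    have hi : ∀ i : ZMod 2, i = 0 ∨ i = 1 := by decide
    rcases hi i with rfl | rfl
    · rw [mul_zero, uzpow_zero, one_smul, CliffordAlgebra.involute_eq_of_mem_even m.2]
    · rw [mul_one, uzpow_one, CliffordAlgebra.involute_eq_of_mem_odd m.2, mul_neg,
        tmul_eq_gradedMk, tmul_eq_gradedMk, map_neg, LinearMap.neg_apply, Units.neg_smul, one_smul]
  | add s s' h h' =>
    rw [tmul_eq_gradedMk _ _ (s + s'), map_add, LinearMap.add_apply, mul_add, ← tmul_eq_gradedMk,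
      ← tmul_eq_gradedMk, h, h', map_add, mul_add, tmul_eq_gradedMk, tmul_eq_gradedMk,
      tmul_eq_gradedMk, map_add, LinearMap.add_apply]

variable {V V' : Type*} [AddCommGroup V] [Module ℂ V] [AddCommGroup V'] [Module ℂ V']
    {Q : QuadraticForm ℂ V} {Q' : QuadraticForm ℂ V'}
    {E E' : Type*} [NormedAddCommGroup E] [NormedSpace ℝ E]
    [NormedAddCommGroup E'] [NormedSpace ℝ E']
    {G G' : Type*} [TopologicalSpace G] [ChartedSpace E G]
    [TopologicalSpace G'] [ChartedSpace E' G'] {g : G} {g' : G'}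

theorem finiteDimensional_clExt [FiniteDimensional ℝ E] [FiniteDimensional ℂ V] :
    FiniteDimensional ℂ (ClExt Q E g) := by
  have : FiniteDimensional ℝ (TangentSpace 𝓘(ℝ, E) g) := inferInstanceAs (FiniteDimensional ℝ E)
  have : FiniteDimensional ℂ (TangentSpace 𝓘(ℝ, E) g →ₗ[ℝ] ℂ) := inferInstance
  exact Module.Finite.equiv (GradedTensorProduct.of ℂ (CliffordAlgebra.evenOdd Q)
    (CliffordAlgebra.evenOdd (0 : QuadraticForm ℂ (TangentSpace 𝓘(ℝ, E) g →ₗ[ℝ] ℂ))))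

theorem clExtMap_tmul (φ : CliffordAlgebra Q →ₗ[ℂ] CliffordAlgebra Q')
    (ψ : ExtCot E g →ₗ[ℂ] ExtCot E' g') (x : CliffordAlgebra Q) (w : ExtCot E g) :
    clExtMap φ ψ (GradedTensorProduct.tmul ℂ x w) = GradedTensorProduct.tmul ℂ (φ x) (ψ w) := rfl

section Intertwining

variable {ι κ : Type*} [Fintype ι] [Fintype κ]
    {φ : CliffordAlgebra Q →ₗ[ℂ] CliffordAlgebra Q'}
    {ψ : (TangentSpace 𝓘(ℝ, E) g →ₗ[ℝ] ℂ) →ₗ[ℂ] (TangentSpace 𝓘(ℝ, E') g' →ₗ[ℝ] ℂ)}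
    (hφ : ∀ s, φ (CliffordAlgebra.involute s) = CliffordAlgebra.involute (φ s))
    {x : ι → CliffordAlgebra Q} {y : κ → CliffordAlgebra Q'} {c : κ → ι → ℂ}
    (hxy : ∀ k s, φ ((∑ a, c k a • x a) * s) = y k * φ s)
    {θ : ι → TangentSpace 𝓘(ℝ, E) g →ₗ[ℝ] ℂ} {η : κ → TangentSpace 𝓘(ℝ, E') g' →ₗ[ℝ] ℂ}
    (hθ : ∀ a, ψ (θ a) = ∑ k, c k a • η k)

include hφ hxy hθ

/-- The same matrix `c` expresses the pulled-back forms through the `η k` and combines the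
generators `x a` into those covered by `hxy`. Bilinearity moves it from one tensor factor to the
other. -/
theorem sum_gradedMk_intertwining (s : CliffordAlgebra Q) (w : ExtCot E g) :
    ∑ a, gradedMk Q' 0 (φ (x a * CliffordAlgebra.involute s))
      (ExteriorAlgebra.map ψ (ExteriorAlgebra.ι ℂ (θ a) * w)) =
    ∑ k, gradedMk Q' 0 (y k * CliffordAlgebra.involute (φ s))
      (ExteriorAlgebra.ι ℂ (η k) * ExteriorAlgebra.map ψ w) := by
  have h3 : ∀ k, gradedMk Q' 0 (y k * CliffordAlgebra.involute (φ s))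
      (ExteriorAlgebra.ι ℂ (η k) * ExteriorAlgebra.map ψ w) =
        ∑ a, gradedMk Q' 0 (φ (x a * CliffordAlgebra.involute s))
          ((c k a • ExteriorAlgebra.ι ℂ (η k)) * ExteriorAlgebra.map ψ w) := by
    intro k
    rw [← hφ, ← hxy, Finset.sum_mul, map_sum, map_sum, LinearMap.sum_apply]
    refine Finset.sum_congr rfl fun a _ => ?_
    rw [smul_mul_assoc, smul_mul_assoc, map_smul, map_smul, map_smul, LinearMap.smul_apply]
  have h5 : ∀ a, ExteriorAlgebra.map ψ (ExteriorAlgebra.ι ℂ (θ a) * w) =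
      ∑ k, (c k a • ExteriorAlgebra.ι ℂ (η k)) * ExteriorAlgebra.map ψ w := by
    intro a
    rw [← Finset.sum_mul, map_mul, ExteriorAlgebra.map_apply_ι, hθ, map_sum]
    simp only [map_smul]
  have h4 : ∀ a, gradedMk Q' 0 (φ (x a * CliffordAlgebra.involute s))
      (ExteriorAlgebra.map ψ (ExteriorAlgebra.ι ℂ (θ a) * w)) =
        ∑ k, gradedMk Q' 0 (φ (x a * CliffordAlgebra.involute s))
          ((c k a • ExteriorAlgebra.ι ℂ (η k)) * ExteriorAlgebra.map ψ w) := fun a =>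
    (congrArg _ (h5 a)).trans (map_sum _ _ _)
  exact (Fintype.sum_congr _ _ h4).trans (Finset.sum_comm.trans (Fintype.sum_congr _ _ h3).symm)

theorem clExtMap_sum_mul (v : ClExt Q E g) :
    clExtMap φ (ExteriorAlgebra.map ψ).toLinearMap
      ((∑ a, GradedTensorProduct.tmul ℂ (x a) (ExteriorAlgebra.ι ℂ (θ a)) : ClExt Q E g) * v) =
      (∑ k, GradedTensorProduct.tmul ℂ (y k) (ExteriorAlgebra.ι ℂ (η k)) : ClExt Q' E' g') *
        clExtMap φ (ExteriorAlgebra.map ψ).toLinearMap v := by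
  set Φ : ClExt Q E g →ₗ[ℂ] ClExt Q' E' g' := clExtMap φ (ExteriorAlgebra.map ψ).toLinearMap with hΦ
  have hm : ∀ (s : CliffordAlgebra Q) (w : ExtCot E g),
      Φ (gradedMk Q 0 s w) = gradedMk Q' 0 (φ s) (ExteriorAlgebra.map ψ w) := fun _ _ => rfl
  have h2 : Φ ∘ₗ LinearMap.mulLeft ℂ (∑ a, gradedMk Q 0 (x a) (CliffordAlgebra.ι 0 (θ a))) =
      LinearMap.mulLeft ℂ (∑ k, gradedMk Q' 0 (y k) (CliffordAlgebra.ι 0 (η k))) ∘ₗ Φ := by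
    refine GradedTensorProduct.hom_ext _ _ (TensorProduct.ext' fun s w => ?_)
    change Φ ((∑ a, gradedMk Q 0 (x a) (CliffordAlgebra.ι 0 (θ a))) * gradedMk Q 0 s w) =
      (∑ k, gradedMk Q' 0 (y k) (CliffordAlgebra.ι 0 (η k))) *
        gradedMk Q' 0 (φ s) (ExteriorAlgebra.map ψ w)
    have h6 : ∀ a, gradedMk Q 0 (x a) (CliffordAlgebra.ι 0 (θ a)) * gradedMk Q 0 s w =
        gradedMk Q 0 (x a * CliffordAlgebra.involute s) (CliffordAlgebra.ι 0 (θ a) * w) :=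
      fun a => tmul_ι_mul_tmul Q 0 (x a) s (θ a) w
    have h7 : ∀ k, gradedMk Q' 0 (y k) (CliffordAlgebra.ι 0 (η k)) *
        gradedMk Q' 0 (φ s) (ExteriorAlgebra.map ψ w) =
        gradedMk Q' 0 (y k * CliffordAlgebra.involute (φ s))
          (CliffordAlgebra.ι 0 (η k) * ExteriorAlgebra.map ψ w) :=
      fun k => tmul_ι_mul_tmul Q' 0 (y k) (φ s) (η k) (ExteriorAlgebra.map ψ w)
    simp only [Finset.sum_mul, map_sum, h6, h7, hm]
    exact sum_gradedMk_intertwining hφ hxy hθ s w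
  exact LinearMap.congr_fun h2 v

/-- Intertwining of the exponentials of two sums of products of a Clifford generator and a
one-form. -/
theorem clExtMap_algExp_mul [FiniteDimensional ℝ E] [FiniteDimensional ℝ E']
    [FiniteDimensional ℂ V] [FiniteDimensional ℂ V'] (z : ClExt Q E g) :
    clExtMap φ (ExteriorAlgebra.map ψ).toLinearMap
      (algExp (-∑ a, GradedTensorProduct.tmul ℂ (x a) (ExteriorAlgebra.ι ℂ (θ a)) : ClExt Q E g) * z) =
      (algExp (-∑ k, GradedTensorProduct.tmul ℂ (y k) (ExteriorAlgebra.ι ℂ (η k))) : ClExt Q' E' g') *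
        clExtMap φ (ExteriorAlgebra.map ψ).toLinearMap z := by
  have : FiniteDimensional ℂ (ClExt Q E g) := finiteDimensional_clExt
  have : FiniteDimensional ℂ (ClExt Q' E' g') := finiteDimensional_clExt
  have h1 := clExtMap_sum_mul hφ hxy hθ
  generalize (∑ a, GradedTensorProduct.tmul ℂ (x a) (ExteriorAlgebra.ι ℂ (θ a)) : ClExt Q E g) = N
    at h1 ⊢
  generalize (∑ k, GradedTensorProduct.tmul ℂ (y k) (ExteriorAlgebra.ι ℂ (η k)) :
    ClExt Q' E' g') = N' at h1 ⊢
  generalize clExtMap φ (ExteriorAlgebra.map ψ).toLinearMap = Φ at h1 ⊢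
  exact map_algExp_congr (Φ ∘ₗ LinearMap.mulRight ℂ z) (LinearMap.mulRight ℂ (Φ z)) (-N) (-N')
    fun n => by
      rw [LinearMap.comp_apply, LinearMap.mulRight_apply, LinearMap.mulRight_apply]
      induction n with
      | zero => rw [pow_zero, pow_zero, one_mul, one_mul]
      | succ n ih =>
        rw [pow_succ', pow_succ', mul_assoc, mul_assoc, neg_mul, neg_mul, map_neg, h1, ih]

end Intertwining

end GradedProduct
-- Evaluation of the restricted kernel on the torus.
section Kernels

variable {F T : Type*} [NormedAddCommGroup F] [NormedSpace ℝ F] [FiniteDimensional ℝ F]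
  [TopologicalSpace T] [ChartedSpace F T] [CommGroup T] [LieGroup 𝓘(ℝ, F) ∞ T] [T2Space T]
  {E G : Type*} [NormedAddCommGroup E] [NormedSpace ℝ E]
  [FiniteDimensional ℝ E] [TopologicalSpace G] [ChartedSpace E G] [Group G] [LieGroup 𝓘(ℝ, E) ∞ G]
  [T2Space G]

instance : FiniteDimensional ℝ (LieAlg F T) := inferInstanceAs (FiniteDimensional ℝ F)

theorem TorusData.formT_basisT_repr (S : TorusData E F G T) (ξ : LieAlg F T) :
    ∑ k, S.formT ξ (S.basisT k) • S.basisT k = ξ := by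
  have h : ∀ k, S.formT ξ (S.basisT k) = S.basisT.repr ξ k := fun k => by
    have h7 := congrArg (fun η => S.formT η (S.basisT k)) (S.basisT.sum_repr ξ)
    have h8 : ∀ l, S.formT (S.basisT l) (S.basisT k) = if l = k then 1 else 0 := fun l =>
      S.basisT_orthonormal l k
    simp only [map_sum, map_smul, LinearMap.sum_apply, LinearMap.smul_apply, h8, smul_eq_mul,
      mul_ite, mul_one, mul_zero, Finset.sum_ite_eq', Finset.mem_univ, if_true] at h7
    exact h7.symm
  simp only [h, S.basisT.sum_repr]

theorem TorusData.tpow_add [ConnectedSpace T] (S : TorusData E F G T) {ν ν' : LieAlg F T} (hν : ν ∈ S.weightLattice)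
    (hν' : ν' ∈ S.weightLattice) (hνν' : ν + ν' ∈ S.weightLattice) (t : T) :
    S.tpow t (ν + ν') = S.tpow t ν * S.tpow t ν' := by
  obtain ⟨ξ, rfl⟩ := lieExp_surjective (F := F) t
  rw [S.tpow_lieExp hν, S.tpow_lieExp hν', S.tpow_lieExp hνν', ← Complex.exp_add, map_add,
    LinearMap.add_apply]
  push_cast
  ring_nf

namespace RootData

variable (S : RootData E F G T)

theorem clGen_lieMap_eq_sum (ξ : LieAlg F T) :
    clGen S.form (lieMap S.incl ξ : LieAlg E G) =
      ∑ a, ((S.form (lieMap S.incl ξ) (S.basisG a) : ℝ) : ℂ) • clGen S.form (S.basisG a) := by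
  have h2 : ∀ a, S.form (lieMap S.incl ξ) (S.basisG a) = S.basisG.repr (lieMap S.incl ξ) a :=
    fun a => by
      have h7 := congrArg (S.form (S.basisG a)) (S.basisG.sum_repr (lieMap S.incl ξ))
      simp only [map_sum, map_smul, S.basisG_orthonormal, smul_eq_mul, mul_ite, mul_one, mul_zero,
        Finset.sum_ite_eq, Finset.mem_univ, if_true] at h7
      rw [S.form_symm, h7]
  simp only [h2]
  conv_lhs => rw [← S.basisG.sum_repr (lieMap S.incl ξ)]
  rw [clGen, TensorProduct.tmul_sum, map_sum]
  refine Finset.sum_congr rfl fun a _ => ?_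
  rw [TensorProduct.tmul_smul, ← algebraMap_smul ℂ (S.basisG.repr (lieMap S.incl ξ) a), map_smul]
  rfl

/-- The right-invariant Maurer-Cartan form of `G` restricts to the Maurer-Cartan form of `T`. -/
theorem cotPullback_mcRight (t : T) (a : Fin (Module.finrank ℝ E)) :
    S.cotPullback t (S.mcRight (S.incl t) a) =
      ∑ k, ((S.form (lieMap S.incl (S.basisT k)) (S.basisG a) : ℝ) : ℂ) • S.mcTorus t k := by
  have : LieGroup 𝓘(ℝ, E) 1 G := LieGroup.of_le (n := ∞) (by norm_num)
  have h1 : MDifferentiableAt 𝓘(ℝ, E) 𝓘(ℝ, E) (fun h : G => h * (S.incl t)⁻¹) (S.incl t) :=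
    (contMDiff_mul_right (I := 𝓘(ℝ, E)) (n := 1)).mdifferentiableAt (by norm_num)
  have h2 : ∀ s, MDifferentiableAt 𝓘(ℝ, F) 𝓘(ℝ, E) S.incl s := fun s =>
    S.incl_smooth.mdifferentiableAt (by norm_num)
  have h3 := hasMFDerivAt_comp_of_eq (E₁ := F) (E₂ := E) (E₃ := E) h1.hasMFDerivAt
    (h2 t).hasMFDerivAt rfl
  have h4 := hasMFDerivAt_comp_of_eq (E₁ := F) (E₂ := F) (E₃ := E) (h2 1).hasMFDerivAt
    (mdifferentiableAt_mul_left (E := F) t⁻¹ t).hasMFDerivAt (inv_mul_cancel t)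
  -- `T` is abelian, so left and right translation agree on it; differentiating this identity at `t`
  -- compares the two Maurer-Cartan forms.
  have h5 : (fun z => S.incl (t⁻¹ * z)) = fun z => S.incl z * (S.incl t)⁻¹ := by
    funext z
    rw [mul_comm, map_mul, map_inv]
  rw [h5] at h4
  have h6 := hasMFDerivAt_unique h3 h4
  refine LinearMap.ext fun w => ?_
  let θ : LieAlg F T := (mfderiv 𝓘(ℝ, F) 𝓘(ℝ, F) (fun s : T => t⁻¹ * s) t w : F)
  have h7 : S.cotPullback t (S.mcRight (S.incl t) a) w =
      ((S.form (lieMap S.incl θ) (S.basisG a) : ℝ) : ℂ) :=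
    congrArg (fun v : LieAlg E G => ((S.form v (S.basisG a) : ℝ) : ℂ))
      (congrArg (fun f : F →L[ℝ] E => f w) h6)
  rw [h7, LinearMap.sum_apply]
  have h8 : ∀ k, S.mcTorus t k w = ((S.formT θ (S.basisT k) : ℝ) : ℂ) := fun k => rfl
  conv_lhs => rw [← S.formT_basisT_repr θ]
  rw [map_sum, map_sum, LinearMap.sum_apply]
  push_cast
  refine Finset.sum_congr rfl fun k _ => ?_
  rw [LinearMap.smul_apply, h8, map_smul, map_smul, LinearMap.smul_apply, smul_eq_mul, smul_eq_mul,
    Complex.ofReal_mul, mul_comm]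

theorem HighestWeightRep.spherical_incl {S : RootData E F G T} {wt : LieAlg F T}
    (V : S.HighestWeightRep wt) (t : T) :
    (V.spherical : G → ℂ) (S.incl t) = S.tpow t wt := by
  change inner ℂ V.vec (V.rep (S.incl t) V.vec) = _
  rw [V.vec_weight, inner_smul_right, inner_self_eq_norm_sq_to_K, V.vec_unit]
  simp

/-- At `ν = λ + ρ` the coefficient is `Δ_λ(t) = t^{ν-ρ}`, and the factor `t^ρ` restores `t^ν`. -/
theorem distrRestr_delta [ConnectedSpace T] (V : ∀ wt : S.dominant, S.HighestWeightRep wt)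
    (hρ : S.rho ∈ S.weightLattice) (t : T) :
    S.tpow t S.rho • S.distrRestr V (delta (S.incl t)) =
      (S.szego (S.torusDelta t) : S.FourierSeries) := by
  classical
  funext ν
  change S.tpow t S.rho * (if h : (ν : LieAlg F T) - S.rho ∈ S.dominant
    then ((V ⟨_, h⟩).spherical : G → ℂ) (S.incl t) else 0) =
      if (ν : LieAlg F T) - S.rho ∈ S.dominant then S.tpow t ν else 0
  split_ifs with h
  · rw [HighestWeightRep.spherical_incl, mul_comm, ← S.tpow_add h.1 hρ]
    · rw [sub_add_cancel]
    · rw [sub_add_cancel]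
      exact ν.2
  · rw [mul_zero]

/-- The pulled-back Maurer-Cartan form has values in `t`, so only generators `x_ξ` with `ξ` in `t`
meet the twisted projection, and these pass through it on the left. -/
theorem clExtMap_clExtMap_algExp_mul [CompactSpace T] [ConnectedSpace T] (t : T) (y : Cl S.form) :
    clExtMap LinearMap.id (ExteriorAlgebra.map (S.cotPullback t)).toLinearMap
      (clExtMap S.clRestr LinearMap.id
        ((algExp (-∑ a, GradedTensorProduct.tmul ℂ (clGen S.form (S.basisG a))
          (ExteriorAlgebra.ι ℂ (S.mcRight (S.incl t) a))) *
          GradedTensorProduct.tmul ℂ y 1 : ClExt (cliffForm S.form) E (S.incl t)))) =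
      (algExp (-∑ k, GradedTensorProduct.tmul ℂ (clGen S.formT (S.basisT k))
        (ExteriorAlgebra.ι ℂ (S.mcTorus t k))) *
        GradedTensorProduct.tmul ℂ (S.clRestr y) 1 : ClExt (cliffForm S.formT) F t) := by
  have h1 : ∀ z : ClExt (cliffForm S.form) E (S.incl t),
      clExtMap LinearMap.id (ExteriorAlgebra.map (S.cotPullback t)).toLinearMap
        (clExtMap S.clRestr LinearMap.id z) =
      (clExtMap S.clRestr (ExteriorAlgebra.map (S.cotPullback t)).toLinearMap z :
        ClExt (cliffForm S.formT) F t) := by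
    intro z
    refine LinearMap.congr_fun (f := clExtMap LinearMap.id
      (ExteriorAlgebra.map (S.cotPullback t)).toLinearMap ∘ₗ clExtMap S.clRestr LinearMap.id) ?_ z
    exact GradedTensorProduct.hom_ext _ _ (TensorProduct.ext' fun s w => rfl)
  rw [h1, clExtMap_algExp_mul (g := S.incl t) (g' := t) S.clRestr_involute
    (y := fun k => clGen S.formT (S.basisT k)) (η := S.mcTorus t) ?_ (S.cotPullback_mcRight t),
    clExtMap_tmul, AlgHom.toLinearMap_apply, map_one]
  intro k s
  rw [← clGen_lieMap_eq_sum, clRestr_clGen_lieMap_mul]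

theorem formPullback_weilRestr_kernelG [CompactSpace T] [ConnectedSpace T] [ConnectedSpace G]
    (hG : IsSimplyConnectedTimesTorus G) (V : ∀ wt : S.dominant, S.HighestWeightRep wt) (t : T) :
    S.formPullback (S.weilRestr V S.kernelG) t =
      TensorProduct.map S.hardy.subtype LinearMap.id (S.kernelT t) := by
  change S.distrRestr V (delta (S.incl t)) ⊗ₜ[ℂ] clExtMap LinearMap.id
    (ExteriorAlgebra.map (S.cotPullback t)).toLinearMap (clExtMap S.clRestr LinearMap.id _) =
      (S.szego (S.torusDelta t) : S.FourierSeries) ⊗ₜ[ℂ] _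
  -- The scalar `t^ρ` from the Clifford factor is moved across the tensor product, where it
  -- completes `r_G^T(δ_t)` to `δ_t⁻`.
  rw [S.clExtMap_clExtMap_algExp_mul, S.clRestr_tau_incl hG,
    ← S.distrRestr_delta V (S.rho_mem_weightLattice hG), TensorProduct.smul_tmul]
  congr 1
  change _ * algebraMap ℂ (ClExt (cliffForm S.formT) F t) (S.tpow t S.rho) = _
  rw [← Algebra.commutes, ← Algebra.smul_def]
  rfl

end RootData
end Kernels
end GroupLocalization

theorem mainTheorem7 {E F G T : Type*}
    [NormedAddCommGroup E] [NormedSpace ℝ E] [FiniteDimensional ℝ E]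
    [NormedAddCommGroup F] [NormedSpace ℝ F] [FiniteDimensional ℝ F]
    [TopologicalSpace G] [ChartedSpace E G] [Group G] [LieGroup 𝓘(ℝ, E) ∞ G]
    [CompactSpace G] [ConnectedSpace G] [T2Space G]
    [TopologicalSpace T] [ChartedSpace F T] [CommGroup T] [LieGroup 𝓘(ℝ, F) ∞ T]
    [CompactSpace T] [ConnectedSpace T] [T2Space T]
    (hG : GroupLocalization.IsSimplyConnectedTimesTorus G)
    (S : GroupLocalization.RootData E F G T)
    (V : ∀ wt : S.dominant, S.HighestWeightRep wt) :
    (∀ t : T, S.formPullback (S.weilRestr V S.kernelG) t =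
      TensorProduct.map S.hardy.subtype LinearMap.id (S.kernelT t)) ∧
    S.rho ∈ S.weightLattice ∧
    (∀ t : T, S.clRestr (S.tau (S.incl t)) =
      algebraMap ℂ (GroupLocalization.Cl S.formT) (S.tpow t S.rho)) :=
  ⟨S.formPullback_weilRestr_kernelG hG V, S.rho_mem_weightLattice hG, S.clRestr_tau_incl hG⟩
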